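/- Let $k$ be an algebraically closed field of characteristic zero, $K=k((z))$, $n\in\mathbb N$, and $\overline K=\bigcup_{m\ge 1}k((z^{1/m}))$, an algebraic closure of $K$. Let $\gamma$ be a procyclic (topological) generator of $\mathrm{Gal}(\overline K/K)$. **Connections.** An $\mathrm{SL}_n$-connection is an expression $A\,d\log z$ with $A\in\mathfrak{sl}_n(K)$. The group $\mathrm{SL}_n(K)$ acts on connections by $g[A\,d\log z]=(gAg^{-1}+z\partial_z(g)g^{-1})\,d\log z$; orbits are called gauge equivalence classes and denoted $[\,\cdot\,]$. A connection is regular if it is gauge equivalent to some $A\,d\log z$ with $A\in\mathfrak{sl}_n(k[[z]])$. For $m\ge1$ let $i_m:K\to K$, $f(z)\mapsto f(z^m)$, and $i_m(A(z)\,d\log z)=mA(z^m)\,d\log z$. Connections $A,B$ are related if $i_m(A)$ and $i_m(B)$ are gauge equivalent for some $m\ge1$; $\mathrm{Rel}(A)$ is the set of connections related to $A$. **Jordan matrices.** Let $\mathcal J(\mathfrak{sl}_n^{\mathrm{zero}})$ be the set of matrices $X\in\mathfrak{sl}_n(k)$ in Jordan normal form such that $\mathrm{ad}\,X$ (on $\mathfrak{sl}_n(k)$)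 has no nonzero rational eigenvalue. Two matrices $X=\mathrm{blockdiag}(J(x_1,a_1),\dots,J(x_r,a_r))$ and $Y=\mathrm{blockdiag}(J(y_1,b_1),\dots,J(y_s,b_s))$ in Jordan normal form differ rationally after block permutation if $r=s$ and there is a permutation $\tau$ with $a_i=b_{\tau(i)}$ and $x_i-y_{\tau(i)}\in\mathbb Q$ for all $i$. **The groups $D_X$ and $W_X$.** For $X$ in Jordan normal form let $T_X$ be the group of diagonal matrices in the centralizer $Z_{\mathrm{GL}_n}(X)\subset\mathrm{GL}_n(k)$ and $D_X=T_X\cap\mathrm{SL}_n(k)$. Put $E_\lambda^i=\ker(X-\lambda)\cap\mathrm{im}\,(X-\lambda)^i$ and let $\pi:Z_{\mathrm{GL}_n}(X)\to\prod_{\lambda\in k,\,i\ge0}\mathrm{GL}(E_\lambda^i/E_\lambda^{i+1})$ be the natural homomorphism. Then $\pi|_{T_X}$ is injective, and $W_X$ is the Weyl group of the maximal torus $\pi(T_X)$ of this product; it acts on $T_X$ via $\pi|_{T_X}$, and on $D_X$. **The map.** Let $X\in\mathcal J(\mathfrak{sl}_n^{\mathrm{zero}})$ and let $B\in\mathrm{Rel}(X\,d\log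 z)$. For $l\ge1$ identify $i_l$ with the extension $K\subset L=k((z^{1/l}))\subset\overline K$. Choose $l\ge 1$ and $b\in\mathrm{SL}_n(L)$ with $b[i_l(B)]=i_l(X\,d\log z)$. The value at $\gamma$ of the cocycle $\sigma\mapsto b\,\sigma(b^{-1})$ is a torsion element of $Z_{\mathrm{SL}_n}(X)\subset\mathrm{SL}_n(k)$, whose conjugacy class in $Z_{\mathrm{SL}_n}(X)$ depends only on $[B]$ and meets $D_X$ in exactly one $W_X$-orbit. This gives a bijection from $\mathrm{Rel}(X\,d\log z)/\mathrm{SL}_n(K)$ onto $\{\text{torsion elements of }D_X\}/W_X$, whose inverse is denoted $\delta\mapsto[(X\,d\log z)^\delta]$. **Theorem.** The map $$\coprod_{X\in\mathcal J(\mathfrak{sl}_n^{\mathrm{zero}})}\{\text{torsion elements of }D_X\}/W_X\;\longrightarrow\;\{\text{regular }\mathrm{SL}_n\text{-connections}\}/\mathrm{SL}_n(K),\qquad \delta\mapsto[(X\,d\log z)^\delta],$$ is well defined and surjective. For $X,Y\in\mathcal J(\mathfrak{sl}_n^{\mathrm{zero}})$ the connections $X\,d\log z$ and $Y\,d\log z$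 are related if and only if $X$ and $Y$ differ rationally after block permutation; in this case there is a unique map $$\mathrm{can}_{YX}:\{\text{torsion elements of }D_X\}/W_X\to\{\text{torsion elements of }D_Y\}/W_Y$$ with $[(Y\,d\log z)^{\mathrm{can}_{YX}(\delta)}]=[(X\,d\log z)^\delta]$ for all $\delta$, and it is bijective. Finally, for all $X,Y\in\mathcal J(\mathfrak{sl}_n^{\mathrm{zero}})$, $\delta\in\{\text{torsion elements of }D_X\}/W_X$ and $\epsilon\in\{\text{torsion elements of }D_Y\}/W_Y$, $$[(X\,d\log z)^\delta]=[(Y\,d\log z)^\epsilon]\iff X\text{ and }Y\text{ differ rationally after block permutation and }\mathrm{can}_{YX}(\delta)=\epsilon.$$ -/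

import Mathlib

noncomputable section

namespace RegSL

open Matrix LieAlgebra.SpecialLinear

/-! ### The field `K = k((z))`, its coverings and its algebraic closure -/

section Fields

variable (k : Type*) [Field k]

/-- The field of Laurent series `K = k((z))`. -/
abbrev LField : Type _ := LaurentSeries k

/-- The endomorphism `f(z) ↦ f(z ^ m)` of `k((z))`, for a positive integer `m`. -/
def incl (m : ℕ+) : LField k →+* LField k :=
  HahnSeries.embDomainRingHom (AddMonoidHom.mulLeft (m : ℤ))
    (fun i j h => by simpa using h)
    (fun i j => by simp)

/-- The embedding `f(z) ↦ f(z ^ (1 / m))` of `k((z))` into the Hahn series with rational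
exponents. -/
def rootEmb (m : ℕ+) : LField k →+* HahnSeries ℚ k :=
  HahnSeries.embDomainRingHom
    ((AddMonoidHom.mulLeft ((m : ℚ)⁻¹)).comp (Int.castAddHom ℚ))
    (fun i j h => by simpa using h)
    (fun i j => by
      have hm : (0 : ℚ) < (m : ℚ)⁻¹ := by positivity
      simp [mul_le_mul_iff_right₀ hm])

/-- The field of Puiseux series, the union of the fields `k((z ^ (1 / m)))`, `m ≥ 1`
(the supremum of this directed family of subfields is its union, see `mem_puiseuxSubfield`). -/
def puiseuxSubfield : Subfield (HahnSeries ℚ k) := ⨆ m : ℕ+, (rootEmb k m).fieldRange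

/-- The field of Puiseux series; an algebraic closure of `k((z))` if `k` is algebraically closed of
characteristic zero. -/
abbrev KBar : Type _ := puiseuxSubfield k

/-- The embedding `k((z)) → KBar`, `f(z) ↦ f(z ^ (1 / m))`. -/
def iota (m : ℕ+) : LField k →+* KBar k :=
  (rootEmb k m).codRestrict (puiseuxSubfield k)
    (fun f => (le_iSup (fun m : ℕ+ => (rootEmb k m).fieldRange) m) ⟨f, rfl⟩)

/-- `KBar` as an extension of `K = k((z))`. -/
instance : Algebra (LField k) (KBar k) := (iota k 1).toAlgebra

theorem rootEmb_comp_incl (m d : ℕ+) (f : LField k) :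
    rootEmb k (m * d) (incl k d f) = rootEmb k m f := by
  have hd : (d : ℚ) ≠ 0 := by exact_mod_cast d.ne_zero
  have hm : (m : ℚ) ≠ 0 := by exact_mod_cast m.ne_zero
  have key : ∀ i : ℤ, ((m * d : ℕ+) : ℚ)⁻¹ * (((d : ℤ) * i : ℤ) : ℚ) = (m : ℚ)⁻¹ * (i : ℚ) := by
    intro i
    push_cast
    field_simp
  ext q
  by_cases hq : ∃ i : ℤ, q = (m : ℚ)⁻¹ * (i : ℚ)
  · obtain ⟨i, rfl⟩ := hq
    have h1 : (rootEmb k m f).coeff ((m : ℚ)⁻¹ * (i : ℚ)) = f.coeff i :=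
      HahnSeries.embDomain_coeff (a := i)
    have h2 : (rootEmb k (m * d) (incl k d f)).coeff
        (((m * d : ℕ+) : ℚ)⁻¹ * (((d : ℤ) * i : ℤ) : ℚ)) = (incl k d f).coeff ((d : ℤ) * i) :=
      HahnSeries.embDomain_coeff (a := (d : ℤ) * i)
    have h3 : (incl k d f).coeff ((d : ℤ) * i) = f.coeff i :=
      HahnSeries.embDomain_coeff (a := i)
    rw [h1, ← key, h2, h3]
  · have h1 : (rootEmb k m f).coeff q = 0 := by
      apply HahnSeries.embDomain_of_notMem_range
      rintro ⟨i, hi⟩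
      exact hq ⟨i, hi.symm⟩
    rw [h1]
    by_cases hq' : ∃ j : ℤ, q = ((m * d : ℕ+) : ℚ)⁻¹ * (j : ℚ)
    · obtain ⟨j, rfl⟩ := hq'
      have h2 : (rootEmb k (m * d) (incl k d f)).coeff
          (((m * d : ℕ+) : ℚ)⁻¹ * (j : ℚ)) = (incl k d f).coeff j :=
        HahnSeries.embDomain_coeff (a := j)
      rw [h2]
      apply HahnSeries.embDomain_of_notMem_range
      rintro ⟨i, hi⟩
      apply hq
      refine ⟨i, ?_⟩
      rw [← key, ← show (d : ℤ) * i = j from hi]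
    · apply HahnSeries.embDomain_of_notMem_range
      rintro ⟨i, hi⟩
      exact hq' ⟨i, hi.symm⟩

theorem mem_puiseuxSubfield (x : HahnSeries ℚ k) :
    x ∈ puiseuxSubfield k ↔ ∃ (m : ℕ+) (f : LField k), rootEmb k m f = x := by
  have hdir : Directed (· ≤ ·) (fun m : ℕ+ => (rootEmb k m).fieldRange) := by
    intro a b
    refine ⟨a * b, ?_, ?_⟩
    · rintro _ ⟨f, rfl⟩
      exact ⟨incl k b f, rootEmb_comp_incl k a b f⟩
    · rintro _ ⟨f, rfl⟩
      refine ⟨incl k a f, ?_⟩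
      rw [mul_comm]
      exact rootEmb_comp_incl k b a f
  unfold puiseuxSubfield
  rw [Subfield.mem_iSup_of_directed hdir]
  rfl

/-- The absolute Galois group `Gal(KBar / K)`. -/
abbrev AbsGal : Type _ := KBar k ≃ₐ[LField k] KBar k

/-- `γ` is a procyclic generator: the subgroup generated by `γ` is dense for the Krull topology. -/
def IsProcyclicGenerator (γ : AbsGal k) : Prop :=
  Dense ((Subgroup.zpowers γ : Subgroup (AbsGal k)) : Set (AbsGal k))

/-- The derivation `z ∂_z = z d/dz` of `k((z))`. -/
def euler : LField k →+ LField k :=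
  (AddMonoidHom.mulLeft (HahnSeries.single (1 : ℤ) (1 : k) : LField k)).comp
    (LaurentSeries.derivative k).toAddMonoidHom

theorem euler_coeff (f : LField k) (i : ℤ) : (euler k f).coeff i = (i : k) * f.coeff i := by
  have h : i = (i - 1) + 1 := by ring
  change ((HahnSeries.single (1 : ℤ) (1 : k) : LField k) * LaurentSeries.derivative k f).coeff i = _
  rw [h, HahnSeries.coeff_single_mul_add]
  simp

theorem euler_mul (f g : LField k) : euler k (f * g) = euler k f * g + f * euler k g := by
  have hs : ∀ h : LField k, (euler k h).support ⊆ h.support := by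
    intro h i hi hz
    apply hi
    rw [euler_coeff, hz, mul_zero]
  ext i
  rw [euler_coeff, HahnSeries.coeff_add,
    HahnSeries.coeff_mul_left' f.isPWO_support (hs f),
    HahnSeries.coeff_mul_right' g.isPWO_support (hs g), HahnSeries.coeff_mul,
    Finset.mul_sum, ← Finset.sum_add_distrib]
  refine Finset.sum_congr rfl fun p hp => ?_
  have hp' : p.1 + p.2 = i := (Finset.mem_antidiagonal.1 hp).2.2
  rw [euler_coeff, euler_coeff, ← hp']
  push_cast
  ring

end Fields

/-! ### Connections and the gauge action -/

section Connections

variable (n : ℕ) (k : Type*) [Field k]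

/-- `SL_n`-connections on the infinitesimal punctured disc. The matrix `A ∈ 𝔰𝔩_n(K)` stands for the
connection `A dlog z = A z⁻¹ dz`; every connection has a unique such expression. -/
abbrev Conn : Type _ := sl (Fin n) (LField k)

variable {n k}

/-- `z ∂_z` applied to all entries of a matrix. -/
def eulerMat (g : Matrix (Fin n) (Fin n) (LField k)) : Matrix (Fin n) (Fin n) (LField k) :=
  g.map (euler k)

theorem eulerMat_mul (g h : Matrix (Fin n) (Fin n) (LField k)) :
    eulerMat (g * h) = eulerMat g * h + g * eulerMat h := by
  ext1 i j
  simp only [eulerMat, Matrix.map_apply, Matrix.mul_apply, Matrix.add_apply, map_sum, euler_mul,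
    Finset.sum_add_distrib]

theorem euler_one : euler k 1 = 0 := by
  have h := euler_mul k 1 1
  simpa using h

theorem eulerMat_one : eulerMat (1 : Matrix (Fin n) (Fin n) (LField k)) = 0 := by
  ext1 i j
  by_cases h : i = j
  · subst h
    simp [eulerMat, euler_one]
  · simp [eulerMat, h]

theorem euler_prod {ι : Type*} [DecidableEq ι] (s : Finset ι) (f : ι → LField k) :
    euler k (∏ i ∈ s, f i) = ∑ i ∈ s, euler k (f i) * ∏ j ∈ s.erase i, f j := by
  induction s using Finset.induction_on with
  | empty => simp [euler_one]
  | insert a s ha ih =>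
    rw [Finset.prod_insert ha, euler_mul, ih, Finset.sum_insert ha, Finset.erase_insert ha,
      Finset.mul_sum]
    congr 1
    refine Finset.sum_congr rfl fun i hi => ?_
    have hne : a ≠ i := fun h => ha (h ▸ hi)
    rw [Finset.erase_insert_of_ne hne,
      Finset.prod_insert (fun h => ha (Finset.mem_of_mem_erase h))]
    ring

theorem euler_det (g : Matrix (Fin n) (Fin n) (LField k)) :
    euler k g.det = (eulerMat g * g.adjugate).trace := by
  have hR : (eulerMat g * g.adjugate).trace
      = ∑ i, (g.updateCol i (fun j => eulerMat g j i)).det := by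
    rw [Matrix.trace_mul_comm, Matrix.trace]
    refine Finset.sum_congr rfl fun i _ => ?_
    rw [← Matrix.cramer_apply, Matrix.cramer_eq_adjugate_mulVec]
    rfl
  rw [hR, Matrix.det_apply', map_sum]
  simp only [Matrix.det_apply']
  rw [Finset.sum_comm]
  refine Finset.sum_congr rfl fun σ _ => ?_
  rw [← Finset.mul_sum]
  have hsign : ∀ f : LField k, euler k (((Equiv.Perm.sign σ : ℤ) : LField k) * f)
      = ((Equiv.Perm.sign σ : ℤ) : LField k) * euler k f := by
    intro f
    rcases Int.units_eq_one_or (Equiv.Perm.sign σ) with h | h <;> simp [h]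
  rw [hsign, euler_prod]
  congr 1
  refine Finset.sum_congr rfl fun i _ => ?_
  rw [← Finset.mul_prod_erase Finset.univ _ (Finset.mem_univ i)]
  congr 1
  · simp [eulerMat]
  · refine Finset.prod_congr rfl fun j hj => ?_
    rw [Matrix.updateCol_ne (Finset.ne_of_mem_erase hj)]

/-- The gauge action `g[A dlog z] = (g A g⁻¹ + z ∂_z(g) g⁻¹) dlog z` of `SL_n(K)`. -/
def gauge (g : Matrix.SpecialLinearGroup (Fin n) (LField k)) (A : Conn n k) : Conn n k :=
  ⟨(g : Matrix (Fin n) (Fin n) (LField k)) * A.1 * (g⁻¹ : Matrix.SpecialLinearGroup (Fin n) (LField k)) +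
      eulerMat (g : Matrix (Fin n) (Fin n) (LField k)) *
        (g⁻¹ : Matrix.SpecialLinearGroup (Fin n) (LField k)), by
    have hA : A.1.trace = 0 := A.2
    have h1 : ((g : Matrix (Fin n) (Fin n) (LField k)) * A.1 *
        (g⁻¹ : Matrix.SpecialLinearGroup (Fin n) (LField k))).trace = 0 := by
      rw [Matrix.trace_mul_comm, ← Matrix.mul_assoc, ← Matrix.SpecialLinearGroup.coe_mul,
        inv_mul_cancel, Matrix.SpecialLinearGroup.coe_one, Matrix.one_mul, hA]
    have h2 : (eulerMat (g : Matrix (Fin n) (Fin n) (LField k)) *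
        (g⁻¹ : Matrix.SpecialLinearGroup (Fin n) (LField k))).trace = 0 := by
      rw [Matrix.SpecialLinearGroup.coe_inv, ← euler_det, Matrix.SpecialLinearGroup.det_coe, euler_one]
    refine LinearMap.mem_ker.2 ?_
    rw [Matrix.traceLinearMap_apply, Matrix.trace_add, h1, h2, add_zero]⟩

theorem gauge_one (A : Conn n k) : gauge 1 A = A := by
  apply Subtype.ext
  simp [gauge, eulerMat_one]

theorem gauge_mul (g h : Matrix.SpecialLinearGroup (Fin n) (LField k)) (A : Conn n k) :
    gauge (g * h) A = gauge g (gauge h A) := by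
  apply Subtype.ext
  have hh : (h : Matrix (Fin n) (Fin n) (LField k)) *
      (h⁻¹ : Matrix.SpecialLinearGroup (Fin n) (LField k)) = 1 := by
    rw [← Matrix.SpecialLinearGroup.coe_mul, mul_inv_cancel, Matrix.SpecialLinearGroup.coe_one]
  have hc : ∀ M : Matrix (Fin n) (Fin n) (LField k), (h : Matrix (Fin n) (Fin n) (LField k)) *
      ((h⁻¹ : Matrix.SpecialLinearGroup (Fin n) (LField k)) * M) = M := fun M => by
    rw [← Matrix.mul_assoc, hh, Matrix.one_mul]
  simp only [gauge, Matrix.SpecialLinearGroup.coe_mul, _root_.mul_inv_rev, eulerMat_mul, Matrix.add_mul,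
    Matrix.mul_add, Matrix.mul_assoc, hc]
  abel

/-- Gauge equivalence of connections. -/
def GaugeEquiv (A B : Conn n k) : Prop := ∃ g, gauge g A = B

variable (n k) in
/-- Gauge equivalence as an equivalence relation. -/
def gaugeSetoid : Setoid (Conn n k) where
  r := GaugeEquiv
  iseqv :=
    { refl := fun A => ⟨1, gauge_one A⟩
      symm := by
        rintro A B ⟨g, rfl⟩
        exact ⟨g⁻¹, by rw [← gauge_mul, inv_mul_cancel, gauge_one]⟩
      trans := by
        rintro A B C ⟨g, rfl⟩ ⟨h, rfl⟩
        exact ⟨h * g, gauge_mul h g A⟩ }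

variable (n k) in
/-- The set of `SL_n`-connections up to `SL_n(K)`-gauge equivalence. -/
def GaugeClass : Type _ := Quotient (gaugeSetoid n k)

/-- The gauge equivalence class of a connection. -/
def gaugeClass (A : Conn n k) : GaugeClass n k := Quotient.mk (gaugeSetoid n k) A

/-- Connections of the first kind: all entries of `A` are power series. -/
def IsFirstKind (A : Conn n k) : Prop :=
  ∀ i j, ∃ f : PowerSeries k, A.1 i j = HahnSeries.ofPowerSeries ℤ k f

/-- A connection is regular if it is gauge equivalent to a connection of the first kind. -/
def IsRegular (A : Conn n k) : Prop := ∃ B, IsFirstKind B ∧ GaugeEquiv A B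

/-- The pull-back of connections along `f(z) ↦ f(z ^ m)`: it sends `A(z) dlog z` to
`m A(z ^ m) dlog z`. -/
def pullback (m : ℕ+) (A : Conn n k) : Conn n k :=
  ⟨((m : ℕ) : LField k) • A.1.map (incl k m), by
    have hA : A.1.trace = 0 := A.2
    change (((m : ℕ) : LField k) • A.1.map (incl k m)).trace = 0
    rw [Matrix.trace_smul, ← AddMonoidHom.map_trace, hA, map_zero, smul_zero]⟩

/-- Two connections are related if some pull-backs of them are gauge equivalent. -/
def Related (A B : Conn n k) : Prop := ∃ m : ℕ+, GaugeEquiv (pullback m A) (pullback m B)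

/-- The connection `X dlog z` for `X ∈ 𝔰𝔩_n(k)`. -/
def constConn (X : sl (Fin n) k) : Conn n k :=
  ⟨X.1.map (HahnSeries.C : k →+* LField k), by
    have hX : X.1.trace = 0 := X.2
    change (X.1.map (HahnSeries.C : k →+* LField k)).trace = 0
    rw [← AddMonoidHom.map_trace, hX, map_zero]⟩

/-- The set `Rel(A) / SL_n(K)` of gauge equivalence classes of relatives of `A`. -/
def relClasses (A : Conn n k) : Set (GaugeClass n k) := {c | ∃ B, Related A B ∧ gaugeClass B = c}

variable (n k) in
/-- The set of gauge equivalence classes of regular connections. -/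
def regularClasses : Set (GaugeClass n k) := {c | ∃ B, IsRegular B ∧ gaugeClass B = c}

end Connections

/-! ### Jordan matrices -/

section Jordan

variable {n : ℕ} {k : Type*} [Field k]

/-- The Jordan block of size `a` with eigenvalue `x` and ones above the diagonal. -/
def jordanBlock (x : k) (a : ℕ) : Matrix (Fin a) (Fin a) k :=
  Matrix.of fun i j => if i = j then x else if (i : ℕ) + 1 = j then 1 else 0

/-- `blockdiag(J(x₁, a₁), …, J(x_r, a_r))`. -/
def jordanMatrix {r : ℕ} (x : Fin r → k) (a : Fin r → ℕ) :
    Matrix (Fin (∑ i, a i)) (Fin (∑ i, a i)) k :=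
  Matrix.reindex finSigmaFinEquiv finSigmaFinEquiv
    (Matrix.blockDiagonal' fun i => jordanBlock (x i) (a i))

/-- An expression `X = blockdiag(J(x₁, a₁), …, J(x_r, a_r))` with positive `a₁, …, a_r`. -/
structure JordanForm (X : Matrix (Fin n) (Fin n) k) where
  /-- the number of blocks -/
  r : ℕ
  /-- the eigenvalues of the blocks -/
  x : Fin r → k
  /-- the sizes of the blocks -/
  a : Fin r → ℕ
  a_pos : ∀ i, 0 < a i
  sum_eq : ∑ i, a i = n
  eq : X = Matrix.reindex (finCongr sum_eq) (finCongr sum_eq) (jordanMatrix x a)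

/-- `X` and `Y` are in Jordan normal form and differ rationally after block permutation. -/
def DifferRationally (X Y : Matrix (Fin n) (Fin n) k) : Prop :=
  ∃ (P : JordanForm X) (Q : JordanForm Y) (τ : Fin P.r ≃ Fin Q.r),
    ∀ i, P.a i = Q.a (τ i) ∧ ∃ q : ℚ, P.x i - Q.x (τ i) = (q : k)

variable (n k) in
/-- The set of `X ∈ 𝔰𝔩_n(k)` in Jordan normal form such that `ad X` has no rational
eigenvalue other than zero. -/
def JZero : Type _ :=
  {X : sl (Fin n) k // Nonempty (JordanForm X.1) ∧
    ∀ q : ℚ, Module.End.HasEigenvalue (LieAlgebra.ad k (sl (Fin n) k) X) (q : k) → q = 0}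

end Jordan

/-! ### The torus `T_X`, the group `D_X` and the Weyl group `W_X` -/

section Torus

variable {n : ℕ} {k : Type*} [Field k]

/-- The centralizer of `X` in `GL_n(k)`. -/
def centGL (X : Matrix (Fin n) (Fin n) k) : Subgroup (GL (Fin n) k) where
  carrier := {g | g.1 * X = X * g.1}
  mul_mem' {a b} ha hb := by
    change a.1 * b.1 * X = X * (a.1 * b.1)
    have ha' : a.1 * X = X * a.1 := ha
    have hb' : b.1 * X = X * b.1 := hb
    rw [Matrix.mul_assoc, hb', ← Matrix.mul_assoc, ha', Matrix.mul_assoc]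
  one_mem' := by
    change (1 : Matrix (Fin n) (Fin n) k) * X = X * 1
    rw [Matrix.one_mul, Matrix.mul_one]
  inv_mem' {a} ha := by
    have ha' : Commute a.1 X := ha
    exact (Commute.units_inv_left_iff.2 ha').eq

/-- The centralizer of `X` in `SL_n(k)`. -/
def centSL (X : Matrix (Fin n) (Fin n) k) : Subgroup (Matrix.SpecialLinearGroup (Fin n) k) :=
  (centGL X).comap Matrix.SpecialLinearGroup.toGL

variable (n k) in
/-- The standard diagonal torus in `GL_n(k)`. -/
def diagTorus : Subgroup (GL (Fin n) k) :=
  (Units.map (Matrix.diagonalRingHom (Fin n) k).toMonoidHom).range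

/-- The diagonal torus `T_X` of the centralizer of `X`, as a subgroup of this centralizer. -/
def torus (X : Matrix (Fin n) (Fin n) k) : Subgroup (centGL X) :=
  (diagTorus n k).subgroupOf (centGL X)

/-- `E_λ^i = ker (X - λ) ∩ im (X - λ) ^ i`, as a subspace of `k ^ n`. -/
def eigFil (X : Matrix (Fin n) (Fin n) k) (c : k) (i : ℕ) : Submodule k (Fin n → k) :=
  LinearMap.ker (Matrix.toLin' X - algebraMap k (Module.End k (Fin n → k)) c) ⊓
    LinearMap.range ((Matrix.toLin' X - algebraMap k (Module.End k (Fin n → k)) c) ^ i)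

theorem eigFil_stable (X : Matrix (Fin n) (Fin n) k) (g : centGL X) (c : k) (i : ℕ) :
    ∀ v ∈ eigFil X c i, Matrix.toLin' g.1.1 v ∈ eigFil X c i := by
  have hg : Commute (Matrix.toLin' g.1.1) (Matrix.toLin' X) := by
    change Matrix.toLin' g.1.1 * Matrix.toLin' X = Matrix.toLin' X * Matrix.toLin' g.1.1
    have h : g.1.1 * X = X * g.1.1 := g.2
    rw [Module.End.mul_eq_comp, Module.End.mul_eq_comp, ← Matrix.toLin'_mul, ← Matrix.toLin'_mul, h]
  have h1 : Commute (Matrix.toLin' g.1.1)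
      (Matrix.toLin' X - algebraMap k (Module.End k (Fin n → k)) c) :=
    hg.sub_right (Algebra.commutes c _).symm
  rintro v ⟨hv, w, rfl⟩
  refine ⟨?_, Matrix.toLin' g.1.1 w, ?_⟩
  · have h2 := LinearMap.congr_fun h1.eq
      (((Matrix.toLin' X - algebraMap k (Module.End k (Fin n → k)) c) ^ i) w)
    simp only [Module.End.mul_apply] at h2
    change _ = _ at hv
    change _ = _
    rw [← h2, hv, map_zero]
  · exact (LinearMap.congr_fun (h1.pow_right i).eq w).symm

/-- The quotient `E_λ^i / E_λ^{i+1}`. -/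
abbrev eigGr (X : Matrix (Fin n) (Fin n) k) (c : k) (i : ℕ) : Type _ :=
  eigFil X c i ⧸ (eigFil X c (i + 1)).submoduleOf (eigFil X c i)

/-- The endomorphism of `E_λ^i / E_λ^{i+1}` induced by an element of the centralizer of `X`. -/
def eigGrMap (X : Matrix (Fin n) (Fin n) k) (c : k) (i : ℕ) :
    centGL X →* Module.End k (eigGr X c i) where
  toFun g := Submodule.mapQ _ _ ((Matrix.toLin' g.1.1).restrict (eigFil_stable X g c i))
    (fun v hv => eigFil_stable X g c (i + 1) v.1 hv)
  map_one' := by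
    apply LinearMap.ext
    intro q
    obtain ⟨v, rfl⟩ := Submodule.Quotient.mk_surjective _ q
    refine (Submodule.mapQ_apply _ _ _ _).trans ?_
    refine congrArg Submodule.Quotient.mk (Subtype.ext ?_)
    simp
  map_mul' g h := by
    apply LinearMap.ext
    intro q
    obtain ⟨v, rfl⟩ := Submodule.Quotient.mk_surjective _ q
    refine (Submodule.mapQ_apply _ _ _ _).trans ?_
    refine congrArg Submodule.Quotient.mk (Subtype.ext ?_)
    simp

/-- The homomorphism `π : Z_{GL_n}(X) → ∏_{λ, i} GL(E_λ^i / E_λ^{i+1})`. -/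
def piHom (X : Matrix (Fin n) (Fin n) k) :
    centGL X →* ((p : k × ℕ) → LinearMap.GeneralLinearGroup k (eigGr X p.1 p.2)) :=
  MonoidHom.pi fun p => (eigGrMap X p.1 p.2).toHomUnits

/-- Two elements of `T_X` lie in the same orbit of the Weyl group `W_X`, i.e. of the quotient
of the normalizer of `π(T_X)` in `∏ GL(E_λ^i / E_λ^{i+1})` by its centralizer; it acts on `T_X`
by conjugation on `π(T_X)`, via the isomorphism `T_X → π(T_X)`. -/
def WeylRel (X : Matrix (Fin n) (Fin n) k) (s t : centGL X) : Prop :=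
  ∃ w ∈ Subgroup.normalizer (((torus X).map (piHom X) : Subgroup _) : Set
      ((p : k × ℕ) → LinearMap.GeneralLinearGroup k (eigGr X p.1 p.2))),
    w * piHom X s * w⁻¹ = piHom X t

/-- The torsion elements of the group `D_X = T_X ∩ SL_n(k)`. -/
def DTors (X : Matrix (Fin n) (Fin n) k) : Type _ :=
  {d : centSL X // (⟨Matrix.SpecialLinearGroup.toGL d.1, d.2⟩ : centGL X) ∈ torus X ∧ IsOfFinOrder d}

/-- A torsion element of `D_X` as an element of the centralizer of `X` in `GL_n(k)`. -/
def DTors.toCent {X : Matrix (Fin n) (Fin n) k} (d : DTors X) : centGL X :=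
  ⟨Matrix.SpecialLinearGroup.toGL d.1.1, d.1.2⟩

/-- The orbit equivalence relation of `W_X` on the torsion elements of `D_X`. -/
def weylSetoid (X : Matrix (Fin n) (Fin n) k) : Setoid (DTors X) where
  r d e := WeylRel X d.toCent e.toCent
  iseqv :=
    { refl := fun d => ⟨1, one_mem _, by simp⟩
      symm := by
        rintro d e ⟨w, hw, h⟩
        refine ⟨w⁻¹, inv_mem hw, ?_⟩
        rw [← h]
        group
      trans := by
        rintro d e f ⟨w, hw, h⟩ ⟨v, hv, h'⟩
        refine ⟨v * w, mul_mem hv hw, ?_⟩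
        rw [← h', ← h]
        group }

/-- The set `{torsion elements of D_X} / W_X`. -/
def TorsClass (X : Matrix (Fin n) (Fin n) k) : Type _ := Quotient (weylSetoid X)

end Torus

/-! ### The correspondence given by Galois cohomology -/

section Twist

variable {n : ℕ} {k : Type*} [Field k]

/-- For `b ∈ SL_n(L)`, `L = k((z ^ (1 / l)))`, the value `b γ(b⁻¹)` at `γ` of the cocycle
`σ ↦ b σ(b⁻¹)`, as an element of `SL_n(KBar)`. -/
def cocycleAt (γ : AbsGal k) (l : ℕ+) (b : Matrix.SpecialLinearGroup (Fin n) (LField k)) :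
    Matrix.SpecialLinearGroup (Fin n) (KBar k) :=
  Matrix.SpecialLinearGroup.map (iota k l) b *
    Matrix.SpecialLinearGroup.map (γ : KBar k →+* KBar k) (Matrix.SpecialLinearGroup.map (iota k l) b⁻¹)

/-- The embedding `k → KBar` of the constants. -/
def constKBar : k →+* KBar k := (algebraMap (LField k) (KBar k)).comp HahnSeries.C

/-- The class `δ` of torsion elements of `D_X` modulo `W_X` and the gauge equivalence class `c`
correspond to each other under the maps
`Rel(X dlog z) / SL_n(K) → H¹(K; X dlog z) → {conjugacy classes of torsion elements of Z_{SL_n}(X)}`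
and `{torsion elements of D_X} / W_X → {conjugacy classes of torsion elements of Z_{SL_n}(X)}`:
there are `B ∈ c` and `b ∈ SL_n(k((z ^ (1 / l))))` such that `b` transforms the pull-back of `B`
into the pull-back of `X dlog z`, and the value at `γ` of the cocycle `σ ↦ b σ(b⁻¹)` is conjugate
in `Z_{SL_n}(X)` to an element `d` of `δ`. -/
def Corresponds (γ : AbsGal k) (X : sl (Fin n) k) (δ : TorsClass X.1) (c : GaugeClass n k) : Prop :=
  ∃ (B : Conn n k) (d : DTors X.1) (l : ℕ+) (b : Matrix.SpecialLinearGroup (Fin n) (LField k))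
    (u : centSL X.1),
    gaugeClass B = c ∧ Quotient.mk (weylSetoid X.1) d = δ ∧
    gauge b (pullback l B) = pullback l (constConn X) ∧
    cocycleAt γ l b = Matrix.SpecialLinearGroup.map constKBar (u * d.1 * u⁻¹ : centSL X.1).1

end Twist

end RegSL

end

noncomputable section

namespace RegSL

open Matrix

/-! ### Laurent series: the substitutions z ↦ z^m and z ↦ ζz -/

section Laurent

variable {k : Type*} [Field k]

/-! The argument takes place at finite levels L = k((z^(1/l))). A gauge transformation from A to B
is an invertible g with z∂_z g + gA = Bg, a linear equation (`gauge_eq_iff`). Between the constant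
connections lX and lY it decouples into i g_i + l g_i X = l Y g_i for the single coefficients of g.
If ad X has no nonzero rational eigenvalue, the stabilizer of X dlog z at every level is therefore
the constant group Z_{SL_n}(X) (`exists_eq_map_C_of_stabilizer`). A procyclic generator γ acts on L
by z^(1/l) ↦ ζ z^(1/l) with ζ a primitive root of unity (`exists_twist`). So b has cocycle value c
at γ exactly when b = c · b(ζz), and descent to K means that only exponents divisible by l occur.
Hence relatives of X dlog z are classified by torsion elements of Z_{SL_n}(X) up to conjugacy.

Linear algebra translates these conjugacy classes into W_X-orbits in D_X. An endomorphism and a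
commuting one of finite order have a simultaneous Jordan form (`exists_isJordan_isDiag`), unique
because dimensions of intersections of kernels and images count its blocks
(`exists_equiv_of_isJordan`). Conjugacy in the centralizer and the Weyl group relation both amount
to permuting Jordan blocks of equal size and eigenvalue (`weylSetoid_iff_conj`).

Every torsion class is realized by a connection of the first kind, written down by gauging with a
diagonal matrix of powers of z^(1/l) (`exists_isFirstKind_corresponds`). Conversely a regular
connection is related to some admissible X dlog z (`IsRegular.exists_related`): pull back until the
rational parts of the residue eigenvalues are integers, remove nonresonant terms by a formal power
series, and shear by powers of z. The result is constant, with eigenvalues of rational part zero.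

For two admissible matrices, shearing and block permutation give one direction of the criterion. For
the other, a gauge equivalence of pull-backs becomes constant after suitable shearing, and
uniqueness of the Jordan form applies (`differRationally_of_related`). The statements about can then
follow formally, since related connections have the same set of relatives. -/

theorem incl_coeff_mul (m : ℕ+) (f : LField k) (i : ℤ) :
    (incl k m f).coeff ((m : ℤ) * i) = f.coeff i :=
  HahnSeries.embDomain_coeff (a := i)

theorem incl_coeff_of_not_dvd (m : ℕ+) (f : LField k) {j : ℤ} (h : ¬ ((m : ℕ) : ℤ) ∣ j) :
    (incl k m f).coeff j = 0 := by
  apply HahnSeries.embDomain_of_notMem_range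
  rintro ⟨i, hi⟩
  exact h ⟨i, hi.symm⟩

theorem pnat_int_ne_zero (m : ℕ+) : ((m : ℕ) : ℤ) ≠ 0 := by
  exact_mod_cast m.ne_zero

theorem incl_eq_iff (m : ℕ+) (f g : LField k) :
    incl k m f = g ↔ (∀ i, g.coeff ((m : ℤ) * i) = f.coeff i) ∧
      ∀ j, ¬ ((m : ℕ) : ℤ) ∣ j → g.coeff j = 0 := by
  constructor
  · rintro rfl
    exact ⟨incl_coeff_mul m f, fun j h => incl_coeff_of_not_dvd m f h⟩
  · rintro ⟨h1, h2⟩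
    ext j
    by_cases h : ((m : ℕ) : ℤ) ∣ j
    · obtain ⟨i, rfl⟩ := h
      rw [incl_coeff_mul, h1]
    · rw [incl_coeff_of_not_dvd m f h, h2 j h]

theorem incl_incl (m d : ℕ+) (f : LField k) : incl k d (incl k m f) = incl k (m * d) f := by
  symm
  rw [incl_eq_iff]
  constructor
  · intro i
    have : (((m * d : ℕ+) : ℕ) : ℤ) * i = (d : ℤ) * ((m : ℤ) * i) := by push_cast; ring
    rw [this, incl_coeff_mul, incl_coeff_mul]
  · intro j hj
    by_cases h : ((d : ℕ) : ℤ) ∣ j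
    · obtain ⟨i, rfl⟩ := h
      rw [incl_coeff_mul, incl_coeff_of_not_dvd]
      rintro ⟨e, rfl⟩
      exact hj ⟨e, by push_cast; ring⟩
    · exact incl_coeff_of_not_dvd d _ h

theorem incl_single (m : ℕ+) (e : ℤ) (c : k) :
    incl k m (HahnSeries.single e c) = HahnSeries.single ((m : ℤ) * e) c :=
  HahnSeries.embDomain_single

theorem incl_C (m : ℕ+) (c : k) : incl k m (HahnSeries.C c) = HahnSeries.C c := by
  have := incl_single m 0 c
  rwa [mul_zero] at this

theorem euler_incl (m : ℕ+) (f : LField k) :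
    euler k (incl k m f) = ((m : ℕ) : LField k) * incl k m (euler k f) := by
  rw [← nsmul_eq_mul]
  ext j
  rw [euler_coeff, HahnSeries.coeff_nsmul, Pi.smul_apply]
  by_cases h : ((m : ℕ) : ℤ) ∣ j
  · obtain ⟨i, rfl⟩ := h
    rw [incl_coeff_mul, incl_coeff_mul, euler_coeff, nsmul_eq_mul]
    push_cast
    ring
  · rw [incl_coeff_of_not_dvd m f h, incl_coeff_of_not_dvd m _ h]
    simp

theorem euler_single (e : ℤ) (c : k) :
    euler k (HahnSeries.single e c) = HahnSeries.single e ((e : k) * c) := by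
  ext j
  rw [euler_coeff]
  by_cases h : j = e
  · subst h; simp
  · simp [HahnSeries.coeff_single_of_ne h]

theorem euler_C (c : k) : euler k (HahnSeries.C c) = 0 := by
  have := euler_single 0 c
  rw [HahnSeries.C_apply, this]; simp

/-- Substitution of `ζ z` for `z` in a Laurent series. -/
def twistFun (ζ : kˣ) (f : LField k) : LField k :=
  ⟨fun i => ((ζ ^ i : kˣ) : k) * f.coeff i,
    f.isPWO_support.mono fun i hi h => hi (by change _ * f.coeff i = 0; rw [h, mul_zero])⟩

theorem twistFun_coeff (ζ : kˣ) (f : LField k) (i : ℤ) :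
    (twistFun ζ f).coeff i = ((ζ ^ i : kˣ) : k) * f.coeff i := rfl

theorem twistFun_support (ζ : kˣ) (f : LField k) : (twistFun ζ f).support ⊆ f.support :=
  fun i hi h => hi (by rw [twistFun_coeff, h, mul_zero])

/-- The endomorphism of `k((z))` substituting `ζ z` for `z`. -/
def twist (ζ : kˣ) : LField k →+* LField k where
  toFun := twistFun ζ
  map_one' := by
    ext i
    rw [twistFun_coeff]
    by_cases h : i = 0
    · subst h; simp
    · simp [HahnSeries.coeff_one, h]
  map_zero' := by ext; simp [twistFun_coeff]
  map_add' f g := by ext; simp [mul_add, twistFun_coeff]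
  map_mul' f g := by
    ext i
    rw [twistFun_coeff, HahnSeries.coeff_mul, Finset.mul_sum, HahnSeries.coeff_mul]
    have hs : ∀ f : LField k, (twistFun ζ f).support = f.support := fun f =>
      subset_antisymm (twistFun_support ζ f) fun i hi h =>
        hi ((mul_eq_zero.1 h).resolve_left (ζ ^ i).ne_zero)
    simp only [hs]
    refine Finset.sum_congr rfl fun p hp => ?_
    have hp' : p.1 + p.2 = i := (Finset.mem_antidiagonal.1 hp).2.2
    rw [twistFun_coeff, twistFun_coeff, ← hp', _root_.zpow_add, Units.val_mul]
    ring

theorem twist_coeff (ζ : kˣ) (f : LField k) (i : ℤ) :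
    (twist ζ f).coeff i = ((ζ ^ i : kˣ) : k) * f.coeff i := rfl

theorem twist_single (ζ : kˣ) (e : ℤ) (c : k) :
    twist ζ (HahnSeries.single e c) = HahnSeries.single e (((ζ ^ e : kˣ) : k) * c) := by
  ext j
  rw [twist_coeff]
  by_cases h : j = e
  · subst h; simp
  · simp [HahnSeries.coeff_single_of_ne h]

theorem twist_C (ζ : kˣ) (c : k) : twist ζ (HahnSeries.C c) = HahnSeries.C c := by
  have := twist_single ζ 0 c
  rw [HahnSeries.C_apply, this]; simp

theorem euler_twist (ζ : kˣ) (f : LField k) : euler k (twist ζ f) = twist ζ (euler k f) := by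
  ext i
  rw [euler_coeff, twist_coeff, twist_coeff, euler_coeff]
  ring

theorem twist_incl (m : ℕ+) {ζ : kˣ} (h : ζ ^ (m : ℕ) = 1) (f : LField k) :
    twist ζ (incl k m f) = incl k m f := by
  symm
  rw [incl_eq_iff]
  constructor
  · intro i
    rw [twist_coeff, incl_coeff_mul, _root_.zpow_mul, zpow_natCast, h]
    simp
  · intro j hj
    rw [twist_coeff, incl_coeff_of_not_dvd m f hj, mul_zero]

/-- The coefficients of `f` with exponents congruent to `r` modulo `m`. -/
theorem exists_coeff_mul_add (m : ℕ+) (r : ℤ) (f : LField k) :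
    ∃ g : LField k, ∀ i, g.coeff i = f.coeff ((m : ℤ) * i + r) := by
  refine ⟨HahnSeries.ofSuppBddBelow (fun i => f.coeff ((m : ℤ) * i + r)) ?_, fun i => rfl⟩
  by_cases hf : f = 0
  · subst hf
    exact ⟨0, by intro i hi; simp at hi⟩
  -- This bound works for every m: below it i is negative, so m * i ≤ i < f.order - r.
  refine ⟨- |f.order - r|, fun i hi => ?_⟩
  have h1 : f.order ≤ (m : ℤ) * i + r := HahnSeries.order_le_of_coeff_ne_zero hi
  have hm : (1 : ℤ) ≤ (m : ℤ) := by exact_mod_cast m.pos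
  by_contra hlt
  push Not at hlt
  have h2 := neg_abs_le (f.order - r)
  have h3 := abs_nonneg (f.order - r)
  nlinarith

/-- Galois descent made explicit: `ζ ^ j = 1` for every exponent j occurring in f, and primitivity
forces m ∣ j. -/
theorem mem_range_incl_of_twist_eq {m : ℕ+} {ζ : kˣ} (hζ : IsPrimitiveRoot ζ m)
    {f : LField k} (h : twist ζ f = f) : ∃ g, incl k m g = f := by
  obtain ⟨g, hg⟩ := exists_coeff_mul_add m 0 f
  refine ⟨g, (incl_eq_iff m g f).2 ⟨fun i => by rw [hg, add_zero], fun j hj => ?_⟩⟩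
  by_contra hne
  have h1 := congrArg (fun f => HahnSeries.coeff f j) h
  simp only [twist_coeff] at h1
  have h2 : ((ζ ^ j : kˣ) : k) = 1 := by
    exact mul_right_cancel₀ hne (by rw [h1, one_mul])
  exact hj ((hζ.zpow_eq_one_iff_dvd j).1 (Units.ext h2))

/-- Exponents are sorted by their residue modulo m. Consequently an automorphism over K is
determined on k((z^(1/m))) by the image of z^(1/m). -/
theorem exists_sum_single_mul_incl (m : ℕ+) (f : LField k) :
    ∃ g : ℕ → LField k,
      f = ∑ r ∈ Finset.range m, HahnSeries.single (1 : ℤ) (1 : k) ^ r * incl k m (g r) := by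
  choose g hg using fun r : ℕ => exists_coeff_mul_add m (r : ℤ) f
  refine ⟨g, ?_⟩
  have hs : ∀ r : ℕ, (HahnSeries.single (1 : ℤ) (1 : k) : LField k) ^ r
      = HahnSeries.single (r : ℤ) (1 : k) := by
    intro r; rw [HahnSeries.single_pow]; simp
  ext j
  rw [HahnSeries.coeff_sum]
  have key : ∀ r : ℕ, ((HahnSeries.single (1 : ℤ) (1 : k) : LField k) ^ r
      * incl k m (g r)).coeff j = (incl k m (g r)).coeff (j - r) := by
    intro r
    rw [hs, HahnSeries.coeff_single_mul, one_mul]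
  simp only [key]
  have hm : (0 : ℤ) < (m : ℤ) := by exact_mod_cast m.pos
  have h0 := Int.emod_nonneg j hm.ne'
  have h1 := Int.emod_lt_of_pos j hm
  have hcast : ((j % (m : ℤ)).toNat : ℤ) = j % (m : ℤ) := Int.toNat_of_nonneg h0
  have hj := Int.mul_ediv_add_emod j (m : ℤ)
  rw [Finset.sum_eq_single (j % (m : ℤ)).toNat]
  · rw [hcast]
    have : j - j % (m : ℤ) = (m : ℤ) * (j / (m : ℤ)) := by linarith
    rw [this, incl_coeff_mul, hg, hcast, hj]
  · intro r hr hne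
    apply incl_coeff_of_not_dvd
    intro hd
    apply hne
    have hr' : (r : ℤ) < (m : ℤ) := by exact_mod_cast Finset.mem_range.1 hr
    have : j % (m : ℤ) = r := by
      rw [← Int.emod_eq_of_lt (Int.natCast_nonneg r) hr']
      exact Int.emod_eq_emod_iff_emod_sub_eq_zero.2 (Int.emod_eq_zero_of_dvd hd)
    omega
  · intro hn
    exact absurd (Finset.mem_range.2 (by omega)) hn

theorem eq_C_of_euler_eq_zero [CharZero k] {f : LField k} (h : euler k f = 0) :
    f = HahnSeries.C (f.coeff 0) := by
  ext i
  have h1 := congrArg (fun f => HahnSeries.coeff f i) h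
  simp only [euler_coeff, HahnSeries.coeff_zero] at h1
  by_cases hi : i = 0
  · subst hi; simp [HahnSeries.C_apply]
  · rw [HahnSeries.C_apply, HahnSeries.coeff_single_of_ne hi]
    exact (mul_eq_zero.1 h1).resolve_left (by exact_mod_cast hi)

end Laurent

/-! ### Gauge equivalence, pull-backs and relatedness -/

section Gauge

variable {n : ℕ} {k : Type*} [Field k]

theorem SL_mul_inv {R : Type*} [CommRing R] (g : Matrix.SpecialLinearGroup (Fin n) R) :
    (g : Matrix (Fin n) (Fin n) R) * ((g⁻¹ : Matrix.SpecialLinearGroup (Fin n) R) :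
      Matrix (Fin n) (Fin n) R) = 1 := by
  rw [← Matrix.SpecialLinearGroup.coe_mul, mul_inv_cancel, Matrix.SpecialLinearGroup.coe_one]

theorem SL_inv_mul {R : Type*} [CommRing R] (g : Matrix.SpecialLinearGroup (Fin n) R) :
    ((g⁻¹ : Matrix.SpecialLinearGroup (Fin n) R) : Matrix (Fin n) (Fin n) R) *
      (g : Matrix (Fin n) (Fin n) R) = 1 := by
  rw [← Matrix.SpecialLinearGroup.coe_mul, inv_mul_cancel, Matrix.SpecialLinearGroup.coe_one]

/-- Free of inverses and linear in g: in this form coefficients can be compared and ring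
homomorphisms applied entrywise. -/
theorem gauge_eq_iff (g : Matrix.SpecialLinearGroup (Fin n) (LField k)) {A B : Conn n k} :
    gauge g A = B ↔ eulerMat (g : Matrix (Fin n) (Fin n) (LField k)) + g * A.1 = B.1 * g := by
  rw [Subtype.ext_iff]
  change (g : Matrix (Fin n) (Fin n) (LField k)) * A.1 *
    (g⁻¹ : Matrix.SpecialLinearGroup (Fin n) (LField k)) +
    eulerMat (g : Matrix (Fin n) (Fin n) (LField k)) *
    (g⁻¹ : Matrix.SpecialLinearGroup (Fin n) (LField k)) = B.1 ↔ _
  rw [← Matrix.add_mul]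
  constructor
  · intro h
    rw [← h, Matrix.mul_assoc, SL_inv_mul, Matrix.mul_one, add_comm]
  · intro h
    rw [add_comm, h, Matrix.mul_assoc, SL_mul_inv, Matrix.mul_one]

theorem eulerMat_smul_C (c : k) (g : Matrix (Fin n) (Fin n) (LField k)) :
    eulerMat ((HahnSeries.C c : LField k) • g) = (HahnSeries.C c : LField k) • eulerMat g := by
  ext1 i j
  simp only [eulerMat, Matrix.map_apply, Matrix.smul_apply, smul_eq_mul, euler_mul, euler_C,
    zero_mul, zero_add]

/-- An element of a commutative ring of matrices of nonzero determinant over an algebraically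
closed field can be rescaled to determinant one. -/
theorem exists_scalar_det_eq_one [IsAlgClosed k] {d : k} (hd : n ≠ 0 → d ≠ 0)
    (hd0 : n = 0 → d = 1) : ∃ c : k, c ≠ 0 ∧ c ^ n * d = 1 := by
  rcases Nat.eq_zero_or_pos n with h | h
  · exact ⟨1, one_ne_zero, by simp [hd0 h]⟩
  · obtain ⟨c, hc⟩ := IsAlgClosed.exists_pow_nat_eq d⁻¹ h
    have hd' := hd h.ne'
    refine ⟨c, ?_, by rw [hc, inv_mul_cancel₀ hd']⟩
    rintro rfl
    rw [zero_pow h.ne'] at hc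
    exact inv_ne_zero hd' hc.symm

theorem exists_smul_det_eq_one [IsAlgClosed k] (g : Matrix (Fin n) (Fin n) k) (hg : g.det ≠ 0) :
    ∃ c : k, c ≠ 0 ∧ (c • g).det = 1 := by
  obtain ⟨c, hc, h⟩ := exists_scalar_det_eq_one (n := n) (d := g.det) (fun _ => hg)
    (fun h => by subst h; exact Matrix.det_isEmpty)
  exact ⟨c, hc, by rw [Matrix.det_smul, Fintype.card_fin, h]⟩

/-- Both connections have trace zero, so Liouville's formula gives z∂_z(det M) = 0 and det M is a
constant. A constant multiple of M solves the same linear equation and has determinant one. -/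
theorem gaugeEquiv_of_intertwine [IsAlgClosed k] [CharZero k] {A B : Conn n k}
    (M : Matrix (Fin n) (Fin n) (LField k)) (hM : M.det ≠ 0)
    (h : eulerMat M + M * A.1 = B.1 * M) : GaugeEquiv A B := by
  have hA : A.1.trace = 0 := A.2
  have hB : B.1.trace = 0 := B.2
  have he : euler k M.det = 0 := by
    rw [euler_det, eq_sub_of_add_eq h, Matrix.sub_mul, Matrix.trace_sub, Matrix.mul_assoc,
      Matrix.mul_adjugate, Matrix.trace_mul_comm (M * A.1), ← Matrix.mul_assoc,
      Matrix.adjugate_mul]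
    simp [hA, hB]
  have hC := eq_C_of_euler_eq_zero he
  set d := M.det.coeff 0
  obtain ⟨c, hc, hcd⟩ := exists_scalar_det_eq_one (n := n) (d := d)
    (fun _ h0 => hM (by rw [hC, h0, map_zero]))
    (fun h0 => by
      subst h0
      have h1 : M.det = 1 := Matrix.det_isEmpty
      simp [d, h1])
  have hdet : ((HahnSeries.C c : LField k) • M).det = 1 := by
    rw [Matrix.det_smul, Fintype.card_fin, hC, ← map_pow, ← map_mul, hcd, map_one]
  refine ⟨⟨_, hdet⟩, (gauge_eq_iff _).2 ?_⟩
  change eulerMat ((HahnSeries.C c : LField k) • M) + (HahnSeries.C c : LField k) • M * A.1 =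
    B.1 * ((HahnSeries.C c : LField k) • M)
  rw [eulerMat_smul_C, Matrix.smul_mul, ← smul_add, h, Matrix.mul_smul]

theorem eulerMat_map_C (X : Matrix (Fin n) (Fin n) k) :
    eulerMat (X.map (HahnSeries.C : k →+* LField k)) = 0 := by
  ext1 i j
  exact euler_C (X i j)

theorem eulerMat_map_incl (m : ℕ+) (g : Matrix (Fin n) (Fin n) (LField k)) :
    eulerMat (g.map (incl k m)) = ((m : ℕ) : LField k) • (eulerMat g).map (incl k m) := by
  ext1 i j
  simp [eulerMat, euler_incl]

theorem gauge_pullback (m : ℕ+) (g : Matrix.SpecialLinearGroup (Fin n) (LField k)) {A B : Conn n k}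
    (h : gauge g A = B) :
    gauge (Matrix.SpecialLinearGroup.map (incl k m) g) (pullback m A) = pullback m B := by
  rw [gauge_eq_iff] at h ⊢
  have h' := congrArg (fun M => ((m : ℕ) : LField k) • Matrix.map M (incl k m)) h
  beta_reduce at h'
  change eulerMat ((g : Matrix (Fin n) (Fin n) (LField k)).map (incl k m)) +
    (g : Matrix (Fin n) (Fin n) (LField k)).map (incl k m) *
      (((m : ℕ) : LField k) • A.1.map (incl k m)) =
    (((m : ℕ) : LField k) • B.1.map (incl k m)) *
      (g : Matrix (Fin n) (Fin n) (LField k)).map (incl k m)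
  rw [Matrix.map_add _ (map_add _), Matrix.map_mul, Matrix.map_mul, smul_add] at h'
  rw [eulerMat_map_incl, Matrix.mul_smul, Matrix.smul_mul, h']

theorem pullback_pullback (m d : ℕ+) (A : Conn n k) :
    pullback d (pullback m A) = pullback (m * d) A := by
  apply Subtype.ext
  ext1 i j
  change ((d : ℕ) : LField k) * incl k d (((m : ℕ) : LField k) * incl k m (A.1 i j)) =
    (((m * d : ℕ+) : ℕ) : LField k) * incl k (m * d) (A.1 i j)
  rw [map_mul, map_natCast, incl_incl, ← mul_assoc]
  push_cast
  ring

theorem pullback_injective [CharZero k] (m : ℕ+) :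
    Function.Injective (pullback m : Conn n k → Conn n k) := by
  intro A B h
  apply Subtype.ext
  ext1 i j
  have h1 : (pullback m A).1 i j = (pullback m B).1 i j := by rw [h]
  change ((m : ℕ) : LField k) * incl k m (A.1 i j) = ((m : ℕ) : LField k) * incl k m (B.1 i j) at h1
  have hm : ((m : ℕ) : LField k) ≠ 0 := by
    have : ((m : ℕ) : LField k) = HahnSeries.C ((m : ℕ) : k) := (map_natCast _ _).symm
    rw [this]
    exact (map_ne_zero _).2 (by exact_mod_cast m.ne_zero)
  exact (incl k m).injective (mul_left_cancel₀ hm h1)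

theorem pullback_constConn (m : ℕ+) (X : LieAlgebra.SpecialLinear.sl (Fin n) k) :
    pullback m (constConn X) = constConn (((m : ℕ) : k) • X) := by
  apply Subtype.ext
  ext1 i j
  change ((m : ℕ) : LField k) * incl k m (HahnSeries.C (X.1 i j)) =
    HahnSeries.C (((m : ℕ) : k) * X.1 i j)
  rw [incl_C, map_mul, map_natCast]

theorem Related.symm {A B : Conn n k} : Related A B → Related B A := by
  rintro ⟨m, h⟩
  exact ⟨m, (gaugeSetoid n k).symm h⟩

theorem GaugeEquiv.pullback (m : ℕ+) {A B : Conn n k} (h : GaugeEquiv A B) :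
    GaugeEquiv (pullback m A) (pullback m B) := by
  obtain ⟨g, hg⟩ := h
  exact ⟨_, gauge_pullback m g hg⟩

/-- Both gauge equivalences are pulled back to the common cover of degree `m * d`. -/
theorem Related.trans {A B C : Conn n k} : Related A B → Related B C → Related A C := by
  rintro ⟨m, h⟩ ⟨d, h'⟩
  refine ⟨m * d, (gaugeSetoid n k).trans (b := RegSL.pullback (m * d) B) ?_ ?_⟩
  · have := h.pullback d
    rwa [pullback_pullback, pullback_pullback] at this
  · have := h'.pullback m
    rwa [pullback_pullback, pullback_pullback, mul_comm d m] at this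

theorem GaugeEquiv.related {A B : Conn n k} (h : GaugeEquiv A B) : Related A B :=
  ⟨1, h.pullback 1⟩

theorem gaugeClass_eq_iff {A B : Conn n k} : gaugeClass A = gaugeClass B ↔ GaugeEquiv A B :=
  Quotient.eq (r := gaugeSetoid n k)

theorem mem_relClasses_gaugeClass {A B : Conn n k} :
    gaugeClass B ∈ relClasses A ↔ Related A B := by
  constructor
  · rintro ⟨B', h, h'⟩
    exact h.trans (gaugeClass_eq_iff.1 h').related
  · intro h
    exact ⟨B, h, rfl⟩

end Gauge

end RegSL

end

noncomputable section

namespace RegSL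

open Matrix

/-! ### The Galois action on Puiseux series -/

section Galois

variable {k : Type*} [Field k]

theorem iota_incl (m d : ℕ+) (f : LField k) : iota k (m * d) (incl k d f) = iota k m f :=
  Subtype.ext (rootEmb_comp_incl k m d f)

theorem algebraMap_eq_iota (l : ℕ+) (f : LField k) :
    algebraMap (LField k) (KBar k) f = iota k l (incl k l f) := by
  have h := iota_incl 1 l f
  rw [one_mul] at h
  exact h.symm

theorem constKBar_eq_iota (l : ℕ+) (c : k) : constKBar c = iota k l (HahnSeries.C c) := by
  rw [← incl_C l c, ← algebraMap_eq_iota]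
  rfl

theorem exists_iota_eq (x : KBar k) : ∃ (l : ℕ+) (f : LField k), iota k l f = x := by
  obtain ⟨l, f, h⟩ := (mem_puiseuxSubfield k x.1).1 x.2
  exact ⟨l, f, Subtype.ext h⟩

theorem single_one_pow (l : ℕ) :
    (HahnSeries.single (1 : ℤ) (1 : k) : LField k) ^ l = HahnSeries.single (l : ℤ) (1 : k) := by
  rw [HahnSeries.single_pow]; simp

/-- The root `z ^ (1 / l)` in `KBar`. -/
def rootZ (k : Type*) [Field k] (l : ℕ+) : KBar k := iota k l (HahnSeries.single (1 : ℤ) (1 : k))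

theorem rootZ_ne_zero (l : ℕ+) : rootZ k l ≠ 0 :=
  (map_ne_zero _).2 (HahnSeries.single_ne_zero one_ne_zero)

theorem rootZ_pow (l : ℕ+) :
    rootZ k l ^ (l : ℕ) = algebraMap (LField k) (KBar k) (HahnSeries.single (1 : ℤ) (1 : k)) := by
  rw [rootZ, ← map_pow, single_one_pow, algebraMap_eq_iota l, incl_single, mul_one]

theorem iota_eq_sum (l : ℕ+) (f : LField k) : ∃ g : ℕ → LField k,
    f = ∑ r ∈ Finset.range l, HahnSeries.single (1 : ℤ) (1 : k) ^ r * incl k l (g r) ∧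
    iota k l f = ∑ r ∈ Finset.range l, rootZ k l ^ r * algebraMap (LField k) (KBar k) (g r) := by
  obtain ⟨g, hg⟩ := exists_sum_single_mul_incl l f
  refine ⟨g, hg, ?_⟩
  conv_lhs => rw [hg]
  rw [map_sum]
  refine Finset.sum_congr rfl fun r _ => ?_
  rw [map_mul, map_pow, algebraMap_eq_iota l]
  rfl

theorem adjoin_rootZ_eq_top :
    IntermediateField.adjoin (LField k) (Set.range (rootZ k)) = ⊤ := by
  rw [eq_top_iff]
  rintro x -
  obtain ⟨l, f, rfl⟩ := exists_iota_eq x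
  obtain ⟨g, -, h⟩ := iota_eq_sum l f
  rw [h]
  refine sum_mem fun r _ => mul_mem (pow_mem ?_ r) (IntermediateField.algebraMap_mem _ _)
  exact IntermediateField.subset_adjoin _ _ ⟨l, rfl⟩

variable [IsAlgClosed k] [CharZero k]

instance : CharZero (LField k) :=
  charZero_of_injective_ringHom (HahnSeries.C_injective : Function.Injective
    (HahnSeries.C : k →+* LField k))

theorem exists_isPrimitiveRoot (k : Type*) [Field k] [IsAlgClosed k] [CharZero k] (l : ℕ+) :
    ∃ ξ : k, IsPrimitiveRoot ξ l := by
  have : NeZero ((l : ℕ) : k) := ⟨by exact_mod_cast l.ne_zero⟩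
  exact HasEnoughRootsOfUnity.exists_primitiveRoot k (l : ℕ)

-- `KBar` is generated by the z^(1/l), roots of the Kummer polynomials T^l - z, which split because
-- k contains primitive l-th roots of unity.
open Polynomial in
instance isGalois_KBar : IsGalois (LField k) (KBar k) := by
  have hS : ∀ x ∈ Set.range (rootZ k), IsIntegral (LField k) x ∧
      ((minpoly (LField k) x).map (algebraMap (LField k) (KBar k))).Splits := by
    rintro _ ⟨l, rfl⟩
    have hl : (l : ℕ) ≠ 0 := l.ne_zero
    set p : (LField k)[X] := X ^ (l : ℕ) - C (HahnSeries.single (1 : ℤ) (1 : k)) with hp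
    have hmon : p.Monic := monic_X_pow_sub_C _ hl
    have hroot : aeval (rootZ k l) p = 0 := by
      simp only [hp, map_sub, map_pow, aeval_X, aeval_C]
      rw [rootZ_pow, sub_self]
    refine ⟨⟨p, hmon, hroot⟩, ?_⟩
    obtain ⟨ξ, hξ⟩ := exists_isPrimitiveRoot k l
    have hsp : (p.map (algebraMap (LField k) (KBar k))).Splits := by
      rw [hp, Polynomial.map_sub, Polynomial.map_pow, map_X, map_C]
      exact X_pow_sub_C_splits_of_isPrimitiveRoot
        (hξ.map_of_injective (constKBar (k := k)).injective) (rootZ_pow l)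
    exact hsp.of_dvd ((hmon.map _).ne_zero) (Polynomial.map_dvd _ (minpoly.dvd _ _ hroot))
  have halg : Algebra.IsAlgebraic (LField k) (KBar k) := by
    have h1 : Algebra.IsAlgebraic (LField k)
        (IntermediateField.adjoin (LField k) (Set.range (rootZ k))) :=
      IntermediateField.isAlgebraic_adjoin fun x hx => (hS x hx).1
    rw [adjoin_rootZ_eq_top] at h1
    exact (IntermediateField.topEquiv (F := LField k) (E := KBar k)).isAlgebraic_iff.1 h1
  have hn : Normal (LField k) (KBar k) :=
    { splits' := fun x => IntermediateField.splits_of_mem_adjoin _ _ hS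
        (by rw [adjoin_rootZ_eq_top]; exact IntermediateField.mem_top) }
  exact {}

/-- The stabilizer of x is the fixing subgroup of K(x), which is closed. Containing γ, it contains
the closure of the group generated by γ, which is everything. -/
theorem fixed_of_isProcyclicGenerator {γ : AbsGal k} (hγ : IsProcyclicGenerator k γ) {x : KBar k}
    (hx : γ x = x) : ∃ f, algebraMap (LField k) (KBar k) f = x := by
  refine (InfiniteGalois.mem_range_algebraMap_iff_fixed x).2 fun σ => ?_
  have hcl := InfiniteGalois.fixingSubgroup_isClosed
    (IntermediateField.adjoin (LField k) {x})
  have hmem : ∀ τ : AbsGal k, τ ∈ (IntermediateField.adjoin (LField k) {x}).fixingSubgroup ↔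
      τ x = x := by
    intro τ
    rw [← Subgroup.zpowers_le, ← IntermediateField.le_iff_le, IntermediateField.adjoin_le_iff,
      Set.singleton_subset_iff, SetLike.mem_coe, IntermediateField.mem_fixedField_iff]
    constructor
    · intro h
      exact h τ (Subgroup.mem_zpowers τ)
    · intro h σ hσ
      have : Subgroup.zpowers τ ≤ MulAction.stabilizer (AbsGal k) x :=
        Subgroup.zpowers_le.2 h
      exact this hσ
  have hle : ((Subgroup.zpowers γ : Subgroup (AbsGal k)) : Set (AbsGal k)) ⊆
      ((IntermediateField.adjoin (LField k) {x}).fixingSubgroup : Set (AbsGal k)) :=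
    Subgroup.zpowers_le.2 ((hmem γ).2 hx)
  exact (hmem σ).1 (hcl.closure_subset_iff.2 hle (hγ σ))

/-- The quotient γ(z^(1/l)) / z^(1/l) is an l-th root of unity and so lies in k. The Galois action
at level l thereby becomes a substitution in k((z)). -/
theorem exists_twist {γ : AbsGal k} (hγ : IsProcyclicGenerator k γ) (l : ℕ+) :
    ∃ ζ : kˣ, IsPrimitiveRoot ζ l ∧ ∀ f : LField k, γ (iota k l f) = iota k l (twist ζ f) := by
  obtain ⟨ξ, hξ⟩ := exists_isPrimitiveRoot k l
  have hξ' := hξ.map_of_injective (constKBar (k := k)).injective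
  have h1 : (γ (rootZ k l) / rootZ k l) ^ (l : ℕ) = 1 := by
    rw [div_pow, ← map_pow, rootZ_pow, AlgEquiv.commutes, div_self]
    exact (map_ne_zero _).2 (HahnSeries.single_ne_zero one_ne_zero)
  have : NeZero (l : ℕ) := ⟨l.ne_zero⟩
  obtain ⟨i, -, hi⟩ := hξ'.eq_pow_of_pow_eq_one h1
  have hu : ξ ^ i ≠ 0 := pow_ne_zero _ (hξ.ne_zero l.ne_zero)
  set ζ : kˣ := Units.mk0 (ξ ^ i) hu with hζ
  have hy : γ (rootZ k l) = iota k l (twist ζ (HahnSeries.single (1 : ℤ) (1 : k))) := by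
    rw [eq_div_iff (rootZ_ne_zero l), ← map_pow, constKBar_eq_iota l, rootZ, ← map_mul] at hi
    rw [rootZ, ← hi, twist_single, HahnSeries.C_apply, HahnSeries.single_mul_single]
    simp [hζ]
  have hl : ζ ^ (l : ℕ) = 1 := by
    ext
    simp only [hζ, Units.val_pow_eq_pow_val, Units.val_mk0, Units.val_one]
    rw [← pow_mul, mul_comm, pow_mul, hξ.pow_eq_one, one_pow]
  have hf : ∀ f : LField k, γ (iota k l f) = iota k l (twist ζ f) := by
    intro f
    obtain ⟨g, hg, h⟩ := iota_eq_sum l f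
    rw [h, map_sum]
    conv_rhs => rw [hg]
    rw [map_sum, map_sum]
    refine Finset.sum_congr rfl fun r _ => ?_
    rw [map_mul, map_mul, map_mul, map_pow, map_pow, map_pow, hy, AlgEquiv.commutes,
      twist_incl l hl, algebraMap_eq_iota l]
  refine ⟨ζ, (IsPrimitiveRoot.iff_def _ _).2 ⟨hl, fun d hd => ?_⟩, hf⟩
  -- If `ζ ^ d = 1`, then z^(d/l) is fixed by γ, hence lies in K, so its exponent is an integer.
  have hfix : γ (iota k l (HahnSeries.single (d : ℤ) (1 : k))) =
      iota k l (HahnSeries.single (d : ℤ) (1 : k)) := by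
    rw [hf, twist_single, zpow_natCast, hd]
    simp
  obtain ⟨f, h⟩ := fixed_of_isProcyclicGenerator hγ hfix
  rw [algebraMap_eq_iota l] at h
  have h' := (iota k l).injective h
  by_contra hnd
  have h2 := incl_coeff_of_not_dvd l f (j := (d : ℤ)) (by exact_mod_cast hnd)
  rw [h', HahnSeries.coeff_single_same] at h2
  exact one_ne_zero h2

end Galois

/-! ### Cocycle values as a functional equation for b -/

section Cocycle

variable {n : ℕ} {k : Type*} [Field k]

/-- The value of the cocycle at `γ` is constant if and only if `b` is multiplied by this constant
under the substitution induced by `γ`. -/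
theorem cocycleAt_eq_iff {γ : AbsGal k} {l : ℕ+} {ζ : kˣ}
    (hζ : ∀ f : LField k, γ (iota k l f) = iota k l (twist ζ f))
    (b : Matrix.SpecialLinearGroup (Fin n) (LField k)) (c : Matrix.SpecialLinearGroup (Fin n) k) :
    cocycleAt γ l b = Matrix.SpecialLinearGroup.map constKBar c ↔
      b = Matrix.SpecialLinearGroup.map HahnSeries.C c *
        Matrix.SpecialLinearGroup.map (twist ζ) b := by
  have h1 : Matrix.SpecialLinearGroup.map (γ : KBar k →+* KBar k)
      (Matrix.SpecialLinearGroup.map (iota k l) b⁻¹) =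
      (Matrix.SpecialLinearGroup.map (iota k l) (Matrix.SpecialLinearGroup.map (twist ζ) b))⁻¹ := by
    rw [← map_inv, ← map_inv]
    refine Matrix.SpecialLinearGroup.ext _ _ fun i j => ?_
    exact hζ _
  have h2 : Matrix.SpecialLinearGroup.map constKBar c =
      Matrix.SpecialLinearGroup.map (iota k l) (Matrix.SpecialLinearGroup.map HahnSeries.C c) := by
    refine Matrix.SpecialLinearGroup.ext _ _ fun i j => ?_
    exact constKBar_eq_iota l _
  rw [cocycleAt, h1, h2, mul_inv_eq_iff_eq_mul, ← map_mul]
  constructor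
  · intro h
    refine Matrix.SpecialLinearGroup.ext _ _ fun i j => ?_
    exact (iota k l).injective (congrArg (fun g : Matrix.SpecialLinearGroup (Fin n) (KBar k) => g.1 i j) h)
  · intro h
    rw [← h]

/-- Allows two trivializations given at different levels to be compared at a common one. -/
theorem cocycleAt_incl (γ : AbsGal k) (l m : ℕ+)
    (b : Matrix.SpecialLinearGroup (Fin n) (LField k)) :
    cocycleAt γ (l * m) (Matrix.SpecialLinearGroup.map (incl k m) b) = cocycleAt γ l b := by
  have h : ∀ b : Matrix.SpecialLinearGroup (Fin n) (LField k),
      Matrix.SpecialLinearGroup.map (iota k (l * m)) (Matrix.SpecialLinearGroup.map (incl k m) b) =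
      Matrix.SpecialLinearGroup.map (iota k l) b := by
    intro b
    refine Matrix.SpecialLinearGroup.ext _ _ fun i j => ?_
    exact iota_incl l m _
  rw [cocycleAt, cocycleAt, h, ← map_inv, h]

end Cocycle

end RegSL

end

noncomputable section

namespace RegSL

open Matrix

/-! ### Matching finite families by cardinalities of fibres -/

section Counting

/-- Two maps from finite types with fibres of the same cardinality differ by a bijection. -/
theorem exists_equiv_of_card_fiber_eq {α β γ : Type*} [Finite α] [Finite β]
    (F : α → γ) (G : β → γ)
    (h : ∀ c, Nat.card {i // F i = c} = Nat.card {i // G i = c}) :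
    ∃ τ : α ≃ β, ∀ i, G (τ i) = F i := by
  refine ⟨(Equiv.sigmaFiberEquiv F).symm.trans ((Equiv.sigmaCongrRight fun c =>
    (Finite.card_eq.1 (h c)).some).trans (Equiv.sigmaFiberEquiv G)), fun i => ?_⟩
  exact ((Finite.card_eq.1 (h (F i))).some ⟨i, rfl⟩).2

/-- Strings of length exactly j + 1 are those longer than j but not longer than j + 1. This converts
dimensions, which count strings longer than j, into multiplicities of blocks. -/
theorem card_lt_eq_add {α γ : Type*} [Finite α] (a : α → ℕ) (x t : α → γ) (y z : γ) (j : ℕ) :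
    Nat.card {i // x i = y ∧ j < a i ∧ t i = z} =
      Nat.card {i // x i = y ∧ j + 1 < a i ∧ t i = z} +
      Nat.card {i // (a i, x i, t i) = (j + 1, y, z)} := by
  classical
  have := Fintype.ofFinite α
  rw [Nat.card_eq_fintype_card, Nat.card_eq_fintype_card, Nat.card_eq_fintype_card,
    Fintype.card_subtype, Fintype.card_subtype, Fintype.card_subtype,
    ← Finset.card_union_of_disjoint]
  · congr 1
    ext i
    simp only [Finset.mem_filter, Finset.mem_univ, true_and, Finset.mem_union, Prod.mk.injEq]
    constructor
    · rintro ⟨h1, h2, h3⟩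
      rcases (Nat.succ_le_of_lt h2).eq_or_lt with h4 | h4
      · exact Or.inr ⟨h4.symm, h1, h3⟩
      · exact Or.inl ⟨h1, h4, h3⟩
    · rintro (⟨h1, h2, h3⟩ | ⟨h1, h2, h3⟩)
      · exact ⟨h1, by omega, h3⟩
      · exact ⟨h2, by omega, h3⟩
  · rw [Finset.disjoint_filter]
    intro i _ h1 h2
    simp only [Prod.mk.injEq] at h2
    omega

theorem exists_equiv_of_card_eq {α β γ : Type*} [Finite α] [Finite β] {a : α → ℕ} {a' : β → ℕ}
    {x t : α → γ} {x' t' : β → γ} (ha : ∀ i, 0 < a i) (ha' : ∀ i, 0 < a' i)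
    (h : ∀ y z j, Nat.card {i // (a i, x i, t i) = (j + 1, y, z)} =
      Nat.card {i // (a' i, x' i, t' i) = (j + 1, y, z)}) :
    ∃ τ : α ≃ β, ∀ i, a' (τ i) = a i ∧ x' (τ i) = x i ∧ t' (τ i) = t i := by
  obtain ⟨τ, hτ⟩ := exists_equiv_of_card_fiber_eq (fun i => (a i, x i, t i))
    (fun i => (a' i, x' i, t' i)) (by
      rintro ⟨_ | j, y, z⟩
      · have h1 : IsEmpty {i // (a i, x i, t i) = (0, y, z)} :=
          ⟨fun i => (ha i.1).ne' (Prod.mk.inj i.2).1⟩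
        have h2 : IsEmpty {i // (a' i, x' i, t' i) = (0, y, z)} :=
          ⟨fun i => (ha' i.1).ne' (Prod.mk.inj i.2).1⟩
        rw [Nat.card_of_isEmpty, Nat.card_of_isEmpty]
      · exact h y z j)
  refine ⟨τ, fun i => ?_⟩
  have := hτ i
  simp only [Prod.mk.injEq] at this
  exact this

end Counting

/-! ### Coordinates in a Jordan basis; uniqueness of simultaneous Jordan forms -/

section JordanBasis

variable {k : Type*} [Field k] {V : Type*} [AddCommGroup V] [Module k V]
  {ι : Type*} {a : ι → ℕ}

/-- The coordinates of a vector with respect to a basis consisting of strings of vectors, extended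
by zero. -/
def jco (b : Module.Basis (Σ i, Fin (a i)) k V) (v : V) (i : ι) (m : ℕ) : k :=
  if h : m < a i then b.repr v ⟨i, ⟨m, h⟩⟩ else 0

variable (b : Module.Basis (Σ i, Fin (a i)) k V)

theorem jco_of_lt {v : V} {i : ι} {m : ℕ} (h : m < a i) :
    jco b v i m = b.repr v ⟨i, ⟨m, h⟩⟩ := dif_pos h

theorem jco_of_le {v : V} {i : ι} {m : ℕ} (h : a i ≤ m) : jco b v i m = 0 := dif_neg h.not_gt

theorem jco_add (v w : V) (i : ι) (m : ℕ) : jco b (v + w) i m = jco b v i m + jco b w i m := by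
  unfold jco; split_ifs <;> simp

theorem jco_sub (v w : V) (i : ι) (m : ℕ) : jco b (v - w) i m = jco b v i m - jco b w i m := by
  unfold jco; split_ifs <;> simp

theorem jco_smul (c : k) (v : V) (i : ι) (m : ℕ) : jco b (c • v) i m = c * jco b v i m := by
  unfold jco; split_ifs <;> simp

theorem jco_zero (i : ι) (m : ℕ) : jco b 0 i m = 0 := by
  unfold jco; split_ifs <;> simp

theorem jco_ext {v w : V} (h : ∀ i m, jco b v i m = jco b w i m) : v = w := by
  apply b.repr.injective
  ext ⟨i, m, hm⟩
  have := h i m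
  rwa [jco_of_lt b hm, jco_of_lt b hm] at this

theorem exists_jco_eq [Finite ι] (g : ι → ℕ → k) :
    ∃ v, ∀ i m, jco b v i m = if m < a i then g i m else 0 := by
  refine ⟨b.equivFun.symm fun p => g p.1 p.2, fun i m => ?_⟩
  split_ifs with h
  · rw [jco_of_lt b h, ← b.equivFun_apply, LinearEquiv.apply_symm_apply]
  · exact jco_of_le b (not_lt.1 h)

/-- `f` is in Jordan normal form with respect to the basis `b`. -/
def IsJordan (x : ι → k) (f : Module.End k V) : Prop :=
  ∀ v i m, jco b (f v) i m = x i * jco b v i m + jco b v i (m + 1)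

/-- `c` is diagonal with respect to the basis `b`, and constant on the strings of `b`. -/
def IsDiag (t : ι → k) (c : Module.End k V) : Prop :=
  ∀ v i m, jco b (c v) i m = t i * jco b v i m

theorem isDiag_one : IsDiag b (fun _ => 1) (1 : Module.End k V) := fun v i m => by simp

theorem IsJordan.sub {x : ι → k} {f : Module.End k V} (h : IsJordan b x f) (c : k) :
    IsJordan b (fun i => x i - c) (f - algebraMap k _ c) := by
  intro v i m
  rw [LinearMap.sub_apply, jco_sub, h, Module.algebraMap_end_apply, jco_smul]
  ring

theorem IsJordan.pow_apply {x : ι → k} {f : Module.End k V} (h : IsJordan b x f) {i : ι}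
    (hi : x i = 0) (j : ℕ) (v : V) (m : ℕ) : jco b ((f ^ j) v) i m = jco b v i (m + j) := by
  induction j generalizing m with
  | zero => simp
  | succ j ih =>
    rw [pow_succ', Module.End.mul_apply, h, hi, zero_mul, zero_add, ih]
    congr 1
    ring

theorem IsJordan.pow_apply_eq_zero {x : ι → k} {f : Module.End k V} (h : IsJordan b x f) {i : ι}
    {v : V} (hv : ∀ m, jco b v i m = 0) (j : ℕ) (m : ℕ) : jco b ((f ^ j) v) i m = 0 := by
  induction j generalizing m with
  | zero => simp [hv]
  | succ j ih => rw [pow_succ', Module.End.mul_apply, h, ih, ih, mul_zero, zero_add]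

/-- On a string with eigenvalue c the operator f - c shifts coordinates down by one place: its
kernel is spanned by the first vector, which is a j-th image exactly when the string is longer than
j. On the other strings f - c is injective. -/
theorem IsJordan.mem_ker_inf_range_iff [Finite ι] {x : ι → k} {f : Module.End k V}
    (h : IsJordan b x f) (c : k) (j : ℕ) (v : V) :
    v ∈ LinearMap.ker (f - algebraMap k (Module.End k V) c) ⊓
      LinearMap.range ((f - algebraMap k (Module.End k V) c) ^ j) ↔
    ∀ i m, jco b v i m ≠ 0 → m = 0 ∧ x i = c ∧ j < a i := by
  have h' := h.sub b c
  set g := f - algebraMap k (Module.End k V) c with hg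
  constructor
  · rintro ⟨hv, w, rfl⟩ i m hne
    set v := (g ^ j) w with hvdef
    have h1 : ∀ m, (x i - c) * jco b v i m + jco b v i (m + 1) = 0 := by
      intro m
      rw [← h' v i m, LinearMap.mem_ker.1 hv, jco_zero]
    have hx : x i = c := by
      by_contra hx
      have hx' : x i - c ≠ 0 := sub_ne_zero.2 hx
      -- By `h1`, vanishing at m + 1 implies vanishing at m; the propagation starts beyond the end
      -- of the string.
      have h2 : ∀ d m, jco b v i (m + d) = 0 → jco b v i m = 0 := by
        intro d
        induction d with
        | zero => exact fun m hm => hm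
        | succ d ih =>
          intro m hm
          apply ih
          have h3 := h1 (m + d)
          rw [add_assoc, hm, add_zero] at h3
          exact (mul_eq_zero.1 h3).resolve_left hx'
      exact hne (h2 (a i) m (jco_of_le b (Nat.le_add_left _ _)))
    have hm : m = 0 := by
      by_contra hm
      obtain ⟨d, rfl⟩ := Nat.exists_eq_succ_of_ne_zero hm
      have h3 := h1 d
      rw [hx, sub_self, zero_mul, zero_add] at h3
      exact hne h3
    refine ⟨hm, hx, ?_⟩
    subst hm
    by_contra hj
    apply hne
    rw [hvdef, h'.pow_apply b (by simp [hx]), zero_add]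
    exact jco_of_le b (not_lt.1 hj)
  · intro hv
    have hz : ∀ i, x i ≠ c → ∀ m, jco b v i m = 0 := fun i hi m => by
      by_contra hne
      exact hi (hv i m hne).2.1
    have hs : ∀ i m, jco b v i (m + 1) = 0 := fun i m => by
      by_contra hne
      exact absurd (hv i _ hne).1 (Nat.succ_ne_zero m)
    refine ⟨LinearMap.mem_ker.2 (jco_ext b fun i m => ?_), ?_⟩
    · rw [h', jco_zero, hs, add_zero]
      by_cases hi : x i = c
      · simp [hi]
      · rw [hz i hi, mul_zero]
    · obtain ⟨w, hw⟩ := exists_jco_eq b fun i m => if m = j then jco b v i 0 else 0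
      refine ⟨w, jco_ext b fun i m => ?_⟩
      by_cases hi : x i = c
      · rw [h'.pow_apply b (by simp [hi]), hw]
        rcases Nat.eq_zero_or_pos m with hm | hm
        · subst hm
          rw [zero_add, if_pos rfl]
          split_ifs with hj
          · rfl
          · by_contra hne
            exact hj (hv i 0 (Ne.symm hne)).2.2
        · obtain ⟨d, rfl⟩ := Nat.exists_eq_succ_of_ne_zero hm.ne'
          have hne : d.succ + j ≠ j := by omega
          rw [if_neg hne, ite_self, hs]
      · rw [hz i hi, h'.pow_apply_eq_zero b]
        intro m
        rw [hw, hz i hi]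
        simp

/-- The first vectors of the strings counted on the right form a basis of this subspace. The left
side does not involve the basis b, and this gives uniqueness of the normal form. -/
theorem finrank_ker_inf_range_inf_ker [Finite ι] {x t : ι → k} {f c : Module.End k V}
    (h : IsJordan b x f) (hc : IsDiag b t c) (y z : k) (j : ℕ) :
    Module.finrank k ↥((LinearMap.ker (f - algebraMap k (Module.End k V) y) ⊓
      LinearMap.range ((f - algebraMap k (Module.End k V) y) ^ j)) ⊓
      LinearMap.ker (c - algebraMap k (Module.End k V) z)) =
    Nat.card {i // x i = y ∧ j < a i ∧ t i = z} := by
  classical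
  have := Fintype.ofFinite ι
  set W := (LinearMap.ker (f - algebraMap k (Module.End k V) y) ⊓
      LinearMap.range ((f - algebraMap k (Module.End k V) y) ^ j)) ⊓
      LinearMap.ker (c - algebraMap k (Module.End k V) z) with hW
  have hmem : ∀ v, v ∈ W ↔ ∀ i m, jco b v i m ≠ 0 → m = 0 ∧ x i = y ∧ j < a i ∧ t i = z := by
    intro v
    rw [hW, Submodule.mem_inf, h.mem_ker_inf_range_iff b, LinearMap.mem_ker]
    have h1 : (c - algebraMap k (Module.End k V) z) v = 0 ↔
        ∀ i m, jco b v i m ≠ 0 → t i = z := by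
      constructor
      · intro hv i m hne
        have h2 : jco b ((c - algebraMap k (Module.End k V) z) v) i m = 0 := by
          rw [hv, jco_zero]
        rw [LinearMap.sub_apply, jco_sub, hc, Module.algebraMap_end_apply, jco_smul,
          ← sub_mul] at h2
        exact sub_eq_zero.1 ((mul_eq_zero.1 h2).resolve_right hne)
      · intro hv
        refine jco_ext b fun i m => ?_
        rw [LinearMap.sub_apply, jco_sub, hc, Module.algebraMap_end_apply, jco_smul,
          ← sub_mul, jco_zero]
        by_cases hne : jco b v i m = 0
        · rw [hne, mul_zero]
        · rw [hv i m hne, sub_self, zero_mul]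
    rw [h1]
    exact ⟨fun ⟨p, q⟩ i m hne => ⟨(p i m hne).1, (p i m hne).2.1, (p i m hne).2.2, q i m hne⟩,
      fun p => ⟨fun i m hne => ⟨(p i m hne).1, (p i m hne).2.1, (p i m hne).2.2.1⟩,
        fun i m hne => (p i m hne).2.2.2⟩⟩
  let φ : W →ₗ[k] ({i // x i = y ∧ j < a i ∧ t i = z} → k) :=
    { toFun := fun v i => jco b v.1 i.1 0
      map_add' := fun v w => funext fun i => jco_add b _ _ _ _
      map_smul' := fun r v => funext fun i => jco_smul b _ _ _ _ }
  have hφ : Function.Bijective φ := by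
    constructor
    · rw [← LinearMap.ker_eq_bot, LinearMap.ker_eq_bot']
      intro v hv
      refine Subtype.ext (jco_ext b fun i m => ?_)
      rw [ZeroMemClass.coe_zero, jco_zero]
      by_contra hne
      obtain ⟨rfl, h2⟩ := (hmem v.1).1 v.2 i m hne
      exact hne (congrFun hv ⟨i, h2⟩)
    · intro g
      obtain ⟨w, hw⟩ := exists_jco_eq b fun i m =>
        if h : m = 0 ∧ x i = y ∧ j < a i ∧ t i = z then g ⟨i, h.2⟩ else 0
      refine ⟨⟨w, (hmem w).2 fun i m hne => ?_⟩, ?_⟩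
      · rw [hw] at hne
        by_contra hn
        simp [hn] at hne
      · funext i
        change jco b w i.1 0 = g i
        rw [hw, if_pos (Nat.zero_lt_of_lt i.2.2.1), dif_pos ⟨rfl, i.2⟩]
  rw [(LinearEquiv.ofBijective φ hφ).finrank_eq, Module.finrank_fintype_fun_eq_card,
    Nat.card_eq_fintype_card]

/-- Uniqueness of simultaneous Jordan normal forms. -/
theorem exists_equiv_of_isJordan {ι' : Type*} {a' : ι' → ℕ} [Finite ι] [Finite ι']
    (b' : Module.Basis (Σ i, Fin (a' i)) k V) {x t : ι → k} {x' t' : ι' → k}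
    {f c : Module.End k V} (ha : ∀ i, 0 < a i) (ha' : ∀ i, 0 < a' i)
    (h : IsJordan b x f) (hc : IsDiag b t c) (h' : IsJordan b' x' f) (hc' : IsDiag b' t' c) :
    ∃ τ : ι ≃ ι', ∀ i, a' (τ i) = a i ∧ x' (τ i) = x i ∧ t' (τ i) = t i := by
  have key : ∀ y z j, Nat.card {i // x i = y ∧ j < a i ∧ t i = z} =
      Nat.card {i // x' i = y ∧ j < a' i ∧ t' i = z} := fun y z j => by
    rw [← finrank_ker_inf_range_inf_ker b h hc, ← finrank_ker_inf_range_inf_ker b' h' hc']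
  refine exists_equiv_of_card_eq ha ha' fun y z j => ?_
  have h1 := card_lt_eq_add a x t y z j
  have h2 := card_lt_eq_add a' x' t' y z j
  rw [key y z j, key y z (j + 1), h2] at h1
  omega

variable {V' : Type*} [AddCommGroup V'] [Module k V'] {ι' : Type*} {a' : ι' → ℕ}
  (b' : Module.Basis (Σ i, Fin (a' i)) k V')

/-- The block permutation as a linear map. By the next two lemmas it intertwines operators whose
normal forms match under τ. -/
theorem exists_linearEquiv_jco_eq (τ : ι ≃ ι') (h : ∀ i, a' (τ i) = a i) :
    ∃ L : V ≃ₗ[k] V', ∀ v i m, jco b' (L v) (τ i) m = jco b v i m := by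
  let e : (Σ i, Fin (a i)) ≃ (Σ i, Fin (a' i)) :=
    τ.sigmaCongr fun i => finCongr (h i).symm
  refine ⟨b.repr ≪≫ₗ Finsupp.domLCongr e ≪≫ₗ b'.repr.symm, fun v i m => ?_⟩
  by_cases hm : m < a i
  · have hm' : m < a' (τ i) := by rwa [h]
    rw [jco_of_lt b hm, jco_of_lt b' hm']
    have : (⟨τ i, ⟨m, hm'⟩⟩ : Σ i, Fin (a' i)) = e ⟨i, ⟨m, hm⟩⟩ := rfl
    rw [this]
    simp only [LinearEquiv.trans_apply, LinearEquiv.apply_symm_apply, Finsupp.domLCongr_apply,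
      Finsupp.domCongr_apply, Finsupp.equivMapDomain_apply, Equiv.symm_apply_apply]
  · rw [jco_of_le b (not_lt.1 hm), jco_of_le b' (by rw [h]; exact not_lt.1 hm)]

variable {b b'} in
theorem IsJordan.comm_of_jco_eq {τ : ι ≃ ι'} {L : V ≃ₗ[k] V'} {x : ι → k} {x' : ι' → k}
    {f : Module.End k V} {f' : Module.End k V'}
    (hL : ∀ v i m, jco b' (L v) (τ i) m = jco b v i m) (hx : ∀ i, x' (τ i) = x i)
    (h : IsJordan b x f) (h' : IsJordan b' x' f') (v : V) : L (f v) = f' (L v) := by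
  refine jco_ext b' fun i' m => ?_
  obtain ⟨i, rfl⟩ := τ.surjective i'
  rw [hL, h, h', hL, hL, hx]

variable {b b'} in
theorem IsDiag.comm_of_jco_eq {τ : ι ≃ ι'} {L : V ≃ₗ[k] V'} {x : ι → k} {x' : ι' → k}
    {f : Module.End k V} {f' : Module.End k V'}
    (hL : ∀ v i m, jco b' (L v) (τ i) m = jco b v i m) (hx : ∀ i, x' (τ i) = x i)
    (h : IsDiag b x f) (h' : IsDiag b' x' f') (v : V) : L (f v) = f' (L v) := by
  refine jco_ext b' fun i' m => ?_
  obtain ⟨i, rfl⟩ := τ.surjective i'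
  rw [hL, h, h', hL, hx]

theorem jco_map (L : V ≃ₗ[k] V') (v : V) (i : ι) (m : ℕ) :
    jco (b.map L) (L v) i m = jco b v i m := by
  unfold jco; split_ifs <;> simp

end JordanBasis

end RegSL

end

noncomputable section

namespace RegSL

open Matrix

/-! ### Jordan bases of nilpotent endomorphisms -/

section Existence

variable {k : Type*} [Field k] {V : Type*} [AddCommGroup V] [Module k V]
  {ι : Type*} {a : ι → ℕ}

open Classical in
theorem jco_basis (b : Module.Basis (Σ i, Fin (a i)) k V) (p : Σ i, Fin (a i)) (i : ι) (m : ℕ) :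
    jco b (b p) i m = if p.1 = i ∧ (p.2 : ℕ) = m then 1 else 0 := by
  obtain ⟨i', j⟩ := p
  by_cases hm : m < a i
  · rw [jco_of_lt b hm, Module.Basis.repr_self, Finsupp.single_apply]
    congr 1
    apply propext
    constructor
    · intro h
      obtain ⟨rfl, h2⟩ := Sigma.mk.inj h
      exact ⟨rfl, congrArg Fin.val (eq_of_heq h2)⟩
    · rintro ⟨rfl, h2⟩
      exact congrArg _ (Fin.ext h2)
  · rw [jco_of_le b (not_lt.1 hm), if_neg]
    rintro ⟨rfl, h2⟩
    exact hm (h2 ▸ j.2)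

/-- The coordinates as linear forms. -/
def jcoL (b : Module.Basis (Σ i, Fin (a i)) k V) (i : ι) (m : ℕ) : V →ₗ[k] k where
  toFun v := jco b v i m
  map_add' v w := jco_add b v w i m
  map_smul' c v := jco_smul b c v i m

theorem isJordan_of_apply_basis (b : Module.Basis (Σ i, Fin (a i)) k V) {x : ι → k}
    {f : Module.End k V} (h0 : ∀ i (h : 0 < a i), f (b ⟨i, 0, h⟩) = x i • b ⟨i, 0, h⟩)
    (h1 : ∀ i m (h : m + 1 < a i), f (b ⟨i, m + 1, h⟩) =
      x i • b ⟨i, m + 1, h⟩ + b ⟨i, m, Nat.lt_of_succ_lt h⟩) : IsJordan b x f := by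
  classical
  intro v i m
  have : (jcoL b i m).comp f = x i • jcoL b i m + jcoL b i (m + 1) := by
    refine b.ext ?_
    rintro ⟨i', j, hj⟩
    change jco b (f (b ⟨i', j, hj⟩)) i m =
      x i * jco b (b ⟨i', j, hj⟩) i m + jco b (b ⟨i', j, hj⟩) i (m + 1)
    rcases j with _ | j
    · rw [h0, jco_smul, jco_basis, jco_basis, if_neg (c := _ ∧ _ = m + 1) (by simp)]
      by_cases hi : i' = i
      · subst hi; simp
      · simp [hi]
    · rw [h1, jco_add, jco_smul, jco_basis, jco_basis, jco_basis]
      by_cases hi : i' = i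
      · subst hi; simp
      · simp [hi]
  exact LinearMap.congr_fun this v

theorem isDiag_of_apply_basis (b : Module.Basis (Σ i, Fin (a i)) k V) {t : ι → k}
    {c : Module.End k V} (h : ∀ p, c (b p) = t p.1 • b p) : IsDiag b t c := by
  classical
  intro v i m
  have : (jcoL b i m).comp c = t i • jcoL b i m := by
    refine b.ext fun p => ?_
    change jco b (c (b p)) i m = t i * jco b (b p) i m
    rw [h, jco_smul, jco_basis]
    by_cases hi : p.1 = i
    · subst hi; rfl
    · simp [hi]
  exact LinearMap.congr_fun this v

theorem IsJordan.apply_basis {b : Module.Basis (Σ i, Fin (a i)) k V} {x : ι → k}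
    {f : Module.End k V} (hf : IsJordan b x f) :
    (∀ i (h : 0 < a i), f (b ⟨i, 0, h⟩) = x i • b ⟨i, 0, h⟩) ∧
    (∀ i m (h : m + 1 < a i), f (b ⟨i, m + 1, h⟩) =
      x i • b ⟨i, m + 1, h⟩ + b ⟨i, m, Nat.lt_of_succ_lt h⟩) := by
  classical
  refine ⟨fun i h => jco_ext b fun i' m' => ?_, fun i m h => jco_ext b fun i' m' => ?_⟩
  · rw [hf, jco_smul, jco_basis, jco_basis, if_neg (c := _ ∧ _ = m' + 1) (by simp)]
    by_cases hi : i = i'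
    · subst hi; simp
    · simp [hi]
  · rw [hf, jco_add, jco_smul, jco_basis, jco_basis, jco_basis]
    by_cases hi : i = i'
    · subst hi; simp
    · simp [hi]

theorem IsDiag.apply_basis {b : Module.Basis (Σ i, Fin (a i)) k V} {t : ι → k}
    {c : Module.End k V} (hc : IsDiag b t c) (p : Σ i, Fin (a i)) : c (b p) = t p.1 • b p := by
  classical
  refine jco_ext b fun i' m' => ?_
  rw [hc, jco_smul, jco_basis]
  by_cases hi : p.1 = i'
  · subst hi; rfl
  · simp [hi]

-- The powers of X are listed in decreasing order, so that multiplication by X lowers the index and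
-- kills the vector with index 0, as `IsJordan` demands.
open Polynomial in
theorem exists_basis_quotient_X_pow (e : ℕ) :
    ∃ b : Module.Basis (Fin e) k (k[X] ⧸ Submodule.span k[X] {(X : k[X]) ^ e}),
      ∀ j, b j = Submodule.Quotient.mk (X ^ (e - 1 - (j : ℕ))) := by
  have hm : ((X : k[X]) ^ e).Monic := monic_X_pow e
  have hd : ((X : k[X]) ^ e).natDegree = e := natDegree_X_pow e
  let b0 : Module.Basis (Fin e) k (AdjoinRoot ((X : k[X]) ^ e)) :=
    ((AdjoinRoot.powerBasis' hm).basis.reindex (finCongr hd)).reindex Fin.revPerm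
  have hb0 : ∀ j, b0 j = AdjoinRoot.mk _ (X ^ (e - 1 - (j : ℕ))) := by
    intro j
    simp only [b0, Module.Basis.reindex_apply, PowerBasis.basis_eq_pow]
    rw [AdjoinRoot.powerBasis'_gen, map_pow, AdjoinRoot.mk_X]
    change AdjoinRoot.root _ ^ ((Fin.rev j : Fin e) : ℕ) = _
    rw [Fin.val_rev]
    congr 1
    omega
  exact ⟨b0, hb0⟩

-- Through g, V is a k[X]-module killed by a power of the prime X. The structure theorem splits it
-- into modules k[X]/(X^e), each forming one string. Empty strings (e = 0) may occur;
-- `exists_fin_reindex` discards them later.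
open Polynomial DirectSum in
theorem exists_isJordan_of_isNilpotent [FiniteDimensional k V] {g : Module.End k V}
    (hg : IsNilpotent g) :
    ∃ (d : ℕ) (a : Fin d → ℕ) (b : Module.Basis (Σ i, Fin (a i)) k V),
      IsJordan b (fun _ => 0) g := by
  obtain ⟨N, hN⟩ := hg
  have htors : Module.IsTorsion' (Module.AEval' g) (Submonoid.powers (X : k[X])) := by
    intro m
    obtain ⟨v, rfl⟩ := (Module.AEval'.of g).surjective m
    refine ⟨⟨X ^ N, N, rfl⟩, ?_⟩
    change (X ^ N : k[X]) • Module.AEval'.of g v = 0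
    rw [Module.AEval'.X_pow_smul_of, hN, zero_smul, map_zero]
  obtain ⟨d, e, ⟨L⟩⟩ := Module.torsion_by_prime_power_decomposition irreducible_X htors
  choose bq hbq using fun i : Fin d => exists_basis_quotient_X_pow (k := k) (e i)
  let b0 : Module.Basis (Σ i, Fin (e i)) k
      (∀ i : Fin d, k[X] ⧸ Submodule.span k[X] {(X : k[X]) ^ e i}) := Pi.basis bq
  have hb0 : ∀ p, b0 p = LinearMap.single k[X] _ p.1
      (Submodule.Quotient.mk (X ^ (e p.1 - 1 - (p.2 : ℕ)))) := by
    rintro ⟨i, j⟩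
    rw [← hbq i j]
    exact Pi.basis_apply _ _
  let L' := L.trans (DirectSum.linearEquivFunOnFintype k[X] _ _)
  let E := (Module.AEval'.of g).trans (L'.restrictScalars k)
  let b := b0.map E.symm
  have hE : ∀ v, E (g v) = (X : k[X]) • E v := by
    intro v
    change L' (Module.AEval'.of g (g v)) = X • L' (Module.AEval'.of g v)
    rw [← Module.AEval'.X_smul_of, map_smul]
  refine ⟨d, e, b, isJordan_of_apply_basis b ?_ ?_⟩
  · intro i h
    apply E.injective
    rw [hE, map_smul, zero_smul]
    simp only [b, Module.Basis.map_apply, LinearEquiv.apply_symm_apply]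
    rw [hb0, ← map_smul, ← Submodule.Quotient.mk_smul, smul_eq_mul, ← pow_succ']
    have h2 : e i - 1 - 0 + 1 = e i := by omega
    simp only
    rw [h2, (Submodule.Quotient.mk_eq_zero _).2 (Submodule.mem_span_singleton_self _), map_zero]
  · intro i m h
    apply E.injective
    rw [hE, map_add, map_smul, zero_smul, zero_add]
    simp only [b, Module.Basis.map_apply, LinearEquiv.apply_symm_apply]
    rw [hb0, hb0, ← map_smul, ← Submodule.Quotient.mk_smul, smul_eq_mul, ← pow_succ']
    have h2 : e i - 1 - (m + 1) + 1 = e i - 1 - m := by omega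
    simp only
    rw [h2]

end Existence

end RegSL

end

noncomputable section

namespace RegSL

open Matrix

/-! ### Simultaneous Jordan forms -/

section Simultaneous

variable {k : Type*} [Field k] {V : Type*} [AddCommGroup V] [Module k V]
  {ι : Type*} {a : ι → ℕ}

/-- Drops empty strings. The index type may be infinite, as it is for simultaneous eigenspaces
indexed by all pairs of scalars, but only finitely many strings are nonempty. -/
theorem exists_fin_reindex [FiniteDimensional k V] (b : Module.Basis (Σ i, Fin (a i)) k V) :
    ∃ (r : ℕ) (φ : Fin r → ι) (b' : Module.Basis (Σ i, Fin (a (φ i))) k V),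
      (∀ i, 0 < a (φ i)) ∧ ∀ v i m, jco b' v i m = jco b v (φ i) m := by
  have h1 : Finite (Σ i, Fin (a i)) := Module.Finite.finite_basis b
  have h2 : Finite {i // 0 < a i} :=
    Finite.of_injective (fun i => (⟨i.1, ⟨0, i.2⟩⟩ : Σ i, Fin (a i)))
      fun i j h => Subtype.ext (Sigma.mk.inj h).1
  obtain ⟨r, ⟨e⟩⟩ := Finite.exists_equiv_fin {i // 0 < a i}
  let φ : Fin r → ι := fun i => (e.symm i).1
  let ψ : (Σ i, Fin (a (φ i))) → Σ i, Fin (a i) := fun p => ⟨φ p.1, p.2⟩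
  have hψ : Function.Bijective ψ := by
    constructor
    · rintro ⟨i, m⟩ ⟨i', m'⟩ h
      have h3 := (Sigma.mk.inj h).1
      have h4 : i = i' := e.symm.injective (Subtype.ext h3)
      subst h4
      exact congrArg _ (eq_of_heq (Sigma.mk.inj h).2)
    · rintro ⟨i, m⟩
      obtain ⟨j, hj⟩ := e.symm.surjective ⟨i, Nat.zero_lt_of_lt m.2⟩
      have hj' : φ j = i := congrArg Subtype.val hj
      subst hj'
      exact ⟨⟨j, m⟩, rfl⟩
  let E := Equiv.ofBijective ψ hψ
  refine ⟨r, φ, b.reindex E.symm, fun i => (e.symm i).2, fun v i m => ?_⟩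
  by_cases hm : m < a (φ i)
  · rw [jco_of_lt (a := fun i => a (φ i)) _ hm, jco_of_lt _ hm,
      Module.Basis.repr_reindex_apply, Equiv.symm_symm]
    rfl
  · rw [jco_of_le (a := fun i => a (φ i)) _ (not_lt.1 hm), jco_of_le _ (not_lt.1 hm)]

/-- In characteristic zero X^N - 1 is separable, so c is semisimple. -/
theorem maxGenEigenspace_eq_eigenspace_of_pow_eq_one [CharZero k] [FiniteDimensional k V]
    {c : Module.End k V} {N : ℕ} (hN : N ≠ 0) (hc : c ^ N = 1) (z : k) :
    c.maxGenEigenspace z = c.eigenspace z := by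
  have hs : c.IsSemisimple := by
    refine Module.End.isSemisimple_of_squarefree_aeval_eq_zero
      (p := (Polynomial.X ^ N - 1 : Polynomial k)) ?_ (by simp [hc])
    exact (Polynomial.X_pow_sub_one_separable_iff.2 (by exact_mod_cast hN)).squarefree
  exact hs.isFinitelySemisimple.maxGenEigenspace_eq_eigenspace z

/-- Existence of simultaneous Jordan normal forms. -/
theorem exists_isJordan_isDiag [IsAlgClosed k] [CharZero k] [FiniteDimensional k V]
    {f c : Module.End k V} (hfc : Commute f c) {N : ℕ} (hN : N ≠ 0) (hc : c ^ N = 1) :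
    ∃ (r : ℕ) (a : Fin r → ℕ) (x t : Fin r → k) (b : Module.Basis (Σ i, Fin (a i)) k V),
      (∀ i, 0 < a i) ∧ IsJordan b x f ∧ IsDiag b t c := by
  classical
  -- `false` stands for f and `true` for c; W χ is the simultaneous generalized eigenspace for the
  -- eigenvalues χ false and χ true.
  let F : Bool → Module.End k V := fun i => if i then c else f
  let W : (Bool → k) → Submodule k V := fun χ => ⨅ i, (F i).maxGenEigenspace (χ i)
  have hcomm : ∀ i j, Commute (F i) (F j) := by
    rintro (_ | _) (_ | _) <;> simp [F, hfc, hfc.symm]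
  have hmaps : ∀ i j φ, Set.MapsTo (F i) ((F j).maxGenEigenspace φ) ((F j).maxGenEigenspace φ) :=
    fun i j φ => Module.End.mapsTo_maxGenEigenspace_of_comm (hcomm j i) φ
  have hint : DirectSum.IsInternal W :=
    DirectSum.isInternal_submodule_of_iSupIndep_of_iSup_eq_top
      (Module.End.independent_iInf_maxGenEigenspace_of_forall_mapsTo F hmaps)
      (Module.End.iSup_iInf_maxGenEigenspace_eq_top_of_forall_mapsTo F hmaps
        fun i => Module.End.iSup_maxGenEigenspace_eq_top (F i))
  have hWf : ∀ χ v, v ∈ W χ → f v ∈ W χ := by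
    intro χ v hv
    rw [Submodule.mem_iInf] at hv ⊢
    exact fun i => hmaps false i _ (hv i)
  have hWc : ∀ χ v, v ∈ W χ → c v = χ true • v := by
    intro χ v hv
    have h1 : v ∈ c.maxGenEigenspace (χ true) := (Submodule.mem_iInf _).1 hv true
    rw [maxGenEigenspace_eq_eigenspace_of_pow_eq_one hN hc] at h1
    exact Module.End.mem_eigenspace_iff.1 h1
  -- On W χ the operator c is a scalar, so every Jordan basis for the nilpotent part of f on W χ is
  -- adapted to c as well.
  let g : (χ : Bool → k) → Module.End k (W χ) := fun χ =>
    (f.restrict (hWf χ)) - algebraMap k _ (χ false)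
  have hg : ∀ χ, IsNilpotent (g χ) := by
    intro χ
    refine ⟨Module.finrank k V, LinearMap.ext fun v => Subtype.ext ?_⟩
    have h1 : v.1 ∈ f.maxGenEigenspace (χ false) := (Submodule.mem_iInf _).1 v.2 false
    rw [Module.End.maxGenEigenspace_eq_genEigenspace_finrank, Module.End.mem_genEigenspace_nat,
      LinearMap.mem_ker] at h1
    have h2 : ∀ (m : ℕ) (v : W χ), (((g χ) ^ m) v).1 = ((f - χ false • 1) ^ m) v.1 := by
      intro m
      induction m with
      | zero => intro v; rfl
      | succ m ih =>
        intro v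
        rw [pow_succ, pow_succ, Module.End.mul_apply, Module.End.mul_apply, ih]
        rfl
    rw [h2, h1]
    rfl
  choose d a b hb using fun χ => exists_isJordan_of_isNilpotent (hg χ)
  let a0 : (Σ χ, Fin (d χ)) → ℕ := fun p => a p.1 p.2
  let b0 : Module.Basis (Σ p : (Σ χ, Fin (d χ)), Fin (a0 p)) k V :=
    (hint.collectedBasis b).reindex
      (Equiv.sigmaAssoc (fun (χ : Bool → k) (i : Fin (d χ)) => Fin (a χ i))).symm
  have hb0 : ∀ χ i j, b0 ⟨⟨χ, i⟩, j⟩ = (b χ ⟨i, j⟩ : V) := by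
    intro χ i j
    simp only [b0, Module.Basis.reindex_apply, DirectSum.IsInternal.collectedBasis_coe]
    rfl
  have hfg : ∀ χ (v : W χ), f v.1 = χ false • v.1 + (g χ v).1 := by
    intro χ v
    simp [g]
  have hJ : IsJordan b0 (fun p => p.1 false) f := by
    refine isJordan_of_apply_basis b0 ?_ ?_
    · rintro ⟨χ, i⟩ h
      rw [hb0, hfg, (hb χ).apply_basis.1 i h, zero_smul, ZeroMemClass.coe_zero, add_zero]
    · rintro ⟨χ, i⟩ m h
      rw [hb0, hb0, hfg, (hb χ).apply_basis.2 i m h, zero_smul, zero_add]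
  have hD : IsDiag b0 (fun p => p.1 true) c := by
    refine isDiag_of_apply_basis b0 ?_
    rintro ⟨⟨χ, i⟩, j⟩
    rw [hb0, hWc χ _ (b χ ⟨i, j⟩).2]
  obtain ⟨r, φ, b', hpos, hb'⟩ := exists_fin_reindex b0
  refine ⟨r, _, fun i => (φ i).1 false, fun i => (φ i).1 true, b', hpos, ?_, ?_⟩
  · intro v i m
    rw [hb', hb', hb', hJ]
  · intro v i m
    rw [hb', hb', hD]

end Simultaneous

/-! ### The standard basis as a Jordan basis of a Jordan matrix -/

section JordanMatrix

variable {n : ℕ} {k : Type*} [Field k]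

theorem JordanForm.basis_aux {X : Matrix (Fin n) (Fin n) k} (P : JordanForm X)
    (p q : Σ i, Fin (P.a i)) :
    X (finCongr P.sum_eq (finSigmaFinEquiv p)) (finCongr P.sum_eq (finSigmaFinEquiv q)) =
      Matrix.blockDiagonal' (fun i => jordanBlock (P.x i) (P.a i)) p q := by
  refine (congrFun (congrFun P.eq _) _).trans ?_
  simp [jordanMatrix]

/-- The standard basis of `k ^ n`, arranged into strings according to the Jordan blocks. -/
def JordanForm.basis {X : Matrix (Fin n) (Fin n) k} (P : JordanForm X) :
    Module.Basis (Σ i, Fin (P.a i)) k (Fin n → k) :=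
  (Pi.basisFun k (Fin n)).reindex (finSigmaFinEquiv.trans (finCongr P.sum_eq)).symm

theorem JordanForm.basis_apply {X : Matrix (Fin n) (Fin n) k} (P : JordanForm X)
    (p : Σ i, Fin (P.a i)) :
    P.basis p = Pi.single (finCongr P.sum_eq (finSigmaFinEquiv p)) 1 := by
  simp [JordanForm.basis]

theorem JordanForm.basis_repr {X : Matrix (Fin n) (Fin n) k} (P : JordanForm X) (v : Fin n → k)
    (p : Σ i, Fin (P.a i)) :
    P.basis.repr v p = v (finCongr P.sum_eq (finSigmaFinEquiv p)) := by
  rw [JordanForm.basis, Module.Basis.repr_reindex_apply]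
  rfl

theorem JordanForm.isJordan {X : Matrix (Fin n) (Fin n) k} (P : JordanForm X) :
    IsJordan P.basis P.x (Matrix.toLin' X) := by
  classical
  have key : ∀ p q, P.basis.repr (Matrix.toLin' X (P.basis p)) q =
      Matrix.blockDiagonal' (fun i => jordanBlock (P.x i) (P.a i)) q p := by
    intro p q
    rw [JordanForm.basis_repr, JordanForm.basis_apply, Matrix.toLin'_apply,
      Matrix.mulVec_single_one, Matrix.col_apply]
    exact P.basis_aux q p
  refine isJordan_of_apply_basis _ (fun i h => ?_) (fun i m h => ?_)
  · apply P.basis.repr.injective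
    ext q
    obtain ⟨i', j⟩ := q
    rw [key]
    simp only [map_smul, Module.Basis.repr_self, Finsupp.smul_apply]
    by_cases hi : i' = i
    · subst hi
      by_cases hj : j = ⟨0, h⟩
      · subst hj
        simp [Matrix.blockDiagonal'_apply_eq, jordanBlock]
      · simp [Matrix.blockDiagonal'_apply_eq, jordanBlock, hj]
    · rw [Matrix.blockDiagonal'_apply_ne _ _ _ hi, Finsupp.single_apply, if_neg]
      · simp
      · intro h'
        exact hi (Sigma.mk.inj h').1.symm
  · apply P.basis.repr.injective
    ext q
    obtain ⟨i', j⟩ := q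
    rw [key]
    simp only [map_smul, map_add, Module.Basis.repr_self, Finsupp.smul_apply, Finsupp.add_apply]
    by_cases hi : i' = i
    · subst hi
      by_cases hj : j = ⟨m + 1, h⟩
      · subst hj
        simp [Matrix.blockDiagonal'_apply_eq, jordanBlock]
      · by_cases hj' : (j : ℕ) = m
        · have : j = ⟨m, Nat.lt_of_succ_lt h⟩ := Fin.ext hj'
          subst this
          simp [Matrix.blockDiagonal'_apply_eq, jordanBlock]
        · have h1 : (⟨m, Nat.lt_of_succ_lt h⟩ : Fin (P.a i')) ≠ j := fun e => hj' (by rw [← e])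
          simp [Matrix.blockDiagonal'_apply_eq, jordanBlock, hj, hj', h1]
    · rw [Matrix.blockDiagonal'_apply_ne _ _ _ hi, Finsupp.single_apply, Finsupp.single_apply,
        if_neg, if_neg]
      · simp
      · intro h'
        exact hi (Sigma.mk.inj h').1.symm
      · intro h'
        exact hi (Sigma.mk.inj h').1.symm

end JordanMatrix

end RegSL

end

noncomputable section

namespace RegSL

open Matrix

/-! ### Jordan forms of matrices, the torus T_X and block permutations -/

section MatrixJordan

variable {n : ℕ} {k : Type*} [Field k]

theorem exists_GL_of_linearEquiv (L : (Fin n → k) ≃ₗ[k] (Fin n → k)) :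
    ∃ g : GL (Fin n) k, Matrix.toLin' g.1 = L.toLinearMap := by
  refine ⟨⟨LinearMap.toMatrix' L.toLinearMap, LinearMap.toMatrix' L.symm.toLinearMap, ?_, ?_⟩, ?_⟩
  · rw [← LinearMap.toMatrix'_comp]; simp
  · rw [← LinearMap.toMatrix'_comp]; simp
  · exact Matrix.toLin'_toMatrix' _

theorem GL_det_ne_zero (g : GL (Fin n) k) : g.1.det ≠ 0 :=
  (Matrix.isUnit_iff_isUnit_det g.1).1 g.isUnit |>.ne_zero

theorem mul_eq_mul_of_toLin' {A B C D : Matrix (Fin n) (Fin n) k}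
    (h : ∀ v, Matrix.toLin' A (Matrix.toLin' B v) = Matrix.toLin' C (Matrix.toLin' D v)) :
    A * B = C * D := by
  apply Matrix.toLin'.injective
  rw [Matrix.toLin'_mul, Matrix.toLin'_mul]
  exact LinearMap.ext h

theorem toLin'_comm {A B C D : Matrix (Fin n) (Fin n) k} (h : A * B = C * D) (v : Fin n → k) :
    Matrix.toLin' A (Matrix.toLin' B v) = Matrix.toLin' C (Matrix.toLin' D v) := by
  rw [← Matrix.toLin'_mul_apply, h, Matrix.toLin'_mul_apply]

/-- A matrix with a Jordan basis is similar to the corresponding Jordan matrix. -/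
theorem exists_jordanForm_of_isJordan {r : ℕ} {a : Fin r → ℕ} {x : Fin r → k}
    (b : Module.Basis (Σ i, Fin (a i)) k (Fin n → k)) (ha : ∀ i, 0 < a i)
    {A : Matrix (Fin n) (Fin n) k} (h : IsJordan b x (Matrix.toLin' A)) :
    ∃ (X : Matrix (Fin n) (Fin n) k) (_ : JordanForm X) (g : GL (Fin n) k),
      g.1 * A = X * g.1 := by
  have hsum : ∑ i, a i = n := by
    have h1 := Module.finrank_eq_card_basis b
    rw [Module.finrank_fintype_fun_eq_card, Fintype.card_fin, Fintype.card_sigma] at h1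
    simpa using h1.symm
  let P : JordanForm (Matrix.reindex (finCongr hsum) (finCongr hsum) (jordanMatrix x a)) :=
    ⟨r, x, a, ha, hsum, rfl⟩
  obtain ⟨L, hL⟩ := exists_linearEquiv_jco_eq b P.basis (Equiv.refl _) (fun _ => rfl)
  have hLf := h.comm_of_jco_eq (τ := Equiv.refl _) (x' := P.x) hL (fun _ => rfl) P.isJordan
  obtain ⟨g, hg⟩ := exists_GL_of_linearEquiv L
  refine ⟨_, P, g, mul_eq_mul_of_toLin' fun v => ?_⟩
  rw [hg]
  exact hLf v

theorem exists_SL_of_GL [IsAlgClosed k] (g : GL (Fin n) k) :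
    ∃ (h : Matrix.SpecialLinearGroup (Fin n) k) (c : k), c ≠ 0 ∧
      (h : Matrix (Fin n) (Fin n) k) = c • g.1 := by
  obtain ⟨c, hc, h⟩ := exists_smul_det_eq_one g.1 (GL_det_ne_zero g)
  exact ⟨⟨c • g.1, h⟩, c, hc, rfl⟩

/-- Every square matrix over an algebraically closed field has a Jordan normal form. -/
theorem exists_jordanForm [IsAlgClosed k] [CharZero k] (A : Matrix (Fin n) (Fin n) k) :
    ∃ (X : Matrix (Fin n) (Fin n) k) (_ : JordanForm X) (g : Matrix.SpecialLinearGroup (Fin n) k),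
      (g : Matrix (Fin n) (Fin n) k) * A = X * g := by
  obtain ⟨r, a, x, t, b, ha, hb, -⟩ := exists_isJordan_isDiag (f := Matrix.toLin' A) (c := 1)
    (Commute.one_right _) one_ne_zero (pow_one _)
  obtain ⟨X, P, g, hg⟩ := exists_jordanForm_of_isJordan b ha hb
  obtain ⟨h, c, -, hh⟩ := exists_SL_of_GL g
  refine ⟨X, P, h, ?_⟩
  rw [hh, Matrix.smul_mul, hg, Matrix.mul_smul]

/-- Uniqueness of the Jordan normal form of a matrix. -/
theorem JordanForm.exists_equiv {X Y : Matrix (Fin n) (Fin n) k} (P : JordanForm X)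
    (Q : JordanForm Y) (g : GL (Fin n) k) (h : g.1 * X = Y * g.1) :
    ∃ τ : Fin P.r ≃ Fin Q.r, ∀ i, Q.a (τ i) = P.a i ∧ Q.x (τ i) = P.x i := by
  let L : (Fin n → k) ≃ₗ[k] (Fin n → k) := Matrix.GeneralLinearGroup.toLin g |>.toLinearEquiv
  have hL : ∀ v, L v = Matrix.toLin' g.1 v := fun v => rfl
  have hJ : IsJordan (P.basis.map L) P.x (Matrix.toLin' Y) := by
    intro v i m
    obtain ⟨v, rfl⟩ := L.surjective v
    have h1 : Matrix.toLin' Y (L v) = L (Matrix.toLin' X v) := by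
      rw [hL, hL, toLin'_comm h]
    rw [h1, jco_map, jco_map, jco_map, P.isJordan]
  obtain ⟨τ, hτ⟩ := exists_equiv_of_isJordan (P.basis.map L) Q.basis P.a_pos Q.a_pos hJ
    (isDiag_one _) Q.isJordan (isDiag_one _)
  exact ⟨τ, fun i => ⟨(hτ i).1, (hτ i).2.1⟩⟩

theorem mem_diagTorus_iff (g : GL (Fin n) k) :
    g ∈ diagTorus n k ↔ ∃ δ : Fin n → k, g.1 = Matrix.diagonal δ := by
  constructor
  · rintro ⟨δ, rfl⟩
    exact ⟨δ.1, rfl⟩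
  · rintro ⟨δ, hδ⟩
    have hne : ∀ q, δ q ≠ 0 := by
      have h1 := GL_det_ne_zero g
      rw [hδ, Matrix.det_diagonal, Finset.prod_ne_zero_iff] at h1
      exact fun q => h1 q (Finset.mem_univ q)
    exact ⟨⟨δ, fun i => (δ i)⁻¹, funext fun i => mul_inv_cancel₀ (hne i),
      funext fun i => inv_mul_cancel₀ (hne i)⟩, Units.ext hδ.symm⟩

variable {X : Matrix (Fin n) (Fin n) k} (P : JordanForm X)

/-- A diagonal matrix commuting with X is constant on each block, because the ones above the
diagonal of X link neighbouring basis vectors. -/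
theorem mem_torus_iff_isDiag (s : centGL X) :
    s ∈ torus X ↔ ∃ t, IsDiag P.basis t (Matrix.toLin' s.1.1) := by
  let e : (Σ i, Fin (P.a i)) ≃ Fin n := finSigmaFinEquiv.trans (finCongr P.sum_eq)
  have hrepr : ∀ v p, P.basis.repr v p = v (e p) := fun v p => P.basis_repr v p
  have hs : s.1.1 * X = X * s.1.1 := s.2
  refine (mem_diagTorus_iff s.1).trans ?_
  constructor
  · rintro ⟨δ, hδ⟩
    have hco : ∀ v i m (h : m < P.a i), jco P.basis (Matrix.toLin' s.1.1 v) i m =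
        δ (e ⟨i, m, h⟩) * jco P.basis v i m := by
      intro v i m h
      rw [jco_of_lt _ h, jco_of_lt _ h, hrepr, hrepr, hδ, Matrix.toLin'_apply,
        Matrix.mulVec_diagonal]
    have hconst : ∀ i m (h : m < P.a i), δ (e ⟨i, m, h⟩) = δ (e ⟨i, 0, P.a_pos i⟩) := by
      intro i m
      induction m with
      | zero => intro h; rfl
      | succ m ih =>
        intro h
        rw [← ih (Nat.lt_of_succ_lt h)]
        classical
        have h1 := congrArg (fun v => jco P.basis v i m)
          (toLin'_comm hs (P.basis ⟨i, m + 1, h⟩))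
        beta_reduce at h1
        rw [hco _ _ _ (Nat.lt_of_succ_lt h), P.isJordan, P.isJordan,
          hco _ _ _ (Nat.lt_of_succ_lt h), hco _ _ _ h, jco_basis, jco_basis] at h1
        simpa using h1.symm
    refine ⟨fun i => δ (e ⟨i, 0, P.a_pos i⟩), fun v i m => ?_⟩
    by_cases h : m < P.a i
    · rw [hco _ _ _ h, hconst]
    · rw [jco_of_le _ (not_lt.1 h), jco_of_le _ (not_lt.1 h), mul_zero]
  · rintro ⟨t, ht⟩
    refine ⟨fun q => t (e.symm q).1, ?_⟩
    apply Matrix.toLin'.injective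
    refine P.basis.ext fun p => ?_
    rw [ht.apply_basis, P.basis_apply, Matrix.toLin'_apply, Matrix.diagonal_mulVec_single,
      ← Pi.single_smul]
    have : e.symm (finCongr P.sum_eq (finSigmaFinEquiv p)) = p := e.symm_apply_apply p
    rw [this, smul_eq_mul]

/-- Torus elements whose entries are related by a permutation of equal Jordan blocks are conjugate
under an element of the centralizer normalizing the torus. -/
theorem exists_conj_of_equiv {s t : centGL X} {c d : Fin P.r → k}
    (hs : IsDiag P.basis c (Matrix.toLin' s.1.1)) (ht : IsDiag P.basis d (Matrix.toLin' t.1.1))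
    (τ : Fin P.r ≃ Fin P.r) (hτ : ∀ i, P.a (τ i) = P.a i ∧ P.x (τ i) = P.x i ∧ d (τ i) = c i) :
    ∃ p : centGL X, p * s * p⁻¹ = t ∧ ∀ q, q ∈ torus X ↔ p * q * p⁻¹ ∈ torus X := by
  obtain ⟨L, hL⟩ := exists_linearEquiv_jco_eq P.basis P.basis τ (fun i => (hτ i).1)
  obtain ⟨g, hg⟩ := exists_GL_of_linearEquiv L
  have hgX : g.1 * X = X * g.1 := mul_eq_mul_of_toLin' fun v => by
    rw [hg]
    exact P.isJordan.comm_of_jco_eq hL (fun i => (hτ i).2.1) P.isJordan v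
  let p : centGL X := ⟨g, hgX⟩
  have hconj : ∀ (q q' : centGL X) (e e' : Fin P.r → k),
      IsDiag P.basis e (Matrix.toLin' q.1.1) → IsDiag P.basis e' (Matrix.toLin' q'.1.1) →
      (∀ i, e' (τ i) = e i) → p * q = q' * p := by
    intro q q' e e' hq hq' he
    refine Subtype.ext (Units.ext ?_)
    change g.1 * q.1.1 = q'.1.1 * g.1
    refine mul_eq_mul_of_toLin' fun v => ?_
    rw [hg]
    exact hq.comm_of_jco_eq hL he hq' v
  have hps : p * s * p⁻¹ = t := by
    rw [hconj s t c d hs ht (fun i => (hτ i).2.2), mul_inv_cancel_right]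
  refine ⟨p, hps, fun q => ?_⟩
  rw [mem_torus_iff_isDiag P, mem_torus_iff_isDiag P]
  have hpq : ∀ v, L (Matrix.toLin' q.1.1 v) = Matrix.toLin' (p * q * p⁻¹).1.1 (L v) := by
    intro v
    have h1 : g.1 * q.1.1 = (p * q * p⁻¹).1.1 * g.1 := by
      change _ = ((p * q * p⁻¹ * p : centGL X)).1.1
      rw [inv_mul_cancel_right]
      rfl
    have h2 := toLin'_comm h1 v
    rw [hg] at h2
    exact h2
  constructor
  · rintro ⟨e, he⟩
    refine ⟨fun i => e (τ.symm i), fun v i m => ?_⟩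
    obtain ⟨v, rfl⟩ := L.surjective v
    obtain ⟨i, rfl⟩ := τ.surjective i
    rw [← hpq, hL, hL, he]
    beta_reduce
    rw [Equiv.symm_apply_apply]
  · rintro ⟨e, he⟩
    refine ⟨fun i => e (τ i), fun v i m => ?_⟩
    rw [← hL, hpq, he, hL]

/-- The block permutation p normalizes the torus inside the centralizer, so `piHom X p` normalizes
the image and represents the required Weyl group element. -/
theorem weylRel_of_equiv {s t : centGL X} {c d : Fin P.r → k}
    (hs : IsDiag P.basis c (Matrix.toLin' s.1.1)) (ht : IsDiag P.basis d (Matrix.toLin' t.1.1))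
    (τ : Fin P.r ≃ Fin P.r) (hτ : ∀ i, P.a (τ i) = P.a i ∧ P.x (τ i) = P.x i ∧ d (τ i) = c i) :
    WeylRel X s t := by
  obtain ⟨p, hp, hT⟩ := exists_conj_of_equiv P hs ht τ hτ
  refine ⟨piHom X p, Subgroup.mem_normalizer_iff.2 fun h => ?_, ?_⟩
  · constructor
    · rintro ⟨q, hq, rfl⟩
      exact ⟨p * q * p⁻¹, (hT q).1 hq, by simp⟩
    · rintro ⟨q, hq, h1⟩
      refine ⟨p⁻¹ * q * p, (hT _).2 ?_, ?_⟩
      · convert! hq using 1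
        group
      · rw [map_mul, map_mul, h1, map_inv]
        group
  · rw [← hp, map_mul, map_mul, map_inv]

/-- Conjugate elements of the torus are related by a permutation of equal Jordan blocks. -/
theorem exists_equiv_of_conj {s t : centGL X} {c d : Fin P.r → k}
    (hs : IsDiag P.basis c (Matrix.toLin' s.1.1)) (ht : IsDiag P.basis d (Matrix.toLin' t.1.1))
    (u : centGL X) (hu : u * s = t * u) :
    ∃ τ : Fin P.r ≃ Fin P.r, ∀ i, P.a (τ i) = P.a i ∧ P.x (τ i) = P.x i ∧ d (τ i) = c i := by
  let L : (Fin n → k) ≃ₗ[k] (Fin n → k) := Matrix.GeneralLinearGroup.toLin u.1 |>.toLinearEquiv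
  have hL : ∀ v, L v = Matrix.toLin' u.1.1 v := fun v => rfl
  have hX : u.1.1 * X = X * u.1.1 := u.2
  have hst : u.1.1 * s.1.1 = t.1.1 * u.1.1 := congrArg (fun g : centGL X => g.1.1) hu
  refine exists_equiv_of_isJordan (P.basis.map L) P.basis (f := Matrix.toLin' X)
    (c := Matrix.toLin' t.1.1) P.a_pos P.a_pos ?_ ?_ P.isJordan ht
  · intro v i m
    obtain ⟨v, rfl⟩ := L.surjective v
    have h1 : Matrix.toLin' X (L v) = L (Matrix.toLin' X v) := by
      rw [hL, hL, toLin'_comm hX]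
    rw [h1, jco_map, jco_map, jco_map, P.isJordan]
  · intro v i m
    obtain ⟨v, rfl⟩ := L.surjective v
    have h1 : Matrix.toLin' t.1.1 (L v) = L (Matrix.toLin' s.1.1 v) := by
      rw [hL, hL, toLin'_comm hst]
    rw [h1, jco_map, jco_map, hs]

end MatrixJordan

end RegSL

end

noncomputable section

namespace RegSL

open Matrix

/-! ### Weyl group orbits and conjugacy in the centralizer -/

section Weyl

variable {n : ℕ} {k : Type*} [Field k] {X : Matrix (Fin n) (Fin n) k} (P : JordanForm X)

/-- Coordinates on `E_λ^j / E_λ^{j+1}` indexed by the Jordan blocks of size `j + 1` with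
eigenvalue `λ`. -/
theorem exists_eigGr_equiv (y : k) (j : ℕ) :
    ∃ Q : eigGr X y j ≃ₗ[k] ({i // P.a i = j + 1 ∧ P.x i = y} → k),
      ∀ (s : centGL X) (c : Fin P.r → k), IsDiag P.basis c (Matrix.toLin' s.1.1) →
        ∀ v i, Q ((piHom X s (y, j)).1 v) i = c i.1 * Q v i := by
  let φ : eigFil X y j →ₗ[k] ({i // P.a i = j + 1 ∧ P.x i = y} → k) :=
    { toFun := fun v i => jco P.basis v.1 i.1 0
      map_add' := fun v w => funext fun i => jco_add P.basis _ _ _ _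
      map_smul' := fun r v => funext fun i => jco_smul P.basis _ _ _ _ }
  have hmem : ∀ (l : ℕ) v, v ∈ eigFil X y l ↔
      ∀ i m, jco P.basis v i m ≠ 0 → m = 0 ∧ P.x i = y ∧ l < P.a i :=
    fun l v => P.isJordan.mem_ker_inf_range_iff P.basis y l v
  -- Vectors of E^j live on the first places of strings longer than j, those of E^(j+1) on strings
  -- longer than j + 1; the quotient sees exactly the strings of length j + 1.
  have hker : (eigFil X y (j + 1)).submoduleOf (eigFil X y j) = LinearMap.ker φ := by
    ext ⟨v, hv⟩
    rw [LinearMap.mem_ker]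
    change v ∈ eigFil X y (j + 1) ↔ _
    rw [hmem]
    rw [hmem] at hv
    constructor
    · intro h
      funext i
      change jco P.basis v i.1 0 = 0
      by_contra hne
      have := (h _ _ hne).2.2
      rw [i.2.1] at this
      exact lt_irrefl _ this
    · intro h i m hne
      obtain ⟨rfl, h2, h3⟩ := hv i m hne
      refine ⟨rfl, h2, lt_of_le_of_ne h3 fun h4 => hne ?_⟩
      exact congrFun h ⟨i, h4.symm, h2⟩
  have hsurj : Function.Surjective φ := by
    intro g
    classical
    obtain ⟨w, hw⟩ := exists_jco_eq P.basis fun i m =>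
      if h : m = 0 ∧ P.a i = j + 1 ∧ P.x i = y then g ⟨i, h.2⟩ else 0
    refine ⟨⟨w, (hmem j w).2 fun i m hne => ?_⟩, ?_⟩
    · rw [hw] at hne
      by_cases hn : m = 0 ∧ P.a i = j + 1 ∧ P.x i = y
      · exact ⟨hn.1, hn.2.2, by rw [hn.2.1]; exact Nat.lt_succ_self j⟩
      · simp [hn] at hne
    · funext i
      change jco P.basis w i.1 0 = g i
      rw [hw, if_pos (P.a_pos _), dif_pos ⟨rfl, i.2⟩]
  let Q : eigGr X y j ≃ₗ[k] ({i // P.a i = j + 1 ∧ P.x i = y} → k) :=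
    (Submodule.quotEquivOfEq _ _ hker).trans (φ.quotKerEquivOfSurjective hsurj)
  refine ⟨Q, fun s c hs q i => ?_⟩
  obtain ⟨v, rfl⟩ := Submodule.Quotient.mk_surjective _ q
  exact hs v.1 i.1 0

/-- On each graded piece w conjugates the action of s into that of t. Both are diagonal with entries
indexed by the blocks of one size and eigenvalue, so each scalar occurs equally often among these
entries. -/
theorem exists_equiv_of_weylRel {s t : centGL X} {c d : Fin P.r → k}
    (hs : IsDiag P.basis c (Matrix.toLin' s.1.1)) (ht : IsDiag P.basis d (Matrix.toLin' t.1.1))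
    (h : WeylRel X s t) :
    ∃ τ : Fin P.r ≃ Fin P.r, ∀ i, P.a (τ i) = P.a i ∧ P.x (τ i) = P.x i ∧ d (τ i) = c i := by
  obtain ⟨w, -, hw⟩ := h
  refine exists_equiv_of_card_eq P.a_pos P.a_pos fun y z j => ?_
  obtain ⟨Q, hQ⟩ := exists_eigGr_equiv P y j
  have hw' : ∀ v, (w (y, j)).1 ((piHom X s (y, j)).1 v) =
      (piHom X t (y, j)).1 ((w (y, j)).1 v) := by
    intro v
    have h1 : w (y, j) * piHom X s (y, j) = piHom X t (y, j) * w (y, j) := by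
      rw [← Pi.mul_apply, ← Pi.mul_apply, ← hw, inv_mul_cancel_right]
    exact LinearMap.congr_fun (congrArg Units.val h1) v
  let W : eigGr X y j ≃ₗ[k] eigGr X y j :=
    LinearMap.GeneralLinearGroup.toLinearEquiv (w (y, j))
  have hW : ∀ v, W v = (w (y, j)).1 v := fun v => rfl
  let I := {i // P.a i = j + 1 ∧ P.x i = y}
  -- An eigenbasis is viewed as a basis of strings of length one, Jordan for the zero operator;
  -- uniqueness of simultaneous Jordan forms then compares multiplicities.
  let b0 : Module.Basis (Σ _ : I, Fin 1) k (eigGr X y j) :=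
    ((Pi.basisFun k I).map Q.symm).reindex
      (Equiv.sigmaUnique I (fun _ => Fin 1)).symm
  have hb0 : ∀ p, Q (b0 p) = Pi.single p.1 1 := by
    intro p
    simp [b0]
  have hb1 : ∀ p, (piHom X s (y, j)).1 (b0 p) = c p.1.1 • b0 p := by
    intro p
    apply Q.injective
    funext i
    rw [hQ s c hs, map_smul, hb0, Pi.smul_apply, smul_eq_mul]
    by_cases hi : i = p.1
    · rw [hi]
    · simp [hi]
  have hb2 : ∀ p, (piHom X t (y, j)).1 (b0 p) = d p.1.1 • b0 p := by
    intro p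
    apply Q.injective
    funext i
    rw [hQ t d ht, map_smul, hb0, Pi.smul_apply, smul_eq_mul]
    by_cases hi : i = p.1
    · rw [hi]
    · simp [hi]
  have hz : ∀ b : Module.Basis (Σ _ : I, Fin 1) k (eigGr X y j),
      IsJordan b (fun _ => 0) (0 : Module.End k (eigGr X y j)) := by
    intro b v i m
    rw [LinearMap.zero_apply, jco_zero, zero_mul, zero_add]
    exact (jco_of_le b (Nat.le_add_left _ _)).symm
  obtain ⟨τ, hτ⟩ := exists_equiv_of_isJordan (b0.map W) b0 (c := (piHom X t (y, j)).1)
    (fun _ => Nat.zero_lt_one) (fun _ => Nat.zero_lt_one) (hz _)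
    (t := fun i : I => c i.1) (isDiag_of_apply_basis _ fun p => by
      rw [Module.Basis.map_apply, hW, ← hw', hb1, map_smul]) (hz _)
    (t' := fun i : I => d i.1) (isDiag_of_apply_basis _ hb2)
  refine Nat.card_congr ⟨fun i => ⟨(τ ⟨i.1, ?_⟩).1, ?_⟩, fun i => ⟨(τ.symm ⟨i.1, ?_⟩).1, ?_⟩,
    fun i => ?_, fun i => ?_⟩
  · have := Prod.mk.inj i.2
    exact ⟨this.1, (Prod.mk.inj this.2).1⟩
  · have h1 := Prod.mk.inj i.2
    have h2 := (hτ ⟨i.1, h1.1, (Prod.mk.inj h1.2).1⟩).2.2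
    refine Prod.ext (τ _).2.1 (Prod.ext (τ _).2.2 ?_)
    exact h2.trans (Prod.mk.inj h1.2).2
  · have := Prod.mk.inj i.2
    exact ⟨this.1, (Prod.mk.inj this.2).1⟩
  · have h1 := Prod.mk.inj i.2
    have h2 := (hτ (τ.symm ⟨i.1, h1.1, (Prod.mk.inj h1.2).1⟩)).2.2
    rw [Equiv.apply_symm_apply] at h2
    refine Prod.ext (τ.symm _).2.1 (Prod.ext (τ.symm _).2.2 ?_)
    exact h2.symm.trans (Prod.mk.inj h1.2).2
  · refine Subtype.ext ?_
    simp
  · refine Subtype.ext ?_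
    simp

theorem exists_isDiag (d : DTors X) :
    ∃ t, IsDiag P.basis t (Matrix.toLin' d.toCent.1.1) :=
  (mem_torus_iff_isDiag P d.toCent).1 d.2.1

/-- The inclusion of the centralizer of `X` in `SL_n` into the one in `GL_n`. -/
def centSLtoGL (X : Matrix (Fin n) (Fin n) k) : centSL X →* centGL X where
  toFun u := ⟨Matrix.SpecialLinearGroup.toGL u.1, u.2⟩
  map_one' := Subtype.ext (map_one _)
  map_mul' _ _ := Subtype.ext (map_mul _ _ _)

theorem exists_centSL_of_centGL [IsAlgClosed k] (p : centGL X) :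
    ∃ (u : centSL X) (c : k), c ≠ 0 ∧ (u.1 : Matrix (Fin n) (Fin n) k) = c • p.1.1 := by
  obtain ⟨h, c, hc, hh⟩ := exists_SL_of_GL p.1
  refine ⟨⟨h, ?_⟩, c, hc, hh⟩
  have hp : p.1.1 * X = X * p.1.1 := p.2
  change (h : Matrix (Fin n) (Fin n) k) * X = X * h
  rw [hh, Matrix.smul_mul, hp, Matrix.mul_smul]

/-- Torsion elements of `D_X` are related by the Weyl group if and only if they are conjugate in
the centralizer of `X`. -/
theorem weylSetoid_iff_conj [IsAlgClosed k] (P : JordanForm X) (d e : DTors X) :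
    (weylSetoid X) d e ↔ ∃ u : centSL X, u * d.1 = e.1 * u := by
  obtain ⟨c, hc⟩ := exists_isDiag P d
  obtain ⟨c', hc'⟩ := exists_isDiag P e
  constructor
  · intro h
    obtain ⟨τ, hτ⟩ := exists_equiv_of_weylRel P hc hc' h
    obtain ⟨p, hp, -⟩ := exists_conj_of_equiv P hc hc' τ hτ
    obtain ⟨u, r, hr, hu⟩ := exists_centSL_of_centGL p
    refine ⟨u, Subtype.ext (Subtype.ext ?_)⟩
    change (u.1 : Matrix (Fin n) (Fin n) k) * d.1.1 = (e.1.1 : Matrix (Fin n) (Fin n) k) * u.1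
    have h1 : p * d.toCent = e.toCent * p := by rw [← hp, inv_mul_cancel_right]
    have h2 : p.1.1 * d.1.1 = (e.1.1 : Matrix (Fin n) (Fin n) k) * p.1.1 :=
      congrArg (fun g : centGL X => g.1.1) h1
    rw [hu, Matrix.smul_mul, h2, Matrix.mul_smul]
  · rintro ⟨u, hu⟩
    have h1 : centSLtoGL X u * d.toCent = e.toCent * centSLtoGL X u := by
      have h2 := congrArg (centSLtoGL X) hu
      rwa [map_mul, map_mul] at h2
    obtain ⟨τ, hτ⟩ := exists_equiv_of_conj P hc hc' (centSLtoGL X u) h1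
    exact weylRel_of_equiv P hc hc' τ hτ

/-- Every element of finite order of the centralizer of `X` is conjugate into `D_X`. -/
theorem exists_conj_mem_DTors [IsAlgClosed k] [CharZero k] (P : JordanForm X) (c : centSL X)
    (hc : IsOfFinOrder c) :
    ∃ (d : DTors X) (u : centSL X), c = u * d.1 * u⁻¹ := by
  obtain ⟨N, hN, hcN⟩ := isOfFinOrder_iff_pow_eq_one.1 hc
  let C : Matrix (Fin n) (Fin n) k := c.1
  have hCX : C * X = X * C := c.2
  have hCN : C ^ N = 1 := by
    have h1 := congrArg (fun g : centSL X => (g.1 : Matrix (Fin n) (Fin n) k)) hcN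
    simpa using h1
  obtain ⟨r, a, x, t, b, ha, hb, hbt⟩ := exists_isJordan_isDiag (f := Matrix.toLin' X)
    (c := Matrix.toLin' C) (N := N) (LinearMap.ext fun v => (toLin'_comm hCX v).symm) hN.ne' (by
      rw [← Matrix.toLin'_pow, hCN, Matrix.toLin'_one]; rfl)
  -- The basis b is adapted to X and c, but its strings are matched with the blocks of P using X
  -- alone. The resulting base change commutes with X and makes c diagonal.
  obtain ⟨τ, hτ⟩ := exists_equiv_of_isJordan b P.basis ha P.a_pos hb (isDiag_one b) P.isJordan
    (isDiag_one _)
  obtain ⟨L, hL⟩ := exists_linearEquiv_jco_eq b P.basis τ (fun i => (hτ i).1)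
  obtain ⟨g, hg⟩ := exists_GL_of_linearEquiv L
  have hgX : g.1 * X = X * g.1 := mul_eq_mul_of_toLin' fun v => by
    rw [hg]
    exact hb.comm_of_jco_eq hL (fun i => (hτ i).2.1) P.isJordan v
  obtain ⟨u, r, hr, hu⟩ := exists_centSL_of_centGL ⟨g, hgX⟩
  have hmem : centSLtoGL X (u * c * u⁻¹) ∈ torus X := by
    rw [mem_torus_iff_isDiag P]
    refine ⟨fun i => t (τ.symm i), fun v i m => ?_⟩
    obtain ⟨v, rfl⟩ := L.surjective v
    obtain ⟨i, rfl⟩ := τ.surjective i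
    have h1 : (u * c * u⁻¹) * u = u * c := inv_mul_cancel_right _ _
    have h2 : ((u * c * u⁻¹).1 : Matrix (Fin n) (Fin n) k) * u.1 =
        (u.1 : Matrix (Fin n) (Fin n) k) * C :=
      congrArg (fun g : centSL X => (g.1 : Matrix (Fin n) (Fin n) k)) h1
    rw [hu, Matrix.mul_smul, Matrix.smul_mul] at h2
    have h3 := toLin'_comm (smul_right_injective _ hr h2) v
    change Matrix.toLin' _ (Matrix.toLin' g.1 v) = Matrix.toLin' g.1 _ at h3
    rw [hg] at h3
    change jco P.basis (Matrix.toLin' ((u * c * u⁻¹).1 : Matrix (Fin n) (Fin n) k) (L v)) _ _ = _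
    have h4 : Matrix.toLin' ((u * c * u⁻¹).1 : Matrix (Fin n) (Fin n) k) (L v) =
      L (Matrix.toLin' C v) := h3
    rw [h4, hL, hL, hbt]
    beta_reduce
    rw [Equiv.symm_apply_apply]
  have hfin : IsOfFinOrder (u * c * u⁻¹) := by
    rw [isOfFinOrder_iff_pow_eq_one]
    exact ⟨N, hN, by rw [conj_pow, hcN, mul_one, mul_inv_cancel]⟩
  exact ⟨⟨u * c * u⁻¹, hmem, hfin⟩, u⁻¹, by group⟩

end Weyl

end RegSL

end

noncomputable section

namespace RegSL

open Matrix

/-! ### Coefficientwise intertwining, stabilizers and descent -/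

section Intertwine

variable {n : ℕ} {k : Type*} [Field k]

/-- The matrix of coefficients of `z ^ i`. -/
def coeffMat (g : Matrix (Fin n) (Fin n) (LField k)) (i : ℤ) : Matrix (Fin n) (Fin n) k :=
  g.map fun f => f.coeff i

theorem coeffMat_eulerMat (g : Matrix (Fin n) (Fin n) (LField k)) (i : ℤ) :
    coeffMat (eulerMat g) i = (i : k) • coeffMat g i := by
  ext1 a b
  exact euler_coeff k _ _

theorem coeffMat_add (g h : Matrix (Fin n) (Fin n) (LField k)) (i : ℤ) :
    coeffMat (g + h) i = coeffMat g i + coeffMat h i := by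
  ext1 a b
  exact HahnSeries.coeff_add

theorem coeffMat_mul_C (g : Matrix (Fin n) (Fin n) (LField k)) (X : Matrix (Fin n) (Fin n) k)
    (i : ℤ) : coeffMat (g * X.map (HahnSeries.C : k →+* LField k)) i = coeffMat g i * X := by
  ext1 a b
  simp only [coeffMat, Matrix.map_apply, Matrix.mul_apply, HahnSeries.coeff_sum]
  refine Finset.sum_congr rfl fun j _ => ?_
  rw [HahnSeries.C_apply, HahnSeries.coeff_mul_single_zero]

theorem coeffMat_C_mul (g : Matrix (Fin n) (Fin n) (LField k)) (X : Matrix (Fin n) (Fin n) k)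
    (i : ℤ) : coeffMat (X.map (HahnSeries.C : k →+* LField k) * g) i = X * coeffMat g i := by
  ext1 a b
  simp only [coeffMat, Matrix.map_apply, Matrix.mul_apply, HahnSeries.coeff_sum]
  refine Finset.sum_congr rfl fun j _ => ?_
  rw [HahnSeries.C_apply, HahnSeries.coeff_single_zero_mul]

/-- Constant connections do not mix degrees: each coefficient M of g satisfies its own equation ZM -
MY = iM. -/
theorem coeffMat_intertwine {g : Matrix (Fin n) (Fin n) (LField k)}
    {Y Z : LieAlgebra.SpecialLinear.sl (Fin n) k}
    (h : eulerMat g + g * (constConn Y).1 = (constConn Z).1 * g) (i : ℤ) :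
    (i : k) • coeffMat g i + coeffMat g i * Y.1 = Z.1 * coeffMat g i := by
  have h1 := congrArg (fun g => coeffMat g i) h
  change coeffMat (eulerMat g + g * Y.1.map (HahnSeries.C : k →+* LField k)) i =
    coeffMat (Z.1.map (HahnSeries.C : k →+* LField k) * g) i at h1
  rwa [coeffMat_add, coeffMat_eulerMat, coeffMat_mul_C, coeffMat_C_mul] at h1

theorem eq_map_C_of_coeffMat {g : Matrix (Fin n) (Fin n) (LField k)}
    (h : ∀ i, i ≠ 0 → coeffMat g i = 0) : g = (coeffMat g 0).map (HahnSeries.C : k →+* LField k) := by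
  ext a b i
  rw [Matrix.map_apply, HahnSeries.C_apply]
  by_cases hi : i = 0
  · subst hi
    rw [HahnSeries.coeff_single_same]
    rfl
  · rw [HahnSeries.coeff_single_of_ne hi]
    exact congrFun (congrFun (h i hi) a) b

theorem map_C_det (c : Matrix (Fin n) (Fin n) k) :
    (c.map (HahnSeries.C : k →+* LField k)).det = HahnSeries.C c.det :=
  ((HahnSeries.C : k →+* LField k).map_det c).symm

/-- `ad X` has no rational eigenvalue other than zero. -/
def NoRatEigenvalue (X : LieAlgebra.SpecialLinear.sl (Fin n) k) : Prop :=
  ∀ q : ℚ, Module.End.HasEigenvalue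
    (LieAlgebra.ad k (LieAlgebra.SpecialLinear.sl (Fin n) k) X) (q : k) → q = 0

/-- A commutator has trace zero, so q ≠ 0 forces tr M = 0, and a nonzero M would be an eigenvector
of ad X in 𝔰𝔩_n. -/
theorem NoRatEigenvalue.eq_zero [CharZero k] {X : LieAlgebra.SpecialLinear.sl (Fin n) k}
    (hX : NoRatEigenvalue X) {M : Matrix (Fin n) (Fin n) k} {q : ℚ} (hq : q ≠ 0)
    (h : X.1 * M - M * X.1 = (q : k) • M) : M = 0 := by
  by_contra hM
  have htr : M.trace = 0 := by
    have h1 := congrArg Matrix.trace h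
    rw [Matrix.trace_sub, Matrix.trace_mul_comm, sub_self, Matrix.trace_smul, smul_eq_mul] at h1
    exact (mul_eq_zero.1 h1.symm).resolve_left (by exact_mod_cast hq)
  let N : LieAlgebra.SpecialLinear.sl (Fin n) k := ⟨M, htr⟩
  refine hq (hX q (Module.End.hasEigenvalue_of_hasEigenvector (x := N) ⟨?_, ?_⟩))
  · rw [Module.End.mem_eigenspace_iff]
    exact Subtype.ext h
  · intro h0
    exact hM (congrArg Subtype.val h0)

/-- Gauge transformations stabilizing `X dlog z` are constant. -/
theorem exists_eq_map_C_of_stabilizer [CharZero k] {X : LieAlgebra.SpecialLinear.sl (Fin n) k}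
    (hX : NoRatEigenvalue X) (l : ℕ+) (h : Matrix.SpecialLinearGroup (Fin n) (LField k))
    (hh : gauge h (pullback l (constConn X)) = pullback l (constConn X)) :
    ∃ c : centSL X.1, h = Matrix.SpecialLinearGroup.map HahnSeries.C c.1 := by
  rw [pullback_constConn, gauge_eq_iff] at hh
  have hl : ((l : ℕ) : k) ≠ 0 := by exact_mod_cast l.ne_zero
  have key := coeffMat_intertwine hh
  -- The coefficient M of z^i satisfies [X, M] = (i/l) M, so it vanishes for i ≠ 0.
  have hk : ∀ i : ℤ, X.1 * coeffMat h.1 i - coeffMat h.1 i * X.1 =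
      (((i : ℚ) / ((l : ℕ) : ℚ) : ℚ) : k) • coeffMat h.1 i := by
    intro i
    have h1 := key i
    change (i : k) • coeffMat h.1 i + coeffMat h.1 i * (((l : ℕ) : k) • X.1) =
      (((l : ℕ) : k) • X.1) * coeffMat h.1 i at h1
    rw [Matrix.mul_smul, Matrix.smul_mul] at h1
    push_cast
    rw [div_eq_inv_mul, mul_smul, eq_inv_smul_iff₀ hl, smul_sub, ← h1, add_sub_cancel_right]
  have hC := eq_map_C_of_coeffMat (g := h.1) fun i hi =>
    hX.eq_zero (div_ne_zero (by exact_mod_cast hi) (by exact_mod_cast l.ne_zero)) (hk i)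
  have hdet : (coeffMat h.1 0).det = 1 := by
    apply (HahnSeries.C : k →+* LField k).injective
    rw [← map_C_det, ← hC, map_one]
    exact h.2
  refine ⟨⟨⟨coeffMat h.1 0, hdet⟩, ?_⟩, Subtype.ext hC⟩
  have h0 := hk 0
  simp only [Int.cast_zero, zero_div, Rat.cast_zero, zero_smul] at h0
  exact (sub_eq_zero.1 h0).symm

theorem gauge_map_C {X : LieAlgebra.SpecialLinear.sl (Fin n) k} (l : ℕ+) (u : centSL X.1) :
    gauge (Matrix.SpecialLinearGroup.map HahnSeries.C u.1) (pullback l (constConn X)) =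
      pullback l (constConn X) := by
  rw [pullback_constConn, gauge_eq_iff]
  have hu : (u.1 : Matrix (Fin n) (Fin n) k) * X.1 = X.1 * u.1 := u.2
  change eulerMat ((u.1 : Matrix (Fin n) (Fin n) k).map (HahnSeries.C : k →+* LField k)) +
    (u.1 : Matrix (Fin n) (Fin n) k).map (HahnSeries.C : k →+* LField k) *
      (((l : ℕ) : k) • X.1).map (HahnSeries.C : k →+* LField k) =
    (((l : ℕ) : k) • X.1).map (HahnSeries.C : k →+* LField k) *
      (u.1 : Matrix (Fin n) (Fin n) k).map (HahnSeries.C : k →+* LField k)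
  rw [eulerMat_map_C, zero_add, ← Matrix.map_mul, ← Matrix.map_mul, Matrix.mul_smul, hu,
    Matrix.smul_mul]

theorem SL_map_injective {R S : Type*} [CommRing R] [CommRing S] (f : R →+* S)
    (hf : Function.Injective f) :
    Function.Injective (Matrix.SpecialLinearGroup.map (n := Fin n) f) := by
  intro g h H
  refine Matrix.SpecialLinearGroup.ext _ _ fun i j => hf ?_
  exact congrArg (fun g : Matrix.SpecialLinearGroup (Fin n) S => g.1 i j) H

theorem eulerMat_twist (ζ : kˣ) (g : Matrix (Fin n) (Fin n) (LField k)) :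
    eulerMat (g.map (twist ζ)) = (eulerMat g).map (twist ζ) := by
  ext1 i j
  exact euler_twist ζ _

theorem pullback_map_twist {l : ℕ+} {ζ : kˣ} (h : ζ ^ (l : ℕ) = 1) (A : Conn n k) :
    (pullback l A).1.map (twist ζ) = (pullback l A).1 := by
  ext1 i j
  change twist ζ (((l : ℕ) : LField k) * incl k l (A.1 i j)) =
    ((l : ℕ) : LField k) * incl k l (A.1 i j)
  rw [map_mul, map_natCast, twist_incl l h]

/-- Connections pulled back from K are invariant under the substitution, which commutes with z∂_z;
so Galois conjugates of a gauge transformation relate the same two connections. -/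
theorem gauge_twist {l : ℕ+} {ζ : kˣ} (h : ζ ^ (l : ℕ) = 1)
    (g : Matrix.SpecialLinearGroup (Fin n) (LField k)) {A B : Conn n k}
    (hg : gauge g (pullback l A) = pullback l B) :
    gauge (Matrix.SpecialLinearGroup.map (twist ζ) g) (pullback l A) = pullback l B := by
  rw [gauge_eq_iff] at hg ⊢
  have h' := congrArg (fun M => Matrix.map M (twist ζ)) hg
  beta_reduce at h'
  rw [Matrix.map_add _ (map_add _), Matrix.map_mul, Matrix.map_mul, pullback_map_twist h,
    pullback_map_twist h, ← eulerMat_twist] at h'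
  exact h'

theorem exists_map_incl_of_twist_eq {l : ℕ+} {ζ : kˣ} (hζ : IsPrimitiveRoot ζ l)
    (g : Matrix.SpecialLinearGroup (Fin n) (LField k))
    (hg : Matrix.SpecialLinearGroup.map (twist ζ) g = g) :
    ∃ g0, Matrix.SpecialLinearGroup.map (incl k l) g0 = g := by
  have h1 : ∀ i j, ∃ f, incl k l f = g.1 i j := fun i j =>
    mem_range_incl_of_twist_eq hζ
      (congrArg (fun g : Matrix.SpecialLinearGroup (Fin n) (LField k) => g.1 i j) hg)
  choose f hf using h1
  have hM : (Matrix.of f).map (incl k l) = g.1 := by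
    ext1 i j
    exact hf i j
  have hdet : (Matrix.of f).det = 1 := by
    apply (incl k l).injective
    rw [map_one, RingHom.map_det, RingHom.mapMatrix_apply, hM]
    exact g.2
  exact ⟨⟨_, hdet⟩, Subtype.ext hM⟩

end Intertwine

end RegSL

end

noncomputable section

namespace RegSL

open Matrix

/-! ### The bijection between torsion classes and relatives of X dlog z -/

section Correspondence

variable {n : ℕ} {k : Type*} [Field k] {γ : AbsGal k}

theorem SL_map_twist_map_C (ζ : kˣ) (u : Matrix.SpecialLinearGroup (Fin n) k) :
    Matrix.SpecialLinearGroup.map (twist ζ)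
      (Matrix.SpecialLinearGroup.map (HahnSeries.C : k →+* LField k) u) =
    Matrix.SpecialLinearGroup.map HahnSeries.C u :=
  Matrix.SpecialLinearGroup.ext _ _ fun _ _ => twist_C ζ _

/-- Equivalent form of the correspondence, where the value of the cocycle at `γ` lies in `D_X`, and
where the extension may be enlarged. -/
theorem exists_of_corresponds {X : LieAlgebra.SpecialLinear.sl (Fin n) k} {δ : TorsClass X.1} {c : GaugeClass n k}
    (h : Corresponds γ X δ c) :
    ∃ (B : Conn n k) (d : DTors X.1) (l : ℕ+), gaugeClass B = c ∧
      Quotient.mk (weylSetoid X.1) d = δ ∧ ∀ m : ℕ+, ∀ ζ : kˣ,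
      (∀ f : LField k, γ (iota k (l * m) f) = iota k (l * m) (twist ζ f)) →
      ∃ b : Matrix.SpecialLinearGroup (Fin n) (LField k),
        gauge b (pullback (l * m) B) = pullback (l * m) (constConn X) ∧
        b = Matrix.SpecialLinearGroup.map HahnSeries.C d.1.1 *
          Matrix.SpecialLinearGroup.map (twist ζ) b := by
  obtain ⟨B, d, l, b, u, hB, hd, hb, hc⟩ := h
  refine ⟨B, d, l, hB, hd, fun m ζ hζ => ?_⟩
  rw [← cocycleAt_incl γ l m, cocycleAt_eq_iff hζ] at hc
  refine ⟨Matrix.SpecialLinearGroup.map HahnSeries.C (u⁻¹).1 *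
    Matrix.SpecialLinearGroup.map (incl k m) b, ?_, ?_⟩
  · rw [gauge_mul, ← pullback_pullback, gauge_pullback m b hb, pullback_pullback, gauge_map_C]
  · have SL_map_twist_map_C : ∀ u : Matrix.SpecialLinearGroup (Fin n) k, Matrix.SpecialLinearGroup.map (twist ζ)
        (Matrix.SpecialLinearGroup.map HahnSeries.C u) =
        Matrix.SpecialLinearGroup.map HahnSeries.C u := fun u =>
      Matrix.SpecialLinearGroup.ext _ _ fun i j => twist_C ζ _
    rw [map_mul, SL_map_twist_map_C]
    conv_lhs => rw [hc]
    rw [← mul_assoc, ← mul_assoc, ← map_mul, ← map_mul]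
    congr 2
    change ((u⁻¹ * (u * d.1 * u⁻¹) : centSL X.1)).1 = (d.1 * u⁻¹ : centSL X.1).1
    congr 1
    group

theorem mem_relClasses_of_corresponds {X : LieAlgebra.SpecialLinear.sl (Fin n) k}
    {δ : TorsClass X.1} {c : GaugeClass n k} (h : Corresponds γ X δ c) :
    c ∈ relClasses (constConn X) := by
  obtain ⟨B, d, l, b, u, hB, -, hb, -⟩ := h
  exact ⟨B, Related.symm ⟨l, b, hb⟩, hB⟩

theorem twist_iterate_coeff (ζ : kˣ) (j : ℕ) (f : LField k) (i : ℤ) :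
    ((twist ζ)^[j] f).coeff i = (((ζ ^ j) ^ i : kˣ) : k) * f.coeff i := by
  induction j with
  | zero => simp
  | succ j ih =>
    rw [Function.iterate_succ_apply', twist_coeff, ih, pow_succ, _root_.mul_zpow, Units.val_mul]
    ring

/-- Since v is constant, iteration gives b = v^j · b(ζ^j z); for j = l the substitution is the
identity. -/
theorem pow_eq_one_of_eq_mul_twist {ζ : kˣ} {l : ℕ} (hζ : ζ ^ l = 1)
    {v : Matrix.SpecialLinearGroup (Fin n) k} {b : Matrix.SpecialLinearGroup (Fin n) (LField k)}
    (h : b = Matrix.SpecialLinearGroup.map HahnSeries.C v *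
      Matrix.SpecialLinearGroup.map (twist ζ) b) : v ^ l = 1 := by
  set τ := Matrix.SpecialLinearGroup.map (n := Fin n) (twist ζ) with hτ
  have hit : ∀ j : ℕ, b = Matrix.SpecialLinearGroup.map HahnSeries.C (v ^ j) * τ^[j] b := by
    intro j
    induction j with
    | zero => simp
    | succ j ih =>
      have h1 := congrArg τ ih
      rw [map_mul, hτ, SL_map_twist_map_C] at h1
      rw [Function.iterate_succ_apply', pow_succ', map_mul, mul_assoc, ← h1]
      exact h
  have h1 : ∀ (j : ℕ) (a c : Fin n), (τ^[j] b).1 a c = (twist ζ)^[j] (b.1 a c) := by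
    intro j a c
    induction j with
    | zero => rfl
    | succ j ih =>
      rw [Function.iterate_succ_apply', Function.iterate_succ_apply', ← ih]
      rfl
  have hτl : τ^[l] b = b := by
    refine Matrix.SpecialLinearGroup.ext _ _ fun a c => ?_
    refine (h1 l a c).trans ?_
    ext i
    rw [twist_iterate_coeff, hζ]
    simp
  have h2 := hit l
  rw [hτl] at h2
  have h3 : Matrix.SpecialLinearGroup.map (HahnSeries.C : k →+* LField k) (v ^ l) =
      Matrix.SpecialLinearGroup.map (HahnSeries.C : k →+* LField k) 1 := by
    rw [map_one]
    exact right_eq_mul.1 h2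
  exact SL_map_injective (HahnSeries.C : k →+* LField k) HahnSeries.C_injective h3

variable [IsAlgClosed k] [CharZero k]

/-- At a common level, multiplying b by a constant in the centralizer gives it the same cocycle
value as b'. The quotient of the two is then invariant under the substitution and descends to a
gauge transformation over K. -/
theorem corresponds_unique (hγ : IsProcyclicGenerator k γ)
    {X : LieAlgebra.SpecialLinear.sl (Fin n) k} (P : JordanForm X.1) {δ : TorsClass X.1}
    {c c' : GaugeClass n k} (h : Corresponds γ X δ c) (h' : Corresponds γ X δ c') : c = c' := by
  obtain ⟨B, d, l, rfl, hd, H⟩ := exists_of_corresponds h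
  obtain ⟨B', d', l', rfl, hd', H'⟩ := exists_of_corresponds h'
  obtain ⟨ζ, hζ, hf⟩ := exists_twist hγ (l * l')
  obtain ⟨b, hb, hbd⟩ := H l' ζ hf
  obtain ⟨b', hb', hbd'⟩ := H' l ζ (by rw [mul_comm l' l]; exact hf)
  rw [mul_comm l' l] at hb'
  obtain ⟨u, hu⟩ := (weylSetoid_iff_conj P d d').1 (Quotient.exact (hd.trans hd'.symm))
  let b₁ := Matrix.SpecialLinearGroup.map HahnSeries.C u.1 * b
  have hb₁ : gauge b₁ (pullback (l * l') B) = pullback (l * l') (constConn X) := by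
    rw [gauge_mul, hb, gauge_map_C]
  have hbd₁ : b₁ = Matrix.SpecialLinearGroup.map HahnSeries.C d'.1.1 *
      Matrix.SpecialLinearGroup.map (twist ζ) b₁ := by
    simp only [b₁]
    rw [map_mul, SL_map_twist_map_C]
    conv_lhs => rw [hbd]
    rw [← mul_assoc, ← mul_assoc, ← map_mul, ← map_mul]
    congr 2
    exact congrArg Subtype.val hu
  have hfix : Matrix.SpecialLinearGroup.map (twist ζ) (b₁⁻¹ * b') = b₁⁻¹ * b' := by
    rw [map_mul, map_inv]
    conv_rhs => rw [hbd₁, hbd']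
    group
  obtain ⟨g, hg⟩ := exists_map_incl_of_twist_eq hζ _ hfix
  symm
  refine gaugeClass_eq_iff.2 ⟨g, pullback_injective (l * l') ?_⟩
  rw [← gauge_pullback (l * l') g rfl, hg, gauge_mul, hb', ← hb₁, ← gauge_mul, inv_mul_cancel,
    gauge_one]

/-- Two trivializations of one class differ by a stabilizer of X dlog z, that is, by a constant u
centralizing X. As u is fixed by the substitution, it conjugates d into d'. -/
theorem corresponds_injective (hγ : IsProcyclicGenerator k γ)
    {X : LieAlgebra.SpecialLinear.sl (Fin n) k} (P : JordanForm X.1) (hX : NoRatEigenvalue X)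
    {δ δ' : TorsClass X.1}
    {c : GaugeClass n k} (h : Corresponds γ X δ c) (h' : Corresponds γ X δ' c) : δ = δ' := by
  obtain ⟨B, d, l, hB, rfl, H⟩ := exists_of_corresponds h
  obtain ⟨B', d', l', hB', rfl, H'⟩ := exists_of_corresponds h'
  obtain ⟨g, rfl⟩ := gaugeClass_eq_iff.1 (hB.trans hB'.symm)
  obtain ⟨ζ, hζ, hf⟩ := exists_twist hγ (l * l')
  obtain ⟨b, hb, hbd⟩ := H l' ζ hf
  obtain ⟨b', hb', hbd'⟩ := H' l ζ (by rw [mul_comm l' l]; exact hf)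
  rw [mul_comm l' l] at hb'
  have htg : Matrix.SpecialLinearGroup.map (twist ζ)
      (Matrix.SpecialLinearGroup.map (incl k (l * l')) g) =
      Matrix.SpecialLinearGroup.map (incl k (l * l')) g :=
    Matrix.SpecialLinearGroup.ext _ _ fun i j => twist_incl (l * l') hζ.pow_eq_one _
  let b₂ := b' * Matrix.SpecialLinearGroup.map (incl k (l * l')) g
  have hb₂ : gauge b₂ (pullback (l * l') B) = pullback (l * l') (constConn X) := by
    rw [gauge_mul, gauge_pullback (l * l') g rfl, hb']
  have hbd₂ : b₂ = Matrix.SpecialLinearGroup.map HahnSeries.C d'.1.1 *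
      Matrix.SpecialLinearGroup.map (twist ζ) b₂ := by
    simp only [b₂]
    rw [map_mul, htg, ← mul_assoc, ← hbd']
  obtain ⟨u, hu⟩ := exists_eq_map_C_of_stabilizer hX (l * l') (b₂ * b⁻¹) (by
    rw [gauge_mul, ← hb, ← gauge_mul b⁻¹, inv_mul_cancel, gauge_one, hb₂, hb])
  have hu' : b₂ = Matrix.SpecialLinearGroup.map HahnSeries.C u.1 * b := by
    rw [← hu, inv_mul_cancel_right]
  refine Quotient.sound ((weylSetoid_iff_conj P d d').2 ⟨u, Subtype.ext ?_⟩)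
  refine SL_map_injective (HahnSeries.C : k →+* LField k) HahnSeries.C_injective ?_
  rw [hu', map_mul, SL_map_twist_map_C] at hbd₂
  conv_lhs at hbd₂ => rw [hbd]
  rw [← mul_assoc, ← mul_assoc, ← map_mul, ← map_mul] at hbd₂
  exact mul_right_cancel hbd₂

/-- Both b and its conjugate τ b carry B to X dlog z, so b (τ b)⁻¹ is a constant centralizing X. It
is torsion, hence conjugate into D_X. -/
theorem exists_corresponds_of_mem_relClasses (hγ : IsProcyclicGenerator k γ)
    {X : LieAlgebra.SpecialLinear.sl (Fin n) k} (P : JordanForm X.1) (hX : NoRatEigenvalue X)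
    {c : GaugeClass n k} (h : c ∈ relClasses (constConn X)) : ∃ δ, Corresponds γ X δ c := by
  obtain ⟨B, hB, rfl⟩ := h
  obtain ⟨l, b, hb⟩ := hB.symm
  obtain ⟨ζ, hζ, hf⟩ := exists_twist hγ l
  have hb' := gauge_twist hζ.pow_eq_one b hb
  set τ := Matrix.SpecialLinearGroup.map (n := Fin n) (twist ζ) with hτ
  obtain ⟨v, hv⟩ := exists_eq_map_C_of_stabilizer hX l (b * (τ b)⁻¹) (by
    rw [gauge_mul, ← hb', ← gauge_mul (τ b)⁻¹, inv_mul_cancel, gauge_one, hb, hb'])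
  have hv' : b = Matrix.SpecialLinearGroup.map HahnSeries.C v.1 * τ b := by
    rw [← hv, inv_mul_cancel_right]
  obtain ⟨d, u, hd⟩ := exists_conj_mem_DTors P v
    ((Submonoid.isOfFinOrder_coe (H := (centSL X.1).toSubmonoid)).1
    (isOfFinOrder_iff_pow_eq_one.2 ⟨l, l.pos, pow_eq_one_of_eq_mul_twist hζ.pow_eq_one hv'⟩))
  refine ⟨Quotient.mk _ d, B, d, l, b, u, rfl, rfl, hb, ?_⟩
  rw [cocycleAt_eq_iff hf, ← hd]
  exact hv'

end Correspondence

end RegSL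

end

noncomputable section

namespace RegSL

open Matrix

/-! ### Triangularity of Jordan matrices -/

section Upper

variable {n : ℕ} {k : Type*} [Field k] {X : Matrix (Fin n) (Fin n) k}

/-- Triangularity keeps exponents nonnegative in the construction of connections of the first kind
and makes the resonance recursion solvable. Equality of the diagonal entries says that the residue
itself is resonant in degree zero. -/
theorem JordanForm.apply_ne_zero (P : JordanForm X) {i j : Fin n} (h : X i j ≠ 0) :
    i ≤ j ∧ X i i = X j j := by
  let e : (Σ i, Fin (P.a i)) ≃ Fin n := finSigmaFinEquiv.trans (finCongr P.sum_eq)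
  have haux : ∀ p q, X (e p) (e q) =
    Matrix.blockDiagonal' (fun i => jordanBlock (P.x i) (P.a i)) p q := P.basis_aux
  obtain ⟨⟨i₁, p⟩, rfl⟩ := e.surjective i
  obtain ⟨⟨i₂, q⟩, rfl⟩ := e.surjective j
  rw [haux] at h
  have hi : i₁ = i₂ := by
    by_contra hne
    exact h (Matrix.blockDiagonal'_apply_ne _ _ _ hne)
  subst hi
  rw [haux, haux]
  simp only [Matrix.blockDiagonal'_apply_eq, jordanBlock, Matrix.of_apply, if_true] at h ⊢
  refine ⟨?_, trivial⟩
  have hpq : (p : ℕ) ≤ q := by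
    by_cases h1 : p = q
    · rw [h1]
    · rw [if_neg h1] at h
      by_cases h2 : (p : ℕ) + 1 = q
      · omega
      · rw [if_neg h2] at h
        exact absurd rfl h
  rw [Fin.le_def]
  change (finSigmaFinEquiv (⟨i₁, p⟩ : Σ i, Fin (P.a i)) : ℕ) ≤
    (finSigmaFinEquiv (⟨i₁, q⟩ : Σ i, Fin (P.a i)) : ℕ)
  rw [finSigmaFinEquiv_apply, finSigmaFinEquiv_apply]
  exact Nat.add_le_add_left hpq _

end Upper

/-! ### Connections of the first kind with prescribed cocycle -/

section Construction

variable {n : ℕ} {k : Type*} [Field k]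

theorem prod_single {ι : Type*} (s : Finset ι) (e : ι → ℤ) :
    ∏ i ∈ s, (HahnSeries.single (e i) (1 : k) : LField k) = HahnSeries.single (∑ i ∈ s, e i) 1 := by
  classical
  induction s using Finset.induction_on with
  | empty => simp
  | insert a s ha ih =>
    rw [Finset.prod_insert ha, Finset.sum_insert ha, ih, HahnSeries.single_mul_single, one_mul]

theorem exists_ofPowerSeries_eq_single (m : ℕ) (c : k) :
    ∃ f : PowerSeries k, (HahnSeries.single (m : ℤ) c : LField k) =
      HahnSeries.ofPowerSeries ℤ k f := by
  refine ⟨PowerSeries.C c * PowerSeries.X ^ m, ?_⟩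
  rw [map_mul, HahnSeries.ofPowerSeries_C, HahnSeries.ofPowerSeries_X_pow, HahnSeries.C_apply,
    HahnSeries.single_mul_single]
  simp

/-- The exponents of the diagonal matrix splitting the cocycle given by a diagonal matrix `D` of
finite order and determinant one. -/
theorem exists_exponents [CharZero k] {N : ℕ+} {ζ : kˣ} (hζ : IsPrimitiveRoot ζ N) (D : Fin n → k)
    (hD : ∀ i, D i ^ (N : ℕ) = 1) (hdet : ∏ i, D i = 1) :
    ∃ e : Fin n → ℤ, ∑ i, e i = 0 ∧ (∀ i, D i * ((ζ ^ e i : kˣ) : k) = 1) ∧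
      ∀ i j, i ≤ j → D i = D j → ∃ m : ℕ, (N : ℤ) * m = e j - e i := by
  have hζ' : IsPrimitiveRoot (ζ : k) N := IsPrimitiveRoot.coe_units_iff.2 hζ
  have : NeZero (N : ℕ) := ⟨N.ne_zero⟩
  have hex : ∀ w : k, ∃ e : ℕ, w ^ (N : ℕ) = 1 → (ζ : k) ^ e = w := by
    intro w
    by_cases hw : w ^ (N : ℕ) = 1
    · obtain ⟨e, -, he⟩ := hζ'.eq_pow_of_pow_eq_one hw
      exact ⟨e, fun _ => he⟩
    · exact ⟨0, fun h => absurd h hw⟩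
  -- E depends only on the value of the entry, so equal entries get equal exponents.
  choose E hE using hex
  have hD0 : ∀ i, D i ≠ 0 := fun i h => by
    have h1 := hD i
    rw [h, zero_pow N.ne_zero] at h1
    exact zero_ne_one h1
  have hE' : ∀ i, (ζ : k) ^ E (D i)⁻¹ = (D i)⁻¹ := fun i =>
    hE _ (by rw [inv_pow, hD, inv_one])
  set S : ℕ := ∑ i, E (D i)⁻¹ with hS
  have hSN : (N : ℕ) ∣ S := by
    rw [← hζ'.pow_eq_one_iff_dvd, hS, ← Finset.prod_pow_eq_pow_sum]
    simp only [hE']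
    rw [Finset.prod_inv_distrib, hdet, inv_one]
  obtain ⟨M, hM⟩ := hSN
  have hζS : ζ ^ S = 1 := by rw [hM, pow_mul, hζ.pow_eq_one, one_pow]
  -- As the entries have product 1, S is a multiple of N, and subtracting it from one exponent
  -- corrects the sum without changing ζ^(e i). The first index is chosen so that e j - e i ≥ 0 for
  -- i ≤ j and D i = D j.
  refine ⟨fun i => (E (D i)⁻¹ : ℤ) - if (i : ℕ) = 0 then (S : ℤ) else 0, ?_, ?_, ?_⟩
  · rw [Finset.sum_sub_distrib, ← Nat.cast_sum, ← hS]
    rcases Nat.eq_zero_or_pos n with h0 | h0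
    · subst h0
      simp [hS]
    · rw [Finset.sum_eq_single (⟨0, h0⟩ : Fin n)]
      · simp
      · intro b _ hb
        rw [if_neg]
        intro hb'
        exact hb (Fin.ext hb')
      · simp
  · intro i
    have h1 : ζ ^ (if (i : ℕ) = 0 then (S : ℤ) else 0) = 1 := by
      split_ifs
      · rw [zpow_natCast, hζS]
      · rw [_root_.zpow_zero]
    rw [_root_.zpow_sub, h1, inv_one, mul_one, zpow_natCast, Units.val_pow_eq_pow_val, hE',
      mul_inv_cancel₀ (hD0 i)]
  · intro i j hij hDij
    beta_reduce
    rw [hDij]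
    by_cases hj : (j : ℕ) = 0
    · have hi : (i : ℕ) = 0 := by
        have := Fin.le_def.1 hij
        omega
      exact ⟨0, by rw [if_pos hi, if_pos hj]; simp⟩
    · by_cases hi : (i : ℕ) = 0
      · refine ⟨M, ?_⟩
        rw [if_pos hi, if_neg hj, hM]
        push_cast
        ring
      · exact ⟨0, by rw [if_neg hi, if_neg hj]; simp⟩

variable [IsAlgClosed k] [CharZero k] {γ : AbsGal k}

/-- Every class of torsion elements of `D_X` corresponds to the class of a connection of the first
kind. -/
theorem exists_isFirstKind_corresponds (hγ : IsProcyclicGenerator k γ)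
    {X : LieAlgebra.SpecialLinear.sl (Fin n) k} (P : JordanForm X.1) (δ : TorsClass X.1) :
    ∃ B : Conn n k, IsFirstKind B ∧ Corresponds γ X δ (gaugeClass B) := by
  obtain ⟨d, rfl⟩ := Quotient.exists_rep δ
  obtain ⟨D, hD⟩ := (mem_diagTorus_iff d.toCent.1).1 d.2.1
  have hD' : (d.1.1 : Matrix (Fin n) (Fin n) k) = Matrix.diagonal D := hD
  obtain ⟨N, hN, hdN⟩ := isOfFinOrder_iff_pow_eq_one.1 d.2.2
  have hDN : ∀ i, D i ^ N = 1 := by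
    intro i
    have h1 := congrArg (fun g : centSL X.1 => (g.1 : Matrix (Fin n) (Fin n) k) i i) hdN
    simpa [hD', Matrix.diagonal_pow] using h1
  have hdet : ∏ i, D i = 1 := by
    rw [← Matrix.det_diagonal, ← hD']
    exact d.1.1.2
  have hDX : ∀ i j, X.1 i j ≠ 0 → D i = D j := by
    intro i j hij
    have h1 : (d.1.1 : Matrix (Fin n) (Fin n) k) * X.1 = X.1 * d.1.1 := d.1.2
    have h2 := congrFun (congrFun h1 i) j
    rw [hD', Matrix.diagonal_mul, Matrix.mul_diagonal, mul_comm] at h2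
    exact mul_left_cancel₀ hij h2
  let l : ℕ+ := ⟨N, hN⟩
  obtain ⟨ζ, hζ, hf⟩ := exists_twist hγ l
  obtain ⟨e, hsum, hDe, hdiv⟩ := exists_exponents (N := l) hζ D hDN hdet
  have hdiv' : ∀ i j, ∃ m : ℕ, X.1 i j ≠ 0 → (l : ℤ) * m = e j - e i := by
    intro i j
    by_cases hij : X.1 i j ≠ 0
    · obtain ⟨m, hm⟩ := hdiv i j (P.apply_ne_zero hij).1 (hDX i j hij)
      exact ⟨m, fun _ => hm⟩
    · exact ⟨0, fun h => absurd h hij⟩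
  choose m hm using hdiv'
  have hl0 : ((l : ℕ) : k) ≠ 0 := by exact_mod_cast l.ne_zero
  have hm0 : ∀ i, X.1 i i ≠ 0 → m i i = 0 := by
    intro i hi
    have h1 := hm i i hi
    rw [sub_self] at h1
    exact_mod_cast (mul_eq_zero.1 h1).resolve_left (pnat_int_ne_zero l)
  -- Obtained from lX by the gauge transformation diag(z^(-e i)): the entry l X_ij acquires the
  -- factor z^(e j - e i) = (z^l)^(m i j), the derivative contributes -e i, and descending from
  -- level l divides by l.
  let A : Matrix (Fin n) (Fin n) (LField k) := Matrix.of fun i j =>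
    HahnSeries.single (m i j : ℤ) (X.1 i j) -
      if i = j then HahnSeries.C ((e i : k) / ((l : ℕ) : k)) else 0
  have hAtr : A.trace = 0 := by
    have hX : X.1.trace = 0 := X.2
    have h1 : ∀ i, A i i = HahnSeries.C (X.1 i i - (e i : k) / ((l : ℕ) : k)) := by
      intro i
      simp only [A, Matrix.of_apply, if_true]
      rw [map_sub]
      congr 1
      by_cases hi : X.1 i i = 0
      · simp [hi]
      · rw [hm0 i hi, HahnSeries.C_apply]
        rfl
    simp only [Matrix.trace, Matrix.diag_apply] at hX ⊢
    simp only [h1]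
    rw [← map_sum, Finset.sum_sub_distrib, hX, ← Finset.sum_div, ← Int.cast_sum, hsum]
    simp
  let B : Conn n k := ⟨A, hAtr⟩
  have hdetb : (Matrix.diagonal fun i => (HahnSeries.single (e i) (1 : k) : LField k)).det = 1 := by
    rw [Matrix.det_diagonal, prod_single, hsum]
    rfl
  let b : Matrix.SpecialLinearGroup (Fin n) (LField k) := ⟨_, hdetb⟩
  refine ⟨B, ?_, B, d, l, b, 1, rfl, rfl, ?_, ?_⟩
  · intro i j
    obtain ⟨f, h1⟩ := exists_ofPowerSeries_eq_single (m i j) (X.1 i j)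
    refine ⟨f - if i = j then PowerSeries.C ((e i : k) / ((l : ℕ) : k)) else 0, ?_⟩
    rw [map_sub, ← h1]
    change HahnSeries.single (m i j : ℤ) (X.1 i j) - _ = _
    congr 1
    split_ifs
    · rw [HahnSeries.ofPowerSeries_C]
    · rw [map_zero]
  · rw [gauge_eq_iff]
    ext1 i j
    have hl1 : ((l : ℕ) : LField k) = HahnSeries.single (0 : ℤ) ((l : ℕ) : k) := by
      rw [← HahnSeries.C_apply, map_natCast]
    change (eulerMat (Matrix.diagonal fun i => (HahnSeries.single (e i) (1 : k) : LField k)) +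
      Matrix.diagonal (fun i => (HahnSeries.single (e i) (1 : k) : LField k)) *
        (pullback l B).1) i j = ((pullback l (constConn X)).1 *
        Matrix.diagonal (fun i => (HahnSeries.single (e i) (1 : k) : LField k))) i j
    rw [Matrix.add_apply, Matrix.diagonal_mul, Matrix.mul_diagonal]
    change euler k (Matrix.diagonal (fun i => (HahnSeries.single (e i) (1 : k) : LField k)) i j) +
      HahnSeries.single (e i) (1 : k) * (((l : ℕ) : LField k) * incl k l (A i j)) =
      ((l : ℕ) : LField k) * incl k l (HahnSeries.C (X.1 i j)) * HahnSeries.single (e j) (1 : k)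
    have hA : A i j = HahnSeries.single (m i j : ℤ) (X.1 i j) -
      if i = j then HahnSeries.C ((e i : k) / ((l : ℕ) : k)) else 0 := rfl
    have hXe : (HahnSeries.single (e i + (l : ℤ) * m i j) (((l : ℕ) : k) * X.1 i j) : LField k) =
        HahnSeries.single (e j) (((l : ℕ) : k) * X.1 i j) := by
      by_cases hij : X.1 i j = 0
      · simp [hij]
      · rw [hm i j hij, add_sub_cancel]
    rw [hA, map_sub, incl_single, incl_C, hl1]
    by_cases hij : i = j
    · subst hij
      rw [if_pos rfl, Matrix.diagonal_apply_eq, euler_single, incl_C, mul_sub, mul_sub]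
      simp only [HahnSeries.C_apply, HahnSeries.single_mul_single, zero_add, add_zero, one_mul,
        mul_one]
      rw [hXe, mul_div_cancel₀ _ hl0]
      ring
    · rw [if_neg hij, Matrix.diagonal_apply_ne _ hij, map_zero, map_zero, sub_zero, zero_add]
      simp only [HahnSeries.C_apply, HahnSeries.single_mul_single, zero_add, one_mul, mul_one]
      exact hXe
  · rw [cocycleAt_eq_iff hf]
    refine Matrix.SpecialLinearGroup.ext _ _ fun i j => ?_
    rw [one_mul, inv_one, mul_one, Matrix.SpecialLinearGroup.coe_mul]
    change Matrix.diagonal (fun i => (HahnSeries.single (e i) (1 : k) : LField k)) i j =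
      ((d.1.1 : Matrix (Fin n) (Fin n) k).map (HahnSeries.C : k →+* LField k) *
      (Matrix.diagonal (fun i => (HahnSeries.single (e i) (1 : k) : LField k))).map (twist ζ)) i j
    rw [hD', Matrix.diagonal_map (map_zero _), Matrix.diagonal_map (map_zero _),
      Matrix.diagonal_mul_diagonal]
    congr 2
    funext i
    rw [twist_single, HahnSeries.C_apply, HahnSeries.single_mul_single, mul_one, zero_add, hDe]

end Construction

end RegSL

end

noncomputable section

namespace RegSL

open Matrix

/-! ### Eigenvalues of X and of ad X -/

section Eigenvalues

variable {n : ℕ} {k : Type*} [Field k]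

/-- `μ` is an eigenvalue of the matrix `X`. -/
def IsEig (X : Matrix (Fin n) (Fin n) k) (μ : k) : Prop := ∃ v, v ≠ 0 ∧ X *ᵥ v = μ • v

theorem IsEig.conj {X Y g : Matrix (Fin n) (Fin n) k} (hg : g.det ≠ 0) (h : g * X = Y * g) {μ : k}
    (hμ : IsEig X μ) : IsEig Y μ := by
  obtain ⟨v, hv, hX⟩ := hμ
  refine ⟨g *ᵥ v, fun h0 => hg ?_, ?_⟩
  · exact Matrix.exists_mulVec_eq_zero_iff.1 ⟨v, hv, h0⟩
  · rw [Matrix.mulVec_mulVec, ← h, ← Matrix.mulVec_mulVec, hX, Matrix.mulVec_smul]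

theorem IsEig.conj_symm {X Y g : Matrix (Fin n) (Fin n) k} (hg : g.det ≠ 0) (h : g * X = Y * g)
    {μ : k} (hμ : IsEig Y μ) : IsEig X μ := by
  have hu : IsUnit g.det := isUnit_iff_ne_zero.2 hg
  refine hμ.conj (g := g⁻¹) ?_ ?_
  · exact (Matrix.isUnit_nonsing_inv_det _ hu).ne_zero
  · calc g⁻¹ * Y = g⁻¹ * (Y * g) * g⁻¹ := by
          rw [Matrix.mul_assoc, Matrix.mul_assoc, Matrix.mul_nonsing_inv _ hu, Matrix.mul_one]
      _ = X * g⁻¹ := by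
          rw [← h, ← Matrix.mul_assoc, Matrix.nonsing_inv_mul _ hu, Matrix.one_mul]

theorem IsEig.add_scalar {X : Matrix (Fin n) (Fin n) k} {c μ : k}
    (h : IsEig (X + c • 1) μ) : IsEig X (μ - c) := by
  obtain ⟨v, hv, hX⟩ := h
  refine ⟨v, hv, ?_⟩
  rw [Matrix.add_mulVec, Matrix.smul_mulVec, Matrix.one_mulVec] at hX
  rw [sub_smul, ← hX, add_sub_cancel_right]

/-- An intertwiner between matrices without common eigenvalues vanishes. -/
theorem exists_common_isEig [IsAlgClosed k] [CharZero k] {Y Z M : Matrix (Fin n) (Fin n) k}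
    (hM : M ≠ 0) (h : Z * M = M * Y) : ∃ μ, IsEig Y μ ∧ IsEig Z μ := by
  obtain ⟨r, a, x, t, b, ha, hb, -⟩ := exists_isJordan_isDiag (f := Matrix.toLin' Y) (c := 1)
    (Commute.one_right _) one_ne_zero (pow_one _)
  by_contra hne
  push Not at hne
  have hY : ∀ i, IsEig Y (x i) := fun i =>
    ⟨b ⟨i, 0, ha i⟩, b.ne_zero _, hb.apply_basis.1 i (ha i)⟩
  have hZ : ∀ (v : Fin n → k) i, Z *ᵥ v = x i • v → v = 0 := by
    intro v i hv
    by_contra hv0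
    exact hne _ (hY i) ⟨v, hv0, hv⟩
  -- M kills every string of the Jordan basis of Y: once M annihilates the preceding vector, the
  -- image of the next one satisfies the eigenvector equation of Z for x i, so it is zero.
  refine hM (Matrix.toLin'.injective (b.ext ?_))
  rintro ⟨i, m, hm⟩
  rw [map_zero, LinearMap.zero_apply]
  induction m with
  | zero =>
    refine hZ _ i ?_
    have h1 := toLin'_comm h (b ⟨i, 0, hm⟩)
    rw [hb.apply_basis.1 i hm, map_smul] at h1
    exact h1
  | succ m ih =>
    refine hZ _ i ?_
    have h1 := toLin'_comm h (b ⟨i, m + 1, hm⟩)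
    rw [hb.apply_basis.2 i m hm, map_add, map_smul, ih, add_zero] at h1
    exact h1

/-- The relation [X, N] = qN says that N intertwines X and X + q, so some μ and μ - q are both
eigenvalues of X. -/
theorem noRatEigenvalue_of_isEig [IsAlgClosed k] [CharZero k]
    {X : LieAlgebra.SpecialLinear.sl (Fin n) k}
    (h : ∀ μ ν (q : ℚ), IsEig X.1 μ → IsEig X.1 ν → μ - ν = q → q = 0) : NoRatEigenvalue X := by
  intro q hq
  obtain ⟨N, hN, hN0⟩ := hq.exists_hasEigenvector
  rw [Module.End.mem_eigenspace_iff] at hN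
  have h1 : X.1 * N.1 - N.1 * X.1 = (q : k) • N.1 := congrArg Subtype.val hN
  have h2 : X.1 * N.1 = N.1 * (X.1 + (q : k) • 1) := by
    rw [Matrix.mul_add, Matrix.mul_smul, Matrix.mul_one, ← h1]
    abel
  obtain ⟨μ, hμ, hμ'⟩ := exists_common_isEig (fun h0 => hN0 (Subtype.ext h0)) h2
  exact h μ (μ - q) q hμ' hμ.add_scalar (by ring)

/-- The test matrix is v wᵀ with v a right eigenvector for μ and w a left eigenvector for ν; ad X
multiplies it by μ - ν. -/
theorem NoRatEigenvalue.eq_zero_of_isEig [CharZero k]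
    {X : LieAlgebra.SpecialLinear.sl (Fin n) k} (hX : NoRatEigenvalue X) {μ ν : k} {q : ℚ}
    (hμ : IsEig X.1 μ) (hν : IsEig X.1 ν) (h : μ - ν = q) : q = 0 := by
  by_contra hq
  obtain ⟨v, hv, hXv⟩ := hμ
  obtain ⟨v', hv', hXv'⟩ := hν
  have hdet : (X.1 - ν • 1).det = 0 := Matrix.exists_mulVec_eq_zero_iff.1
    ⟨v', hv', by rw [Matrix.sub_mulVec, Matrix.smul_mulVec, Matrix.one_mulVec, hXv', sub_self]⟩
  obtain ⟨w, hw, hXw⟩ := Matrix.exists_vecMul_eq_zero_iff.2 hdet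
  rw [Matrix.vecMul_sub, Matrix.vecMul_smul, Matrix.vecMul_one, sub_eq_zero] at hXw
  have hM := hX.eq_zero (M := Matrix.vecMulVec v w) hq (by
    rw [Matrix.mul_vecMulVec, Matrix.vecMulVec_mul, hXv, hXw, ← h, sub_smul,
      Matrix.smul_vecMulVec, Matrix.vecMulVec_smul])
  obtain ⟨i, hi⟩ := Function.ne_iff.1 hv
  obtain ⟨j, hj⟩ := Function.ne_iff.1 hw
  exact mul_ne_zero hi hj (congrFun (congrFun hM i) j)

end Eigenvalues

end RegSL

end

noncomputable section

namespace RegSL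

open Matrix

/-! ### Matrices of power series -/

section PowerSeriesMatrices

variable {n : ℕ} {k : Type*} [Field k]

/-- The matrix of power series with given coefficient matrices. -/
def psMat (a : ℕ → Matrix (Fin n) (Fin n) k) : Matrix (Fin n) (Fin n) (PowerSeries k) :=
  Matrix.of fun i j => PowerSeries.mk fun r => a r i j

theorem psMat_add (a b : ℕ → Matrix (Fin n) (Fin n) k) :
    psMat (fun r => a r + b r) = psMat a + psMat b := by
  ext i j r
  simp [psMat]

theorem psMat_mul (a b : ℕ → Matrix (Fin n) (Fin n) k) :
    psMat a * psMat b = psMat fun r => ∑ p ∈ Finset.HasAntidiagonal.antidiagonal r, a p.1 * b p.2 := by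
  ext i j r
  simp only [psMat, Matrix.mul_apply, Matrix.of_apply, map_sum, PowerSeries.coeff_mul,
    PowerSeries.coeff_mk, Matrix.sum_apply]
  exact Finset.sum_comm

theorem psMat_det_ne_zero {a : ℕ → Matrix (Fin n) (Fin n) k} (h : (a 0).det ≠ 0) :
    (psMat a).det ≠ 0 := by
  intro h0
  refine h ?_
  have h1 := (PowerSeries.constantCoeff (R := k)).map_det (psMat a)
  rw [h0, map_zero] at h1
  rw [h1]
  refine congrArg Matrix.det ?_
  ext i j
  simp [psMat]

theorem eulerMat_psMat (a : ℕ → Matrix (Fin n) (Fin n) k) :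
    eulerMat ((psMat a).map (HahnSeries.ofPowerSeries ℤ k)) =
      (psMat fun r => (r : k) • a r).map (HahnSeries.ofPowerSeries ℤ k) := by
  ext i j r
  simp only [eulerMat, Matrix.map_apply, euler_coeff, psMat, Matrix.of_apply, Matrix.smul_apply]
  rw [PowerSeries.coeff_coe, PowerSeries.coeff_coe]
  split_ifs with hr
  · rw [mul_zero]
  · rw [PowerSeries.coeff_mk, PowerSeries.coeff_mk, smul_eq_mul]
    congr 1
    lift r to ℕ using not_lt.1 hr
    simp

theorem psMat_coeffMat {A : Matrix (Fin n) (Fin n) (LField k)} (h : ∀ i < 0, coeffMat A i = 0) :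
    (psMat fun r => coeffMat A (r : ℤ)).map (HahnSeries.ofPowerSeries ℤ k) = A := by
  ext i j r
  simp only [Matrix.map_apply, psMat, Matrix.of_apply]
  rw [PowerSeries.coeff_coe]
  split_ifs with hr
  · exact (congrFun (congrFun (h r hr) i) j).symm
  · rw [PowerSeries.coeff_mk]
    lift r to ℕ using not_lt.1 hr
    rfl

end PowerSeriesMatrices

/-! ### Formal reduction to resonant terms -/

section Recursion

/-- Course-of-values recursion for a relation: P sees only values already constructed, the others
being masked by `default`. -/
theorem exists_seq_of_forall_exists {α : Type*} [Inhabited α] (P : ℕ → (ℕ → α) → α → Prop)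
    (h : ∀ r G, ∃ a, P r G a) :
    ∃ F : ℕ → α, ∀ r, P r (fun m => if m < r then F m else default) (F r) := by
  choose g hg using h
  let F : ℕ → α := wellFounded_lt.fix fun r ih =>
    g r fun m => if hm : m < r then ih m hm else default
  refine ⟨F, fun r => ?_⟩
  have h1 : F r = g r fun m => if m < r then F m else default := by
    refine (WellFounded.fix_eq _ _ _).trans ?_
    congr 1
  exact h1 ▸ hg r _

variable {n : ℕ} {k : Type*} [Field k]

/-- Solution of `[A, H] - r H + R = C` with `C` concentrated on the resonant entries. -/
theorem exists_resonant {A : Matrix (Fin n) (Fin n) k} (hA : ∀ i j, A i j ≠ 0 → i ≤ j) (r : k)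
    (R : Matrix (Fin n) (Fin n) k) :
    ∃ H C, A * H - H * A - r • H + R = C ∧ ∀ i j, C i j ≠ 0 → A i i - A j j = r := by
  let L : Matrix (Fin n) (Fin n) k →ₗ[k] Matrix (Fin n) (Fin n) k :=
    LinearMap.mulLeft k A - LinearMap.mulRight k A - r • LinearMap.id
  let V : Submodule k (Matrix (Fin n) (Fin n) k) :=
    { carrier := {C | ∀ i j, C i j ≠ 0 → A i i - A j j = r}
      add_mem' := by
        intro C D hC hD i j hij
        by_cases h : C i j = 0
        · refine hD i j fun h' => hij ?_
          rw [Matrix.add_apply, h, h', add_zero]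
        · exact hC i j h
      zero_mem' := fun i j h => absurd rfl h
      smul_mem' := fun c C hC i j hij => hC i j fun h => hij (by
        rw [Matrix.smul_apply, h, smul_zero]) }
  -- Induction on the weight i + (n - j). As A is upper triangular, L maps the matrix unit E_ij to
  -- (A_ii - A_jj - r) E_ij plus terms of smaller weight, so a nonresonant E_ij is reached by
  -- induction; a resonant one lies in V.
  have key : ∀ (N : ℕ) (i j : Fin n), (i : ℕ) + (n - j) ≤ N →
      Matrix.single i j (1 : k) ∈ LinearMap.range L ⊔ V := by
    intro N
    induction N with
    | zero =>
      intro i j h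
      have := j.2
      omega
    | succ N ih =>
      intro i j h
      by_cases hr : A i i - A j j = r
      · refine Submodule.mem_sup_right fun i' j' h' => ?_
        obtain ⟨rfl, rfl⟩ : i = i' ∧ j = j' := by
          by_contra hne
          exact h' (Matrix.single_apply_of_ne _ _ _ _ _ hne)
        exact hr
      · have h1 : L (Matrix.single i j 1) ∈ LinearMap.range L ⊔ V :=
          Submodule.mem_sup_left ⟨_, rfl⟩
        have hAE : A * Matrix.single i j 1 = ∑ i', A i' i • Matrix.single i' j (1 : k) := by
          ext p q
          rw [Matrix.sum_apply]
          simp only [Matrix.smul_apply, Matrix.single_apply, Matrix.mul_apply, smul_eq_mul]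
          by_cases hq : j = q <;> simp [hq]
        have hEA : Matrix.single i j 1 * A = ∑ j', A j j' • Matrix.single i j' (1 : k) := by
          ext p q
          rw [Matrix.sum_apply]
          simp only [Matrix.smul_apply, Matrix.single_apply, Matrix.mul_apply, smul_eq_mul]
          by_cases hq : i = p <;> simp [hq]
        have h2 : (A i i - A j j - r) • Matrix.single i j (1 : k) =
            L (Matrix.single i j 1) - ∑ i' ∈ Finset.univ.erase i, A i' i • Matrix.single i' j 1 +
              ∑ j' ∈ Finset.univ.erase j, A j j' • Matrix.single i j' 1 := by
          change _ = A * Matrix.single i j 1 - Matrix.single i j 1 * A - r • Matrix.single i j 1 -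
            _ + _
          rw [hAE, hEA, ← Finset.add_sum_erase _ _ (Finset.mem_univ i),
            ← Finset.add_sum_erase _ (fun j' => A j j' • Matrix.single i j' (1 : k))
              (Finset.mem_univ j), sub_smul, sub_smul]
          abel
        have h3 : (A i i - A j j - r) • Matrix.single i j (1 : k) ∈ LinearMap.range L ⊔ V := by
          rw [h2]
          refine add_mem (sub_mem h1 (sum_mem fun i' hi' => ?_)) (sum_mem fun j' hj' => ?_)
          · by_cases h0 : A i' i = 0
            · rw [h0, zero_smul]
              exact zero_mem _
            · have h4 := hA _ _ h0
              have h5 : i' ≠ i := Finset.ne_of_mem_erase hi'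
              refine Submodule.smul_mem _ _ (ih _ _ ?_)
              have := lt_of_le_of_ne h4 h5
              rw [Fin.lt_def] at this
              omega
          · by_cases h0 : A j j' = 0
            · rw [h0, zero_smul]
              exact zero_mem _
            · have h4 := hA _ _ h0
              have h5 : j' ≠ j := Finset.ne_of_mem_erase hj'
              refine Submodule.smul_mem _ _ (ih _ _ ?_)
              have := lt_of_le_of_ne h4 h5.symm
              rw [Fin.lt_def] at this
              have := j'.2
              omega
        exact (Submodule.smul_mem_iff _ (sub_ne_zero.2 hr)).1 h3
  have hR : -R ∈ LinearMap.range L ⊔ V := by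
    refine neg_mem ?_
    rw [Matrix.matrix_eq_sum_single R]
    refine sum_mem fun i _ => sum_mem fun j _ => ?_
    have h1 : Matrix.single i j (R i j) = R i j • Matrix.single i j (1 : k) := by
      rw [Matrix.smul_single, smul_eq_mul, mul_one]
    rw [h1]
    exact Submodule.smul_mem _ _ (key _ i j le_rfl)
  obtain ⟨_, ⟨H, rfl⟩, C, hC, h⟩ := Submodule.mem_sup.1 hR
  refine ⟨H, -C, ?_, fun i j hij => hC i j fun h0 => hij (by rw [Matrix.neg_apply, h0, neg_zero])⟩
  change L H + R = -C
  rw [eq_neg_iff_add_eq_zero, add_right_comm, h, neg_add_cancel]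

/-- The formal reduction of `A` to a resonant series `C`. -/
theorem exists_reduction (A : ℕ → Matrix (Fin n) (Fin n) k) (hA : ∀ i j, A 0 i j ≠ 0 →
    i ≤ j ∧ A 0 i i = A 0 j j) :
    ∃ H C : ℕ → Matrix (Fin n) (Fin n) k, H 0 = 1 ∧ C 0 = A 0 ∧
      (∀ r i j, C r i j ≠ 0 → A 0 i i - A 0 j j = (r : k)) ∧
      psMat A * psMat H = psMat (fun r => (r : k) • H r) + psMat H * psMat C := by
  -- The coefficient of z^(r+1) in AH = z∂_z H + HC with H_0 = 1 and C_0 = A_0. The unknowns H_(r+1)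
  -- and C_(r+1) are isolated; both sums involve only earlier ones.
  let P : ℕ → (ℕ → Matrix (Fin n) (Fin n) k × Matrix (Fin n) (Fin n) k) →
      Matrix (Fin n) (Fin n) k × Matrix (Fin n) (Fin n) k → Prop := fun r G a =>
    match r with
    | 0 => a = (1, A 0)
    | r + 1 => A 0 * a.1 - a.1 * A 0 - ((r + 1 : ℕ) : k) • a.1 +
        (∑ p ∈ Finset.range (r + 1), A (p + 1) * (G (r - p)).1 -
          ∑ p ∈ Finset.range r, (G (p + 1)).1 * (G (r - p)).2) = a.2 ∧
        ∀ i j, a.2 i j ≠ 0 → A 0 i i - A 0 j j = ((r + 1 : ℕ) : k)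
  have : Inhabited (Matrix (Fin n) (Fin n) k × Matrix (Fin n) (Fin n) k) := ⟨0⟩
  obtain ⟨F, hF⟩ := exists_seq_of_forall_exists P (by
    rintro (_ | r) G
    · exact ⟨_, rfl⟩
    · obtain ⟨H, C, h1, h2⟩ := exists_resonant (fun i j h => (hA i j h).1) ((r + 1 : ℕ) : k)
        (∑ p ∈ Finset.range (r + 1), A (p + 1) * (G (r - p)).1 -
          ∑ p ∈ Finset.range r, (G (p + 1)).1 * (G (r - p)).2)
      exact ⟨(H, C), h1, h2⟩)
  have h0 : F 0 = (1, A 0) := hF 0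
  refine ⟨fun r => (F r).1, fun r => (F r).2, congrArg Prod.fst h0, congrArg Prod.snd h0, ?_, ?_⟩
  · rintro (_ | r) i j hij
    · beta_reduce at hij
      rw [h0] at hij
      rw [(hA i j hij).2, sub_self, Nat.cast_zero]
    · exact (hF (r + 1)).2 i j hij
  · rw [psMat_mul, psMat_mul, ← psMat_add]
    congr 1
    funext r
    rw [Finset.Nat.sum_antidiagonal_eq_sum_range_succ_mk,
      Finset.Nat.sum_antidiagonal_eq_sum_range_succ_mk]
    cases r with
    | zero => simp [h0]
    | succ r =>
      have h1 := (hF (r + 1)).1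
      have h2 : ∑ p ∈ Finset.range (r + 1), A (p + 1) *
          ((if r - p < r + 1 then F (r - p) else default) :
            Matrix (Fin n) (Fin n) k × Matrix (Fin n) (Fin n) k).1 =
          ∑ p ∈ Finset.range (r + 1), A (p + 1) * (F (r - p)).1 :=
        Finset.sum_congr rfl fun p _ => by rw [if_pos (by omega)]
      have h3 : ∑ p ∈ Finset.range r,
          ((if p + 1 < r + 1 then F (p + 1) else default) :
            Matrix (Fin n) (Fin n) k × Matrix (Fin n) (Fin n) k).1 *
          ((if r - p < r + 1 then F (r - p) else default) :
            Matrix (Fin n) (Fin n) k × Matrix (Fin n) (Fin n) k).2 =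
          ∑ p ∈ Finset.range r, (F (p + 1)).1 * (F (r - p)).2 :=
        Finset.sum_congr rfl fun p hp => by
          have := Finset.mem_range.1 hp
          rw [if_pos (by omega), if_pos (by omega)]
      rw [h2, h3] at h1
      rw [Finset.sum_range_succ', Finset.sum_range_succ _ (r + 1),
        Finset.sum_range_succ' (fun p => (F p).1 * (F (r + 1 - p)).2) r]
      simp only [Nat.add_sub_add_right, Nat.sub_zero, Nat.sub_self, h0, Matrix.one_mul]
      rw [← h1]
      abel

end Recursion

end RegSL

end

noncomputable section

namespace RegSL

open Matrix

/-! ### Reduction of regular connections to constant ones -/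

section Levelt

variable {n : ℕ} {k : Type*} [Field k]

/-- C is triangular for the order by f and then by decreasing index. In the row of the first index
in the support of an eigenvector, all off-diagonal contributions vanish. -/
theorem isEig_of_triangular {C : Matrix (Fin n) (Fin n) k} (f : Fin n → ℤ)
    (hC : ∀ i j, i ≠ j → C i j ≠ 0 → f j < f i ∨ f j = f i ∧ i < j) {μ : k} (h : IsEig C μ) :
    ∃ i, μ = C i i := by
  classical
  obtain ⟨v, hv, hCv⟩ := h
  obtain ⟨i₀, hi₀⟩ := Function.ne_iff.1 hv
  obtain ⟨i, hi, hmin⟩ := Finset.exists_min_image ({i | v i ≠ 0} : Finset (Fin n))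
    (fun i => toLex (f i, -(i : ℤ))) ⟨i₀, by simpa using hi₀⟩
  have hvi : v i ≠ 0 := by simpa using hi
  refine ⟨i, ?_⟩
  have h1 := congrFun hCv i
  rw [Matrix.mulVec, dotProduct, Finset.sum_eq_single i] at h1
  · exact (mul_right_cancel₀ hvi h1).symm
  · intro j _ hj
    by_contra h0
    have hvj : v j ≠ 0 := right_ne_zero_of_mul h0
    have h2 := hmin j (by simpa using hvj)
    rw [Prod.Lex.toLex_le_toLex] at h2
    have h3 := hC i j hj.symm (left_ne_zero_of_mul h0)
    simp only [Fin.lt_def] at h3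
    omega
  · intro h0
    exact absurd (Finset.mem_univ i) h0

theorem coeffMat_pullback (m : ℕ+) (A : Conn n k) (i : ℤ) :
    coeffMat (pullback m A).1 ((m : ℕ) * i) = ((m : ℕ) : k) • coeffMat A.1 i := by
  ext1 a b
  change (((m : ℕ) : LField k) * incl k m (A.1 a b)).coeff ((m : ℕ) * i) =
    ((m : ℕ) : k) * (A.1 a b).coeff i
  rw [← map_natCast (HahnSeries.C : k →+* LField k), HahnSeries.C_apply,
    HahnSeries.coeff_single_zero_mul, incl_coeff_mul]

theorem coeffMat_pullback_of_not_dvd (m : ℕ+) (A : Conn n k) {i : ℤ} (h : ¬ ((m : ℕ) : ℤ) ∣ i) :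
    coeffMat (pullback m A).1 i = 0 := by
  ext1 a b
  change (((m : ℕ) : LField k) * incl k m (A.1 a b)).coeff i = 0
  rw [← map_natCast (HahnSeries.C : k →+* LField k), HahnSeries.C_apply,
    HahnSeries.coeff_single_zero_mul, incl_coeff_of_not_dvd m _ h, mul_zero]

theorem IsFirstKind.coeffMat_eq_zero {A : Conn n k} (hA : IsFirstKind A) {i : ℤ} (hi : i < 0) :
    coeffMat A.1 i = 0 := by
  ext1 a b
  obtain ⟨f, hf⟩ := hA a b
  change (A.1 a b).coeff i = 0
  rw [hf, PowerSeries.coeff_coe, if_pos hi]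

theorem eulerMat_diagonal_single (f : Fin n → ℤ) :
    eulerMat (Matrix.diagonal fun i => (HahnSeries.single (f i) (1 : k) : LField k)) =
      (Matrix.diagonal fun i => (HahnSeries.single (f i) (1 : k) : LField k)) *
        (Matrix.diagonal fun i => (f i : k)).map (HahnSeries.C : k →+* LField k) := by
  rw [Matrix.diagonal_map (map_zero _), Matrix.diagonal_mul_diagonal, eulerMat,
    Matrix.diagonal_map (map_zero _)]
  congr 1
  funext i
  rw [euler_single, HahnSeries.C_apply, HahnSeries.single_mul_single,
    add_zero, one_mul, mul_one]

/-- A ℚ-linear retraction of k onto ℚ gives every eigenvalue a rational part. It determines the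
integer shifts and later shows that no nonzero rational difference of eigenvalues survives. -/
theorem exists_ratLinear [CharZero k] : ∃ ρ : k →ₗ[ℚ] ℚ, ρ 1 = 1 := by
  obtain ⟨ρ, hρ⟩ := LinearMap.exists_leftInverse_of_injective (Algebra.linearMap ℚ k)
    (LinearMap.ker_eq_bot.2 (algebraMap ℚ k).injective)
  refine ⟨ρ, ?_⟩
  have h := LinearMap.congr_fun hρ 1
  simpa using h

theorem exists_common_den {ι : Type*} [Fintype ι] (q : ι → ℚ) :
    ∃ (m : ℕ+) (f : ι → ℤ), ∀ i, (f i : ℚ) = (m : ℕ) * q i := by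
  classical
  refine ⟨⟨∏ i, (q i).den, Finset.prod_pos fun i _ => (q i).pos⟩,
    fun i => (q i).num * ∏ j ∈ Finset.univ.erase i, (q j).den, fun i => ?_⟩
  have h1 : ((q i).den : ℚ) * q i = (q i).num := by rw [mul_comm, Rat.mul_den_eq_num]
  rw [PNat.mk_coe, ← Finset.mul_prod_erase _ _ (Finset.mem_univ i)]
  push_cast
  rw [← h1]
  ring

variable [IsAlgClosed k] [CharZero k]

/-- A connection of the first kind whose residue is in upper triangular Jordan form is gauge
equivalent to a constant one, if the resonances are shifted by integers. -/
theorem exists_gaugeEquiv_constConn (B : Conn n k) (hB : ∀ i < 0, coeffMat B.1 i = 0)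
    (hB0 : ∀ i j, coeffMat B.1 0 i j ≠ 0 → i ≤ j ∧ coeffMat B.1 0 i i = coeffMat B.1 0 j j)
    (f : Fin n → ℤ)
    (hf : ∀ (i j) (r : ℤ), coeffMat B.1 0 i i - coeffMat B.1 0 j j = (r : k) → f i - f j = r)
    (hsum : ∑ i, f i = 0) :
    ∃ C : LieAlgebra.SpecialLinear.sl (Fin n) k, GaugeEquiv (constConn C) B ∧
      ∀ μ, IsEig C.1 μ → ∃ i, μ = coeffMat B.1 0 i i - f i := by
  obtain ⟨H, C, hH0, hC0, hC, hHC⟩ := exists_reduction (fun r => coeffMat B.1 (r : ℤ)) hB0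
  replace hC : ∀ (r : ℕ) i j, C r i j ≠ 0 → f i - f j = r := fun r i j hij =>
    hf i j r (by rw [Int.cast_natCast]; exact hC r i j hij)
  have hC0' : C 0 = coeffMat B.1 0 := hC0
  -- The entry (i, j) of the series C occurs only in degree f i - f j, so C is the conjugate of E by
  -- diag(z^(f i)). If f i - f j < 0, `toNat` selects degree 0, where this entry vanishes.
  let E : Matrix (Fin n) (Fin n) k := Matrix.of fun i j => C (f i - f j).toNat i j
  have hEdiag : ∀ i, E i i = coeffMat B.1 0 i i := by
    intro i
    change C (f i - f i).toNat i i = _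
    rw [sub_self, Int.toNat_zero, hC0']
  let C' : Matrix (Fin n) (Fin n) k := E - Matrix.diagonal fun i => (f i : k)
  have htr : C'.trace = 0 := by
    have h1 : B.1.trace = 0 := B.2
    have h2 : (coeffMat B.1 0).trace = 0 := by
      have h3 := congrArg (fun f : LField k => f.coeff 0) h1
      simpa [Matrix.trace, coeffMat, HahnSeries.coeff_sum] using h3
    have h4 : E.trace = 0 := by
      rw [← h2]
      exact Finset.sum_congr rfl fun i _ => hEdiag i
    rw [Matrix.trace_sub, h4, Matrix.trace_diagonal, ← Int.cast_sum, hsum, Int.cast_zero, sub_zero]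
  refine ⟨⟨C', htr⟩, ?_, ?_⟩
  · let Z : Matrix (Fin n) (Fin n) (LField k) :=
      Matrix.diagonal fun i => HahnSeries.single (f i) (1 : k)
    let Hs := (psMat H).map (HahnSeries.ofPowerSeries ℤ k)
    let Cs := (psMat C).map (HahnSeries.ofPowerSeries ℤ k)
    have hCZ : Cs * Z = Z * E.map (HahnSeries.C : k →+* LField k) := by
      ext1 i j
      rw [Matrix.mul_diagonal, Matrix.diagonal_mul, Matrix.map_apply, HahnSeries.C_apply,
        HahnSeries.single_mul_single, add_zero, one_mul]
      ext r
      obtain ⟨r, rfl⟩ : ∃ s, r = s + f j := ⟨r - f j, by ring⟩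
      rw [HahnSeries.coeff_mul_single_add, mul_one]
      change ((HahnSeries.ofPowerSeries ℤ k) (PowerSeries.mk fun r => C r i j)).coeff r = _
      rw [PowerSeries.coeff_coe, PowerSeries.coeff_mk]
      change _ = (HahnSeries.single (f i) (C (f i - f j).toNat i j)).coeff (r + f j)
      by_cases hr : r = f i - f j
      · subst hr
        rw [sub_add_cancel, HahnSeries.coeff_single_same]
        split_ifs with h0
        · by_contra h1
          have := hC _ i j (Ne.symm h1)
          omega
        · congr 1
          omega
      · rw [HahnSeries.coeff_single_of_ne (by omega)]
        split_ifs with h0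
        · rfl
        · by_contra h1
          have := hC _ i j h1
          omega
    have hZ : eulerMat Z = Z * (Matrix.diagonal fun i => (f i : k)).map
        (HahnSeries.C : k →+* LField k) := eulerMat_diagonal_single f
    have hHs : B.1 * Hs = eulerMat Hs + Hs * Cs := by
      rw [eulerMat_psMat, ← Matrix.map_mul, ← Matrix.map_add _ (map_add _), ← hHC, Matrix.map_mul,
        psMat_coeffMat hB]
    -- The shearing Z carries the constant E - diag(f) to C, and Hs carries C to B.
    refine gaugeEquiv_of_intertwine (Hs * Z) ?_ ?_
    · rw [Matrix.det_mul, Matrix.det_diagonal, prod_single, hsum]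
      refine mul_ne_zero ?_ (HahnSeries.single_ne_zero one_ne_zero)
      have h1 : (psMat H).det ≠ 0 := psMat_det_ne_zero (by rw [hH0, Matrix.det_one]; exact one_ne_zero)
      intro h2
      refine h1 (HahnSeries.ofPowerSeries_injective (Γ := ℤ) (R := k) ?_)
      rw [map_zero, RingHom.map_det]
      exact h2
    · change eulerMat (Hs * Z) + Hs * Z * C'.map (HahnSeries.C : k →+* LField k) = B.1 * (Hs * Z)
      rw [Matrix.map_sub _ (map_sub _), eulerMat_mul, hZ, ← Matrix.mul_assoc B.1, hHs,
        Matrix.add_mul, Matrix.mul_assoc Hs Cs, hCZ, Matrix.mul_sub, Matrix.mul_assoc,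
        Matrix.mul_assoc]
      abel
  · intro μ hμ
    have hlex : ∀ i j, i ≠ j → C' i j ≠ 0 → f j < f i ∨ f j = f i ∧ i < j := by
      intro i j hij h
      replace h : C (f i - f j).toNat i j - Matrix.diagonal (fun i => (f i : k)) i j ≠ 0 := h
      rw [Matrix.diagonal_apply_ne _ hij, sub_zero] at h
      have h1 := hC _ i j h
      by_cases h2 : f j = f i
      · rw [h2, sub_self, Int.toNat_zero, hC0'] at h
        exact Or.inr ⟨h2, lt_of_le_of_ne (hB0 i j h).1 hij⟩
      · left
        omega
    obtain ⟨i, hi⟩ := isEig_of_triangular f hlex hμ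
    refine ⟨i, ?_⟩
    rw [hi, ← hEdiag]
    change E i i - Matrix.diagonal (fun i => (f i : k)) i i = _
    rw [Matrix.diagonal_apply_eq]

theorem constConn_gaugeEquiv {X Y : LieAlgebra.SpecialLinear.sl (Fin n) k}
    (g : Matrix (Fin n) (Fin n) k) (hg : g.det ≠ 0) (h : g * X.1 = Y.1 * g) :
    GaugeEquiv (constConn X) (constConn Y) := by
  refine gaugeEquiv_of_intertwine (g.map (HahnSeries.C : k →+* LField k)) ?_ ?_
  · rw [map_C_det]
    exact fun h0 => hg ((HahnSeries.C : k →+* LField k).injective (by rw [h0, map_zero]))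
  · change _ + _ * X.1.map _ = Y.1.map _ * _
    rw [eulerMat_map_C, zero_add, ← Matrix.map_mul, h, Matrix.map_mul]

/-- Every regular connection is related to `X dlog z` for some Jordan matrix `X` such that `ad X`
has no rational eigenvalue other than zero. -/
theorem IsRegular.exists_related {A : Conn n k} (hA : IsRegular A) :
    ∃ X : LieAlgebra.SpecialLinear.sl (Fin n) k, Nonempty (JordanForm X.1) ∧ NoRatEigenvalue X ∧
      Related A (constConn X) := by
  obtain ⟨B, hB, hAB⟩ := hA
  obtain ⟨J, PJ, g, hg⟩ := exists_jordanForm (coeffMat B.1 0)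
  let B' := gauge (Matrix.SpecialLinearGroup.map (HahnSeries.C : k →+* LField k) g) B
  have hB' : (g : Matrix (Fin n) (Fin n) k).map (HahnSeries.C : k →+* LField k) * B.1 =
      B'.1 * (g : Matrix (Fin n) (Fin n) k).map (HahnSeries.C : k →+* LField k) := by
    have h1 := (gauge_eq_iff _).1 (rfl : _ = B')
    change eulerMat ((g : Matrix (Fin n) (Fin n) k).map (HahnSeries.C : k →+* LField k)) + _ = _ at h1
    rw [eulerMat_map_C, zero_add] at h1
    exact h1
  have hcoeff : ∀ i, coeffMat B'.1 i = g * coeffMat B.1 i * (g⁻¹ : Matrix.SpecialLinearGroup (Fin n) k) := by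
    intro i
    have h1 := congrArg (fun M => coeffMat M i) hB'
    beta_reduce at h1
    rw [coeffMat_C_mul, coeffMat_mul_C] at h1
    rw [h1, Matrix.mul_assoc, SL_mul_inv, Matrix.mul_one]
  have hJ : coeffMat B'.1 0 = J := by
    rw [hcoeff, hg, Matrix.mul_assoc, SL_mul_inv, Matrix.mul_one]
  have hneg : ∀ i < 0, coeffMat B'.1 i = 0 := by
    intro i hi
    rw [hcoeff, hB.coeffMat_eq_zero hi, Matrix.mul_zero, Matrix.zero_mul]
  have hJtr : J.trace = 0 := by
    have h1 : B'.1.trace = 0 := B'.2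
    have h3 := congrArg (fun f : LField k => f.coeff 0) h1
    rw [← hJ]
    simpa [Matrix.trace, coeffMat, HahnSeries.coeff_sum] using h3
  obtain ⟨ρ, hρ⟩ := exists_ratLinear (k := k)
  have hρq : ∀ q : ℚ, ρ (q : k) = q := by
    intro q
    have h1 : (q : k) = q • (1 : k) := by rw [Rat.smul_def, mul_one]
    rw [h1, map_smul, hρ, smul_eq_mul, mul_one]
  -- After pulling back by m, the residue eigenvalues have the integers f i as rational parts;
  -- shearing by f leaves eigenvalues with rational part zero.
  obtain ⟨m, f, hf⟩ := exists_common_den fun i => ρ (J i i)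
  have hm : ((m : ℕ) : k) ≠ 0 := by exact_mod_cast m.ne_zero
  have hmρ : ∀ x : k, ρ (((m : ℕ) : k) * x) = (m : ℕ) * ρ x := by
    intro x
    rw [← nsmul_eq_mul, map_nsmul, nsmul_eq_mul]
  have hcoeff0 : coeffMat (pullback m B').1 0 = ((m : ℕ) : k) • J := by
    rw [← hJ, ← coeffMat_pullback, mul_zero]
  have hpneg : ∀ i < 0, coeffMat (pullback m B').1 i = 0 := by
    intro i hi
    by_cases hd : ((m : ℕ) : ℤ) ∣ i
    · obtain ⟨j, rfl⟩ := hd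
      have hm0 : (0 : ℤ) < (m : ℕ) := by exact_mod_cast m.pos
      rw [coeffMat_pullback, hneg j (by nlinarith), smul_zero]
    · exact coeffMat_pullback_of_not_dvd m _ hd
  have hupper : ∀ i j, coeffMat (pullback m B').1 0 i j ≠ 0 → i ≤ j ∧
      coeffMat (pullback m B').1 0 i i = coeffMat (pullback m B').1 0 j j := by
    intro i j hij
    rw [hcoeff0] at hij ⊢
    have h1 := PJ.apply_ne_zero (right_ne_zero_of_mul hij)
    refine ⟨h1.1, ?_⟩
    rw [Matrix.smul_apply, Matrix.smul_apply, h1.2]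
  have hres : ∀ (i j) (r : ℤ), coeffMat (pullback m B').1 0 i i -
      coeffMat (pullback m B').1 0 j j = (r : k) → f i - f j = r := by
    intro i j r hr
    rw [hcoeff0, Matrix.smul_apply, Matrix.smul_apply, smul_eq_mul, smul_eq_mul, ← mul_sub] at hr
    have h1 := congrArg ρ hr
    have h3 : ρ (r : k) = r := by
      have := hρq r
      rwa [Rat.cast_intCast] at this
    rw [hmρ, map_sub, h3, mul_sub, ← hf, ← hf] at h1
    exact_mod_cast h1
  have hfsum : ∑ i, f i = 0 := by
    have h1 : ((∑ i, f i : ℤ) : ℚ) = 0 := by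
      push_cast
      simp only [hf]
      rw [← Finset.mul_sum, ← map_sum]
      have h2 : ∑ i, J i i = 0 := hJtr
      rw [h2, map_zero, mul_zero]
    exact_mod_cast h1
  obtain ⟨C, hC, hCeig⟩ := exists_gaugeEquiv_constConn _ hpneg hupper f hres hfsum
  -- Dividing by m compensates the factor m in the pull-back of a constant connection.
  obtain ⟨X, PX, g', hg'⟩ := exists_jordanForm (((m : ℕ) : k)⁻¹ • C.1)
  have hX : X = g' * (((m : ℕ) : k)⁻¹ • C.1) * (g'⁻¹ : Matrix.SpecialLinearGroup (Fin n) k) := by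
    rw [hg', Matrix.mul_assoc, SL_mul_inv, Matrix.mul_one]
  have hXtr : X.trace = 0 := by
    have h1 : C.1.trace = 0 := C.2
    rw [hX, Matrix.trace_mul_comm, ← Matrix.mul_assoc, SL_inv_mul, Matrix.one_mul,
      Matrix.trace_smul, h1, smul_zero]
  have hgC : (g' : Matrix (Fin n) (Fin n) k) * C.1 = (((m : ℕ) : k) • X) * g' := by
    rw [Matrix.smul_mul, ← hg', Matrix.mul_smul, smul_smul, mul_inv_cancel₀ hm, one_smul]
  have hdet : (g' : Matrix (Fin n) (Fin n) k).det ≠ 0 := by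
    rw [g'.2]
    exact one_ne_zero
  have key : ∀ μ, IsEig X μ → ρ μ = 0 := by
    intro μ hμ
    have h1 : IsEig (((m : ℕ) : k) • X) (((m : ℕ) : k) * μ) := by
      obtain ⟨v, hv, hv'⟩ := hμ
      exact ⟨v, hv, by rw [Matrix.smul_mulVec, hv', smul_smul]⟩
    obtain ⟨i, hi⟩ := hCeig _ (h1.conj_symm hdet hgC)
    have h2 := congrArg ρ hi
    rw [hcoeff0, hmρ, map_sub, Matrix.smul_apply, smul_eq_mul, hmρ] at h2
    have h3 : ρ (f i : k) = f i := by
      have := hρq (f i)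
      rwa [Rat.cast_intCast] at this
    rw [h3, hf, sub_self] at h2
    exact (mul_eq_zero.1 h2).resolve_left (by exact_mod_cast m.ne_zero)
  refine ⟨⟨X, hXtr⟩, ⟨PX⟩, noRatEigenvalue_of_isEig fun μ ν q hμ hν h => ?_, ?_⟩
  · rw [← hρq q, ← h, map_sub, key μ hμ, key ν hν, sub_self]
  · have hr : GaugeEquiv A B' := (gaugeSetoid n k).iseqv.trans hAB ⟨_, rfl⟩
    refine ⟨m, (gaugeSetoid n k).iseqv.trans (hr.pullback m) ?_⟩
    refine (gaugeSetoid n k).iseqv.trans ((gaugeSetoid n k).iseqv.symm hC) ?_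
    rw [pullback_constConn]
    exact constConn_gaugeEquiv _ hdet hgC

end Levelt

end RegSL

end

noncomputable section

namespace RegSL

open Matrix

/-! ### Shifting the eigenvalues of Jordan blocks -/

section Shift

variable {n : ℕ} {k : Type*} [Field k] {X : Matrix (Fin n) (Fin n) k}

/-- The index of the Jordan block containing a row. -/
def JordanForm.block (P : JordanForm X) (q : Fin n) : Fin P.r :=
  (finSigmaFinEquiv.symm ((finCongr P.sum_eq).symm q)).1

theorem JordanForm.block_apply (P : JordanForm X) (p : Σ i, Fin (P.a i)) :
    P.block (finCongr P.sum_eq (finSigmaFinEquiv p)) = p.1 := by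
  rw [JordanForm.block, Equiv.symm_apply_apply, Equiv.symm_apply_apply]

theorem JordanForm.exists_eq (P : JordanForm X) (q : Fin n) :
    ∃ p : Σ i, Fin (P.a i), finCongr P.sum_eq (finSigmaFinEquiv p) = q :=
  (finSigmaFinEquiv.trans (finCongr P.sum_eq)).surjective q

theorem JordanForm.block_eq (P : JordanForm X) {i j : Fin n} (h : X i j ≠ 0) :
    P.block i = P.block j := by
  obtain ⟨p, rfl⟩ := P.exists_eq i
  obtain ⟨q, rfl⟩ := P.exists_eq j
  rw [P.block_apply, P.block_apply]
  rw [P.basis_aux] at h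
  by_contra hne
  obtain ⟨i₁, p⟩ := p
  obtain ⟨i₂, q⟩ := q
  exact h (Matrix.blockDiagonal'_apply_ne _ _ _ hne)

theorem JordanForm.apply_self (P : JordanForm X) (i : Fin n) : X i i = P.x (P.block i) := by
  obtain ⟨⟨i, p⟩, rfl⟩ := P.exists_eq i
  rw [P.block_apply, P.basis_aux, Matrix.blockDiagonal'_apply_eq, jordanBlock, Matrix.of_apply,
    if_pos rfl]

/-- The Jordan matrix obtained by adding scalars to the Jordan blocks. -/
def JordanForm.shift (P : JordanForm X) (c : Fin P.r → k) :
    JordanForm (X + Matrix.diagonal fun q => c (P.block q)) where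
  r := P.r
  x i := P.x i + c i
  a := P.a
  a_pos := P.a_pos
  sum_eq := P.sum_eq
  eq := by
    ext1 i j
    obtain ⟨p, rfl⟩ := P.exists_eq i
    obtain ⟨q, rfl⟩ := P.exists_eq j
    rw [Matrix.add_apply, P.basis_aux]
    simp only [Matrix.reindex_apply, Matrix.submatrix_apply, Equiv.symm_apply_apply, jordanMatrix]
    obtain ⟨i₁, p⟩ := p
    obtain ⟨i₂, q⟩ := q
    by_cases hi : i₁ = i₂
    · subst hi
      rw [Matrix.blockDiagonal'_apply_eq, Matrix.blockDiagonal'_apply_eq]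
      simp only [jordanBlock, Matrix.of_apply]
      by_cases hpq : p = q
      · subst hpq
        rw [Matrix.diagonal_apply_eq, if_pos rfl, if_pos rfl, P.block_apply]
      · rw [if_neg hpq, if_neg hpq, Matrix.diagonal_apply_ne, add_zero]
        intro h
        have h1 := finSigmaFinEquiv.injective ((finCongr P.sum_eq).injective h)
        exact hpq (by simpa using h1)
    · rw [Matrix.blockDiagonal'_apply_ne _ _ _ hi, Matrix.blockDiagonal'_apply_ne _ _ _ hi,
        Matrix.diagonal_apply_ne, add_zero]
      intro h
      have h1 := finSigmaFinEquiv.injective ((finCongr P.sum_eq).injective h)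
      exact hi (congrArg Sigma.fst h1)

/-- Nonzero entries of X stay within one block, on which the diagonal matrix is scalar. With K =
k((z)) this applies to shearing matrices. -/
theorem JordanForm.commute_diagonal {K : Type*} [Field K] (φ : k →+* K) (P : JordanForm X)
    (d : Fin P.r → K) :
    (Matrix.diagonal fun q => d (P.block q)) * X.map φ =
      X.map φ * Matrix.diagonal fun q => d (P.block q) := by
  ext1 i j
  rw [Matrix.diagonal_mul, Matrix.mul_diagonal, Matrix.map_apply]
  by_cases h : X i j = 0
  · rw [h, map_zero, mul_zero, zero_mul]
  · rw [P.block_eq h, mul_comm]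

theorem JordanForm.exists_of_isEig (P : JordanForm X) {μ : k} (h : IsEig X μ) :
    ∃ i, μ = P.x i := by
  obtain ⟨i, hi⟩ := isEig_of_triangular (fun _ => 0)
    (fun i j hij h => Or.inr ⟨rfl, lt_of_le_of_ne (P.apply_ne_zero h).1 hij⟩) h
  exact ⟨_, hi.trans (P.apply_self i)⟩

theorem JordanForm.exists_eigenvector (P : JordanForm X) (i : Fin P.r) :
    ∃ v, v ≠ 0 ∧ X *ᵥ v = P.x i • v :=
  ⟨P.basis ⟨i, 0, P.a_pos i⟩, P.basis.ne_zero _, P.isJordan.apply_basis.1 i (P.a_pos i)⟩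

end Shift

/-! ### Related constant connections -/

section Related

theorem map_C_smul {n : ℕ} {k : Type*} [Field k] (c : k) (M : Matrix (Fin n) (Fin n) k) :
    (c • M).map (HahnSeries.C : k →+* LField k) =
      (HahnSeries.C c : LField k) • M.map (HahnSeries.C : k →+* LField k) := by
  ext1 a b
  exact map_mul (HahnSeries.C : k →+* LField k) _ _

variable {n : ℕ} {k : Type*} [Field k] [IsAlgClosed k] [CharZero k]
  {X Y : LieAlgebra.SpecialLinear.sl (Fin n) k}

/-- Jordan matrices differing rationally after block permutation give related connections. -/
theorem related_of_differRationally (h : DifferRationally X.1 Y.1) :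
    Related (constConn X) (constConn Y) := by
  obtain ⟨P, Q, τ, hτ⟩ := h
  choose ha q hq using hτ
  obtain ⟨m, f, hf⟩ := exists_common_den q
  have hf' : ∀ i, (f i : k) = ((m : ℕ) : k) * (q i : k) := by
    intro i
    exact_mod_cast congrArg (fun q : ℚ => (q : k)) (hf i)
  have hx : ∀ i, Q.x (τ i) = P.x i + -(q i : k) := by
    intro i
    rw [← hq]
    ring
  let P' := P.shift fun i => -(q i : k)
  obtain ⟨L, hL⟩ := exists_linearEquiv_jco_eq P'.basis Q.basis τ fun i => (ha i).symm
  have hLf := P'.isJordan.comm_of_jco_eq hL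
    hx Q.isJordan
  obtain ⟨g, hg⟩ := exists_GL_of_linearEquiv L
  have hgX : g.1 * (X.1 + Matrix.diagonal fun i => -(q (P.block i) : k)) = Y.1 * g.1 :=
    mul_eq_mul_of_toLin' fun v => by
      rw [hg]
      exact hLf v
  have hZ := P.commute_diagonal (HahnSeries.C : k →+* LField k)
    fun i => HahnSeries.single (-f i) (1 : k)
  refine ⟨m, ?_⟩
  rw [pullback_constConn, pullback_constConn]
  -- The shearing shifts the eigenvalue m x_i of block i by -f i = -m q_i, and g permutes the
  -- blocks.
  refine gaugeEquiv_of_intertwine (g.1.map (HahnSeries.C : k →+* LField k) *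
    Matrix.diagonal fun i => HahnSeries.single (-f (P.block i)) (1 : k)) ?_ ?_
  · rw [Matrix.det_mul, Matrix.det_diagonal, map_C_det]
    refine mul_ne_zero (fun h0 => GL_det_ne_zero g
      ((HahnSeries.C : k →+* LField k).injective (by rw [h0, map_zero])))
      (Finset.prod_ne_zero_iff.2 fun i _ => HahnSeries.single_ne_zero one_ne_zero)
  · change _ + _ * (((m : ℕ) : k) • X.1).map (HahnSeries.C : k →+* LField k) =
      (((m : ℕ) : k) • Y.1).map (HahnSeries.C : k →+* LField k) * _
    have h1 : (((m : ℕ) : k) • Y.1).map (HahnSeries.C : k →+* LField k) *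
        g.1.map (HahnSeries.C : k →+* LField k) = g.1.map (HahnSeries.C : k →+* LField k) *
        ((((m : ℕ) : k) • X.1).map (HahnSeries.C : k →+* LField k) +
          (Matrix.diagonal fun i => ((-f (P.block i) : ℤ) : k)).map
            (HahnSeries.C : k →+* LField k)) := by
      rw [← Matrix.map_add _ (map_add _), ← Matrix.map_mul, ← Matrix.map_mul, Matrix.smul_mul,
        ← hgX, ← Matrix.mul_smul, smul_add, ← Matrix.diagonal_smul]
      congr 5
      funext i
      change ((m : ℕ) : k) * -(q (P.block i) : k) = _
      rw [Int.cast_neg, hf']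
      ring
    have hd : ((Matrix.diagonal fun i => ((-f (P.block i) : ℤ) : k)).map
        (HahnSeries.C : k →+* LField k)) *
        (Matrix.diagonal fun i => HahnSeries.single (-f (P.block i)) (1 : k)) =
        (Matrix.diagonal fun i => HahnSeries.single (-f (P.block i)) (1 : k)) *
        ((Matrix.diagonal fun i => ((-f (P.block i) : ℤ) : k)).map
          (HahnSeries.C : k →+* LField k)) := by
      rw [Matrix.diagonal_map (map_zero _), Matrix.diagonal_mul_diagonal,
        Matrix.diagonal_mul_diagonal]
      congr 1
      funext i
      exact mul_comm _ _
    have hmX : (Matrix.diagonal fun i => HahnSeries.single (-f (P.block i)) (1 : k)) *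
        (((m : ℕ) : k) • X.1).map (HahnSeries.C : k →+* LField k) =
        (((m : ℕ) : k) • X.1).map (HahnSeries.C : k →+* LField k) *
          (Matrix.diagonal fun i => HahnSeries.single (-f (P.block i)) (1 : k)) := by
      rw [map_C_smul, Matrix.mul_smul, hZ, Matrix.smul_mul]
    rw [eulerMat_mul, eulerMat_map_C, Matrix.zero_mul, zero_add, eulerMat_diagonal_single,
      ← Matrix.mul_assoc (Matrix.map _ _) (Matrix.map _ _), h1, Matrix.mul_assoc, Matrix.mul_assoc,
      Matrix.add_mul, hd, hmX, Matrix.mul_add, add_comm]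

/-- Related Jordan matrices without nonzero rational eigenvalues of `ad` differ rationally after
block permutation. -/
theorem differRationally_of_related (P : JordanForm X.1) (Q : JordanForm Y.1)
    (hY : NoRatEigenvalue Y) (h : Related (constConn X) (constConn Y)) :
    DifferRationally X.1 Y.1 := by
  obtain ⟨m, g, hg⟩ := h
  rw [pullback_constConn, pullback_constConn, gauge_eq_iff] at hg
  have hm : ((m : ℕ) : k) ≠ 0 := by exact_mod_cast m.ne_zero
  have hco : ∀ i : ℤ, (i : k) • coeffMat g.1 i + ((m : ℕ) : k) • (coeffMat g.1 i * X.1) =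
      ((m : ℕ) : k) • (Y.1 * coeffMat g.1 i) := by
    intro i
    have h1 := coeffMat_intertwine hg i
    change _ + coeffMat g.1 i * (((m : ℕ) : k) • X.1) = (((m : ℕ) : k) • Y.1) * _ at h1
    rwa [Matrix.mul_smul, Matrix.smul_mul] at h1
  -- As g is invertible, some coefficient g_j does not kill the eigenvector v of X; the coefficient
  -- equation then makes g_j v an eigenvector of Y.
  have hj : ∀ i, ∃ j : ℤ, IsEig Y.1 (P.x i + (j : k) / ((m : ℕ) : k)) := by
    intro i
    obtain ⟨v, hv, hXv⟩ := P.exists_eigenvector i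
    have hex : ∃ j, coeffMat g.1 j *ᵥ v ≠ 0 := by
      by_contra hne
      push Not at hne
      have hgv : g.1 *ᵥ (fun a => (HahnSeries.C (v a) : LField k)) = 0 := by
        funext a
        ext j
        have h1 := congrFun (hne j) a
        simp only [Matrix.mulVec, dotProduct, HahnSeries.coeff_sum] at h1 ⊢
        refine Eq.trans (Finset.sum_congr rfl fun b _ => ?_) h1
        rw [HahnSeries.C_apply, HahnSeries.coeff_mul_single_zero]
        rfl
      obtain ⟨a, ha⟩ := Function.ne_iff.1 hv
      have h0 : g.1.det = 0 := Matrix.exists_mulVec_eq_zero_iff.1 ⟨_, fun h0 => ha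
        ((HahnSeries.C : k →+* LField k).injective (by
          rw [Pi.zero_apply, map_zero]
          exact congrFun h0 a)), hgv⟩
      rw [g.2] at h0
      exact one_ne_zero h0
    obtain ⟨j, hj⟩ := hex
    refine ⟨j, _, hj, ?_⟩
    have h1 := congrArg (fun M => M *ᵥ v) (hco j)
    beta_reduce at h1
    rw [Matrix.add_mulVec, Matrix.smul_mulVec, Matrix.smul_mulVec, Matrix.smul_mulVec,
      ← Matrix.mulVec_mulVec, ← Matrix.mulVec_mulVec, hXv, Matrix.mulVec_smul] at h1
    rw [← (smul_right_injective _ hm).eq_iff]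
    rw [← h1, smul_smul, smul_smul, ← add_smul]
    congr 1
    field_simp
    ring
  choose j hj using hj
  -- Each block of X is shifted so that its eigenvalue becomes an eigenvalue of Y; after the
  -- corresponding shearing, w intertwines mX' with mY.
  let c : Fin P.r → k := fun i => (j i : k) / ((m : ℕ) : k)
  let X' := X.1 + Matrix.diagonal fun q => c (P.block q)
  have hX' : X' = X.1 + Matrix.diagonal fun q => c (P.block q) := rfl
  let P' : JordanForm X' := P.shift c
  let Z : Matrix (Fin n) (Fin n) (LField k) :=
    Matrix.diagonal fun i => HahnSeries.single (-j (P.block i)) (1 : k)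
  have hZX : Z * (X.1.map (HahnSeries.C : k →+* LField k)) =
      X.1.map (HahnSeries.C : k →+* LField k) * Z :=
    P.commute_diagonal (HahnSeries.C : k →+* LField k) fun i => HahnSeries.single (-j i) (1 : k)
  let w : Matrix (Fin n) (Fin n) (LField k) := g.1 * Z
  have hw : eulerMat w + w * (((m : ℕ) : k) • X').map (HahnSeries.C : k →+* LField k) =
      (((m : ℕ) : k) • Y.1).map (HahnSeries.C : k →+* LField k) * w := by
    have h1 : eulerMat g.1 + g.1 * (((m : ℕ) : k) • X.1).map (HahnSeries.C : k →+* LField k) =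
      (((m : ℕ) : k) • Y.1).map (HahnSeries.C : k →+* LField k) * g.1 := hg
    have h2 : ((m : ℕ) : k) • X' = ((m : ℕ) : k) • X.1 -
        Matrix.diagonal fun i => ((-j (P.block i) : ℤ) : k) := by
      rw [hX', smul_add, sub_eq_add_neg, ← Matrix.diagonal_smul, Matrix.diagonal_neg]
      congr 2
      funext i
      change ((m : ℕ) : k) * ((j (P.block i) : k) / ((m : ℕ) : k)) = -_
      rw [mul_div_cancel₀ _ hm, Int.cast_neg, neg_neg]
    have h3 : eulerMat Z = Z * (Matrix.diagonal fun i => ((-j (P.block i) : ℤ) : k)).map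
      (HahnSeries.C : k →+* LField k) := eulerMat_diagonal_single _
    have h4 : Z * (((m : ℕ) : k) • X.1).map (HahnSeries.C : k →+* LField k) =
        (((m : ℕ) : k) • X.1).map (HahnSeries.C : k →+* LField k) * Z := by
      rw [map_C_smul, Matrix.mul_smul, hZX, Matrix.smul_mul]
    rw [h2, Matrix.map_sub _ (map_sub _), eulerMat_mul, h3, Matrix.mul_sub, Matrix.mul_assoc g.1 Z,
      h4, ← Matrix.mul_assoc, ← Matrix.mul_assoc, ← Matrix.mul_assoc, ← h1, Matrix.add_mul,
      Matrix.mul_assoc g.1 Z]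
    abel
  have hwco : ∀ i : ℤ, Y.1 * coeffMat w i =
      coeffMat w i * (X' + (((i : k) / ((m : ℕ) : k)) • 1)) := by
    intro i
    have h1 := congrArg (fun g => coeffMat g i) hw
    beta_reduce at h1
    rw [coeffMat_add, coeffMat_eulerMat, coeffMat_mul_C, coeffMat_C_mul, Matrix.mul_smul,
      Matrix.smul_mul] at h1
    rw [← (smul_right_injective _ hm).eq_iff]
    rw [← h1, Matrix.mul_add (coeffMat w i) X', Matrix.mul_smul, Matrix.mul_one, smul_add, smul_smul,
      mul_div_cancel₀ _ hm, add_comm]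
  -- A nonzero coefficient yields a common eigenvalue μ of Y and X' + i/m. Eigenvalues of X' are
  -- eigenvalues of Y, so μ and μ - i/m both belong to Y, whence i = 0. Thus w is constant and
  -- conjugates X' into Y.
  have hw0 : ∀ i : ℤ, i ≠ 0 → coeffMat w i = 0 := by
    intro i hi
    by_contra hne
    obtain ⟨μ, hμ, hμY⟩ := exists_common_isEig hne (hwco i)
    obtain ⟨i', hi'⟩ := P'.exists_of_isEig hμ.add_scalar
    have h1 : IsEig Y.1 (μ - (i : k) / ((m : ℕ) : k)) := by
      rw [hi']
      exact hj i'
    have h2 := hY.eq_zero_of_isEig (q := (i : ℚ) / ((m : ℕ) : ℚ)) hμY h1 (by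
      push_cast
      ring)
    exact div_ne_zero (by exact_mod_cast hi) (by exact_mod_cast m.ne_zero) h2
  have hdet : (coeffMat w 0).det ≠ 0 := by
    intro h0
    have h1 : w.det ≠ 0 := by
      rw [Matrix.det_mul, Matrix.det_diagonal, g.2, one_mul]
      exact Finset.prod_ne_zero_iff.2 fun i _ => HahnSeries.single_ne_zero one_ne_zero
    rw [eq_map_C_of_coeffMat hw0, map_C_det, h0, map_zero] at h1
    exact h1 rfl
  have hint := hwco 0
  rw [Int.cast_zero, zero_div, zero_smul, add_zero] at hint
  obtain ⟨τ, hτ⟩ := P'.exists_equiv Q (Matrix.GeneralLinearGroup.mkOfDetNeZero _ hdet) hint.symm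
  refine ⟨P, Q, τ, fun i => ⟨(hτ i).1.symm, -((j i : ℚ) / ((m : ℕ) : ℚ)), ?_⟩⟩
  refine (congrArg (fun y => P.x i - y) (hτ i).2).trans ?_
  change P.x i - (P.x i + (j i : k) / ((m : ℕ) : k)) = _
  push_cast
  ring

end Related

end RegSL

end

noncomputable section

namespace RegSL

/-! ### Assembly of the main theorem -/

theorem relClasses_eq_of_related {n : ℕ} {k : Type*} [Field k] {A B : Conn n k} (h : Related A B) :
    relClasses A = relClasses B := by
  ext c
  exact ⟨fun ⟨C, hC, hc⟩ => ⟨C, h.symm.trans hC, hc⟩, fun ⟨C, hC, hc⟩ => ⟨C, h.trans hC, hc⟩⟩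

end RegSL

end

theorem mainTheorem3 {k : Type*} [Field k] [IsAlgClosed k] [CharZero k] (n : ℕ)
    (γ : RegSL.AbsGal k) (hγ : RegSL.IsProcyclicGenerator k γ) :
    ∃ Φ : (X : RegSL.JZero n k) → RegSL.TorsClass X.1.1 → RegSL.GaugeClass n k,
      (∀ (X : RegSL.JZero n k) (δ : RegSL.TorsClass X.1.1) (c : RegSL.GaugeClass n k),
        Φ X δ = c ↔ RegSL.Corresponds γ X.1 δ c) ∧
      (∀ X : RegSL.JZero n k,
        Set.BijOn (Φ X) Set.univ (RegSL.relClasses (RegSL.constConn X.1))) ∧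
      Set.range (fun p : (X : RegSL.JZero n k) × RegSL.TorsClass X.1.1 => Φ p.1 p.2) =
        RegSL.regularClasses n k ∧
      (∀ X Y : RegSL.JZero n k,
        RegSL.Related (RegSL.constConn X.1) (RegSL.constConn Y.1) ↔
          RegSL.DifferRationally X.1.1 Y.1.1) ∧
      ∃ can : (X Y : RegSL.JZero n k) → RegSL.DifferRationally X.1.1 Y.1.1 →
          (RegSL.TorsClass X.1.1 ≃ RegSL.TorsClass Y.1.1),
        (∀ (X Y : RegSL.JZero n k) (h : RegSL.DifferRationally X.1.1 Y.1.1)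
          (f : RegSL.TorsClass X.1.1 → RegSL.TorsClass Y.1.1),
          (∀ δ : RegSL.TorsClass X.1.1, Φ Y (f δ) = Φ X δ) ↔ f = ⇑(can X Y h)) ∧
        ∀ (X Y : RegSL.JZero n k) (δ : RegSL.TorsClass X.1.1) (ε : RegSL.TorsClass Y.1.1),
          Φ X δ = Φ Y ε ↔ ∃ h : RegSL.DifferRationally X.1.1 Y.1.1, can X Y h δ = ε := by
  have hT1 : ∀ (X : RegSL.JZero n k) (δ : RegSL.TorsClass X.1.1),
      ∃ B : RegSL.Conn n k, RegSL.IsFirstKind B ∧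
        RegSL.Corresponds γ X.1 δ (RegSL.gaugeClass B) := fun X δ =>
    RegSL.exists_isFirstKind_corresponds hγ X.2.1.some δ
  choose B hB hBc using hT1
  -- Choosing representatives of the first kind makes all values regular by construction; `hΦ` shows
  -- independence of the choice.
  let Φ : (X : RegSL.JZero n k) → RegSL.TorsClass X.1.1 → RegSL.GaugeClass n k :=
    fun X δ => RegSL.gaugeClass (B X δ)
  have hΦ : ∀ X δ c, Φ X δ = c ↔ RegSL.Corresponds γ X.1 δ c := fun X δ c =>
    ⟨fun h => by rw [← h]; exact hBc X δ, fun h => RegSL.corresponds_unique hγ X.2.1.some (hBc X δ) h⟩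
  have hbij : ∀ X : RegSL.JZero n k,
      Set.BijOn (Φ X) Set.univ (RegSL.relClasses (RegSL.constConn X.1)) := fun X =>
    ⟨fun δ _ => RegSL.mem_relClasses_of_corresponds (hBc X δ),
      fun δ _ δ' _ h => RegSL.corresponds_injective hγ X.2.1.some X.2.2 ((hΦ X δ _).1 h)
        (hBc X δ'),
      fun c hc => by
        obtain ⟨δ, hδ⟩ := RegSL.exists_corresponds_of_mem_relClasses hγ X.2.1.some X.2.2 hc
        exact ⟨δ, trivial, (hΦ X δ c).2 hδ⟩⟩
  have hinj : ∀ X, Function.Injective (Φ X) := fun X δ δ' h =>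
    (hbij X).injOn trivial trivial h
  have hrel : ∀ X Y : RegSL.JZero n k,
      RegSL.Related (RegSL.constConn X.1) (RegSL.constConn Y.1) ↔
        RegSL.DifferRationally X.1.1 Y.1.1 := fun X Y =>
    ⟨RegSL.differRationally_of_related X.2.1.some Y.2.1.some Y.2.2,
      RegSL.related_of_differRationally⟩
  -- Φ X and Φ Y are bijections onto the same set of classes, so can is the inverse of Φ Y after Φ
  -- X.
  have hcan : ∀ X Y : RegSL.JZero n k, RegSL.DifferRationally X.1.1 Y.1.1 →
      ∃ e : RegSL.TorsClass X.1.1 ≃ RegSL.TorsClass Y.1.1, ∀ δ, Φ Y (e δ) = Φ X δ := by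
    intro X Y h
    have hXY := RegSL.relClasses_eq_of_related ((hrel X Y).2 h)
    have hex : ∀ δ, ∃ ε, Φ Y ε = Φ X δ := fun δ => by
      obtain ⟨ε, -, hε⟩ := (hbij Y).surjOn (hXY.subset <| (hbij X).mapsTo (Set.mem_univ δ))
      exact ⟨ε, hε⟩
    choose e he using hex
    refine ⟨Equiv.ofBijective e ⟨fun δ δ' hδ => hinj X ?_, fun ε => ?_⟩, he⟩
    · rw [← he, ← he, hδ]
    · obtain ⟨δ, -, hδ⟩ := (hbij X).surjOn (hXY.symm.subset <| (hbij Y).mapsTo (Set.mem_univ ε))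
      exact ⟨δ, hinj Y ((he δ).trans hδ)⟩
  choose can hcan using hcan
  refine ⟨Φ, hΦ, hbij, ?_, hrel, can, fun X Y h f => ⟨fun hf => ?_, ?_⟩, fun X Y δ ε => ⟨?_, ?_⟩⟩
  · ext c
    constructor
    · rintro ⟨⟨X, δ⟩, rfl⟩
      exact ⟨B X δ, ⟨B X δ, hB X δ, 1, RegSL.gauge_one _⟩, rfl⟩
    · rintro ⟨A, hA, rfl⟩
      obtain ⟨X, hX, hX', hAX⟩ := hA.exists_related
      obtain ⟨δ, -, hδ⟩ := (hbij ⟨X, hX, hX'⟩).surjOn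
        (RegSL.mem_relClasses_gaugeClass.2 hAX.symm)
      exact ⟨⟨⟨X, hX, hX'⟩, δ⟩, hδ⟩
  · funext δ
    exact hinj Y ((hf δ).trans (hcan X Y h δ).symm)
  · rintro rfl δ
    exact hcan X Y h δ
  · intro h
    obtain ⟨C, hC, hc⟩ := (hbij X).mapsTo (Set.mem_univ δ)
    obtain ⟨C', hC', hc'⟩ := (hbij Y).mapsTo (Set.mem_univ ε)
    -- A common class makes X dlog z and Y dlog z related to each other through it.
    have hCC : RegSL.Related C C' :=
      (RegSL.gaugeClass_eq_iff.1 (hc.trans (h.trans hc'.symm))).related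
    have hd := (hrel X Y).1 ((hC.trans hCC).trans hC'.symm)
    exact ⟨hd, hinj Y ((hcan X Y hd δ).trans h)⟩
  · rintro ⟨h, rfl⟩
    exact (hcan X Y h δ).symm
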